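/- Let $D=(0,1)$, $0<\alpha<2$, and let $A_\alpha=-(-\Delta)^{\alpha/2}$ be the nonlocal Laplacian $$A_\alpha f(x)=c_\alpha\,\mathrm{p.v.}\!\int_{\mathbb R\setminus\{0\}}\frac{f(x+y)-f(x)}{|y|^{1+\alpha}}\,dy ,\qquad c_\alpha>0\ \text{a constant}.$$ Let $H_0^{\alpha/2}(D)$ be the closure of $C_c^\infty(D)$ (functions extended by $0$ to $\mathbb R$) in $H^{\alpha/2}(\mathbb R)$, with the norm $\|u\|^2=\|u\|_{L^2}^2+\iint_{\mathbb R^2}\frac{|u(x)-u(y)|^2}{|x-y|^{1+\alpha}}\,dx\,dy$. Regard $A_\alpha$ as the unbounded operator in the real space $L^2(D)$ with domain $\{u\in H_0^{\alpha/2}(D): A_\alpha u\in L^2(D)\}$, where $A_\alpha u$ is taken in the sense of distributions on $D$. Then $A_\alpha$ generates a strongly continuous semigroup $(e^{tA_\alpha})_{t\ge0}$ on $L^2(D)$, and for every $u_0\in H_0^{\alpha/2}(D)$ there is $T>0$ such that the nonlocal Ginzburg–Landau equation $$u_t=A_\alpha u+u-u^3\ \ (x\in D,\ t>0),\qquad u|_{\mathbb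 R\setminus D}=0,\qquad u(\cdot,0)=u_0,$$ has exactly one solution $u\in C^0([0,T],H_0^{\alpha/2}(D))$. Here a solution is understood in the mild sense: $u-u^3\in L^1(0,T;L^2(D))$ and $$u(t)=e^{tA_\alpha}u_0+\int_0^t e^{(t-\tau)A_\alpha}\bigl(u(\tau)-u(\tau)^3\bigr)\,d\tau\qquad\text{for all }t\in[0,T].$$ -/

import Mathlib

open MeasureTheory Set Filter Topology
open scoped ContDiff ENNReal

namespace NonlocalGL

noncomputable section

/-- The spatial domain `D = (0,1)`. -/
def dom : Set ℝ := Ioo 0 1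

/-- The real Hilbert space `L²(D)`. -/
abbrev L2D : Type := Lp ℝ 2 ((volume : Measure ℝ).restrict dom)

/-- The extension of `u ∈ L²(D)` to the whole line by zero on the complement of `D`. -/
def zeroExt (u : L2D) : ℝ → ℝ := dom.indicator (u : ℝ → ℝ)

/-- `φ ∈ C_c^∞(D)`, seen as a function on the line that vanishes outside `D`. -/
def IsTest (φ : ℝ → ℝ) : Prop :=
  ContDiff ℝ ∞ φ ∧ HasCompactSupport φ ∧ tsupport φ ⊆ dom

/-- The squared norm of `H^{α/2}(ℝ)` with the Gagliardo seminorm,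
`∫ |f|² dx + ∬ |f(x) - f(y)|² / |x - y|^{1+α} dx dy`, with values in `[0,∞]`. -/
def sobolevSq (α : ℝ) (f : ℝ → ℝ) : ℝ≥0∞ :=
  (∫⁻ x, ENNReal.ofReal (f x ^ 2)) +
    ∫⁻ x, ∫⁻ y, ENNReal.ofReal ((f x - f y) ^ 2 / |x - y| ^ (1 + α))

/-- `u ∈ H₀^{α/2}(D)`: the extension of `u` by zero is in the closure of `C_c^∞(D)` for the norm
of `H^{α/2}(ℝ)`. -/
def MemH0 (α : ℝ) (u : L2D) : Prop :=
  ∀ ε : ℝ≥0∞, 0 < ε → ∃ φ : ℝ → ℝ, IsTest φ ∧ sobolevSq α (fun x => zeroExt u x - φ x) < ε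

/-- `u ∈ C⁰([0,T], H₀^{α/2}(D))`. -/
def ContinuousH0 (α T : ℝ) (u : ℝ → L2D) : Prop :=
  (∀ t ∈ Icc 0 T, MemH0 α (u t)) ∧
    ∀ t ∈ Icc 0 T,
      Tendsto (fun s => sobolevSq α (zeroExt (u s - u t))) (𝓝[Icc 0 T] t) (𝓝 0)

/-- The singular integral
`A_α φ(x) = c · p.v. ∫_{ℝ∖{0}} (φ(x+y) - φ(x)) / |y|^{1+α} dy = -(-Δ)^{α/2} φ(x)`,
as the limit `ε → 0+` of the integrals over `|y| > ε`. It is only applied to test functions, for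
which the limit exists at every point. -/
def singularIntegral (c α : ℝ) (φ : ℝ → ℝ) (x : ℝ) : ℝ :=
  limUnder (𝓝[>] (0 : ℝ)) fun ε : ℝ =>
    c * ∫ y in {y : ℝ | ε < |y|}, (φ (x + y) - φ x) / |y| ^ (1 + α)

/-- The graph of the nonlocal Laplacian `A_α` as an unbounded operator in `L²(D)`:
`u` is in `Dom(A_α)` with `A_α u = g` if `u ∈ H₀^{α/2}(D)` and `A_α u = g ∈ L²(D)` in the sense of
distributions on `D`, where `u` is extended by zero to the line. -/
def IsNonlocalLaplacian (c α : ℝ) (u g : L2D) : Prop :=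
  MemH0 α u ∧ ∀ φ : ℝ → ℝ, IsTest φ →
    ∫ x in dom, u x * singularIntegral c α φ x = ∫ x in dom, g x * φ x

/-- `S` (restricted to `t ≥ 0`) is a strongly continuous semigroup of bounded operators. -/
structure IsC0Semigroup (S : ℝ → L2D →L[ℝ] L2D) : Prop where
  zero : S 0 = ContinuousLinearMap.id ℝ L2D
  add : ∀ s t : ℝ, 0 ≤ s → 0 ≤ t → S (s + t) = (S s).comp (S t)
  tendsto : ∀ f : L2D, Tendsto (fun t => S t f) (𝓝[>] 0) (𝓝 f)

/-- `S t = e^{t A_α}` for `t ≥ 0`: `S` is a strongly continuous semigroup on `L²(D)` and its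
infinitesimal generator is `A_α`, with equality of domains. -/
def IsGeneratedSemigroup (c α : ℝ) (S : ℝ → L2D →L[ℝ] L2D) : Prop :=
  IsC0Semigroup S ∧ ∀ f g : L2D,
    IsNonlocalLaplacian c α f g ↔ Tendsto (fun t : ℝ => t⁻¹ • (S t f - f)) (𝓝[>] 0) (𝓝 g)

/-- `u` is a solution on `[0,T]` in `C⁰([0,T], H₀^{α/2}(D))` of `u_t = A_α u + u - u³`, `u = 0`
on the complement of `D`, `u(0) = u₀`, in the mild formulation
`u(t) = e^{tA_α} u₀ + ∫₀ᵗ e^{(t-τ)A_α} (u(τ) - u(τ)³) dτ`. Here `F` is the `L²(D)`-valued function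
`u - u³`, which has to be in `L¹(0,T; L²(D))`, so that the Bochner integral is meaningful. -/
def IsSolution (α T : ℝ) (S : ℝ → L2D →L[ℝ] L2D) (u₀ : L2D) (u : ℝ → L2D) : Prop :=
  ContinuousH0 α T u ∧
    ∃ F : ℝ → L2D, IntegrableOn F (Ioc 0 T) ∧
      (∀ᵐ τ ∂((volume : Measure ℝ).restrict (Ioc 0 T)),
        ∀ᵐ x ∂((volume : Measure ℝ).restrict dom), F τ x = u τ x - u τ x ^ 3) ∧
      ∀ t ∈ Icc 0 T, u t = S t u₀ + ∫ τ in (0 : ℝ)..t, S (t - τ) (F τ)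

end

end NonlocalGL

/-! The linear part is Hilbert space theory. `H₀^{α/2}(D)` is realised as the closure of the pairs
`(φ, φ(x) - φ(y))`, `φ` a test function, in `L²(D) × L²(μ)`, where `μ = (c/2)|x-y|^{-1-α} dx dy`. If
`J` embeds this space `V` into `L²(D)`, then `J J*` is the resolvent `(1 - A)⁻¹` of the self-adjoint
operator `A ≤ 0` of the form. Exponentials of the Yosida approximations converge to a contraction
semigroup with generator `A` (`IsYosidaLimit.generator_iff`), and symmetrizing the singular integral
against test functions identifies `A` with `A_α` (`isNonlocalLaplacian_iff`).

The difficulty is the cubic term. For small `α` the form domain does not embed in `L⁶(D)`, so `u³`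
need not be in `L²(D)` and a plain contraction argument in `C⁰([0,T], H₀^{α/2}(D))` fails. The sign
of `-u³` compensates in three ways.

(1) The function `ψ(t) = (n⁻² + t)^{-1/2}` is a supersolution up to time `1/4`, so a solution from
data of height `n` satisfies `|u(t)| ≤ t^{-1/2}` whatever `n` is. The form norm controls
`L^{2+2α}(D)` (`exists_lintegral_rpow_le`); interpolation gives `‖u - u³‖ ≤ C t^{α/2-1}`, which is
integrable at `0`.

(2) The slopes of `s - s³` are at most `1`, so two solutions satisfy `‖u(t) - v(t)‖ ≤ e^t ‖u(0) -
v(0)‖`.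

(3) For the same reason the form norm grows at most by the factor `e^t`. At time `0` this bound and
convergence in `L²(D)` force convergence in the form norm; at positive times continuity comes from
the smoothing of the semigroup.

These comparisons are made without differentiating mild solutions. Replacing `S(t)` by `e^{-Kt}
S(t)` and the forcing `F` by `K u + F` does not change a mild solution
(`IsEvolution.mild_expShift`); with a truncation at height `n` and `K = 3n²`, the new nonlinearity
is increasing with slopes in `[0, K+1]`. The semigroup preserves the unit balls of `L^∞(D)` and of
`V`, and Duhamel integrals are averages, so they respect multiples of these closed convex sets,
which are described by support functions (`PolarLE`).

Existence: clamp the datum at height `k + 2`, solve the truncated equation by Picard iteration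
inside the barrier, and let `k → ∞` using (2), with (1) as the dominating function. Uniqueness: for
unbounded solutions no single `K` works, but the defect in the Lipschitz bound with constant `k + 1`
tends to `0` as `k → ∞` (`tendsto_defect`), and Gronwall's inequality with dominated convergence
concludes. -/

namespace NonlocalGL

noncomputable section

open scoped InnerProductSpace

/-! ### Contraction semigroups of nonpositive self-adjoint operators, by Yosida approximation. -/

section Semigroup

variable {H : Type*} [NormedAddCommGroup H] [InnerProductSpace ℝ H]

/-- `R` is a resolvent `(1 - A)⁻¹` of a nonpositive self-adjoint operator `A`. -/
structure IsUnitResolvent (R : H →L[ℝ] H) : Prop where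
  symm : ∀ x y, ⟪R x, y⟫_ℝ = ⟪x, R y⟫_ℝ
  sq_le : ∀ x, ‖R x‖ ^ 2 ≤ ⟪R x, x⟫_ℝ
  inj : ∀ x, R x = 0 → x = 0

/-- The inverse of `κ + (1 - κ) R`. -/
def resInv (R : H →L[ℝ] H) (κ : ℝ) : H →L[ℝ] H := Ring.inverse (1 - (1 - κ) • (1 - R))

/-- The resolvent `(1 - κ A)⁻¹`, where `R = (1 - A)⁻¹`. -/
def resolv (R : H →L[ℝ] H) (κ : ℝ) : H →L[ℝ] H := R * resInv R κ

/-- The Yosida approximation `A (1 - κ A)⁻¹`, where `R = (1 - A)⁻¹`. -/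
def yosida (R : H →L[ℝ] H) (κ : ℝ) : H →L[ℝ] H := (R - 1) * resInv R κ

variable {R : H →L[ℝ] H}

/-- Expanding the square, `‖x - R x‖² = ‖x‖² - 2⟪R x, x⟫ + ‖R x‖² ≤ ‖x‖² - ‖R x‖²`. -/
theorem IsUnitResolvent.norm_one_sub_le (hR : IsUnitResolvent R) : ‖1 - R‖ ≤ 1 := by
  refine ContinuousLinearMap.opNorm_le_bound _ zero_le_one fun x => ?_
  have h1 := hR.sq_le x
  have h2 : ‖(1 - R) x‖ ^ 2 ≤ (1 * ‖x‖) ^ 2 := by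
    have : (1 - R) x = x - R x := rfl
    rw [this, @norm_sub_sq_real, one_mul, real_inner_comm]
    nlinarith [sq_nonneg ‖R x‖]
  exact le_of_sq_le_sq h2 (by positivity)

variable [CompleteSpace H]

/-- The factor `1 - κ < 1` makes the Neumann series converge. -/
theorem IsUnitResolvent.isUnit (hR : IsUnitResolvent R) {κ : ℝ} (h0 : 0 < κ) (h1 : κ ≤ 1) :
    IsUnit (1 - (1 - κ) • (1 - R)) := by
  refine isUnit_one_sub_of_norm_lt_one ?_
  rw [norm_smul, Real.norm_of_nonneg (by linarith)]
  have := hR.norm_one_sub_le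
  nlinarith [norm_nonneg (1 - R)]

theorem IsUnitResolvent.mul_resInv (hR : IsUnitResolvent R) {κ : ℝ} (h0 : 0 < κ) (h1 : κ ≤ 1) :
    (1 - (1 - κ) • (1 - R)) * resInv R κ = 1 :=
  Ring.mul_inverse_cancel _ (hR.isUnit h0 h1)

/-- `f = κ p + (1 - κ) R p` for `p = (κ + (1 - κ) R)⁻¹ f`. -/
theorem IsUnitResolvent.resInv_spec (hR : IsUnitResolvent R) {κ : ℝ} (h0 : 0 < κ) (h1 : κ ≤ 1)
    (f : H) : f = κ • resInv R κ f + (1 - κ) • R (resInv R κ f) := by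
  have h := congrArg (fun T : H →L[ℝ] H => T f) (hR.mul_resInv h0 h1)
  have h2 : (1 - (1 - κ) • (1 - R)) (resInv R κ f) = f := h
  have h3 : (1 - (1 - κ) • (1 - R)) (resInv R κ f)
    = resInv R κ f - (1 - κ) • (resInv R κ f - R (resInv R κ f)) := rfl
  rw [h3] at h2
  nth_rewrite 1 [← h2]
  module

omit [CompleteSpace H] in
-- Neither `κ` nor `R` is restricted: `Ring.inverse` of a non-unit is `0`, which commutes with
-- everything.
theorem resInv_commute (R : H →L[ℝ] H) (κ : ℝ) {T : H →L[ℝ] H} (hT : Commute T R) :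
    Commute T (resInv R κ) := by
  have hc : Commute T (1 - (1 - κ) • (1 - R)) :=
    (Commute.one_right _).sub_right (((Commute.one_right _).sub_right hT).smul_right _)
  rw [resInv]
  by_cases hu : IsUnit (1 - (1 - κ) • (1 - R))
  · obtain ⟨U, hU⟩ := hu
    rw [← hU] at hc ⊢
    rw [Ring.inverse_unit]
    exact hc.units_inv_right
  · rw [Ring.inverse_non_unit _ hu]
    exact Commute.zero_right _

omit [CompleteSpace H] in
theorem commute_yosida {T : H →L[ℝ] H} (hT : Commute T R) (κ : ℝ) : Commute T (yosida R κ) :=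
  (hT.sub_right (Commute.one_right _)).mul_right (resInv_commute R κ hT)

omit [CompleteSpace H] in
theorem commute_resolv {T : H →L[ℝ] H} (hT : Commute T R) (κ : ℝ) : Commute T (resolv R κ) :=
  hT.mul_right (resInv_commute R κ hT)

omit [CompleteSpace H] in
theorem yosida_commute (κ μ : ℝ) : Commute (yosida R κ) (yosida R μ) :=
  commute_yosida (commute_yosida (Commute.refl R) κ).symm μ

omit [CompleteSpace H] in
theorem yosida_commute_resolv (κ μ : ℝ) : Commute (yosida R κ) (resolv R μ) :=
  commute_resolv (commute_yosida (Commute.refl R) κ).symm μ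

/-- This expresses the Yosida approximation as `κ⁻¹` times the resolvent minus the identity, which
turns its exponential into a Poisson average of powers of the resolvent. -/
theorem IsUnitResolvent.resolv_eq (hR : IsUnitResolvent R) {κ : ℝ} (h0 : 0 < κ) (h1 : κ ≤ 1) :
    resolv R κ = 1 + κ • yosida R κ := by
  ext f
  have h := hR.resInv_spec h0 h1 f
  have e1 : resolv R κ f = R (resInv R κ f) := rfl
  have e2 : (1 + κ • yosida R κ) f = f + κ • (R (resInv R κ f) - resInv R κ f) := rfl
  rw [e1, e2]
  nth_rewrite 2 [h]
  module

/-- With `f = κ p + (1 - κ) R p`, pairing with `R p` and using `‖R p‖² ≤ ⟪R p, p⟫` gives `‖R p‖² ≤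
⟪R p, f⟫`; then apply Cauchy–Schwarz. -/
theorem IsUnitResolvent.norm_resolv_le (hR : IsUnitResolvent R) {κ : ℝ} (h0 : 0 < κ)
    (h1 : κ ≤ 1) : ‖resolv R κ‖ ≤ 1 := by
  refine ContinuousLinearMap.opNorm_le_bound _ zero_le_one fun f => ?_
  rw [one_mul]
  have h := hR.resInv_spec h0 h1 f
  set p := resInv R κ f
  have e1 : resolv R κ f = R p := rfl
  rw [e1]
  have h2 := hR.sq_le p
  have h3 : ‖R p‖ ^ 2 ≤ ⟪R p, f⟫_ℝ := by
    rw [h, inner_add_right, inner_smul_right, inner_smul_right, real_inner_self_eq_norm_sq]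
    nlinarith
  have h4 := real_inner_le_norm (R p) f
  by_contra hlt
  push Not at hlt
  nlinarith [norm_nonneg f, norm_nonneg (R p)]

omit [CompleteSpace H] in
/-- If `u = R (u - g)`, that is `A u = g`, then `A_κ u = (1 - κ A)⁻¹ g`. -/
theorem yosida_apply (κ : ℝ) {u g : H} (h : u = R (u - g)) : yosida R κ u = resolv R κ g := by
  have hc : ∀ x, resInv R κ (R x) = R (resInv R κ x) := fun x =>
    (congrArg (fun T : H →L[ℝ] H => T x) (resInv_commute R κ (Commute.refl R)).eq).symm
  have e1 : yosida R κ u = R (resInv R κ u) - resInv R κ u := rfl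
  have e2 : resolv R κ g = R (resInv R κ g) := rfl
  have e3 : resInv R κ u = R (resInv R κ u) - R (resInv R κ g) := by
    conv_lhs => rw [h]
    rw [hc, map_sub, map_sub]
  rw [e1, e2]
  nth_rewrite 2 [e3]
  abel

theorem IsUnitResolvent.resolv_symm (hR : IsUnitResolvent R) {κ : ℝ} (h0 : 0 < κ) (h1 : κ ≤ 1)
    (x y : H) : ⟪resolv R κ x, y⟫_ℝ = ⟪x, resolv R κ y⟫_ℝ := by
  have hx := hR.resInv_spec h0 h1 x
  have hy := hR.resInv_spec h0 h1 y
  set p := resInv R κ x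
  set q := resInv R κ y
  have e1 : resolv R κ x = R p := rfl
  have e2 : resolv R κ y = R q := rfl
  rw [e1, e2]
  conv_lhs => rw [hy]
  conv_rhs => rw [hx]
  simp only [inner_add_left, inner_add_right, inner_smul_left, inner_smul_right, hR.symm, map_add,
    map_smul]
  simp

theorem IsUnitResolvent.yosida_symm (hR : IsUnitResolvent R) {κ : ℝ} (h0 : 0 < κ) (h1 : κ ≤ 1)
    (x y : H) : ⟪yosida R κ x, y⟫_ℝ = ⟪x, yosida R κ y⟫_ℝ := by
  have h := hR.resolv_symm h0 h1 x y
  rw [hR.resolv_eq h0 h1] at h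
  have e : ∀ z, (1 + κ • yosida R κ) z = z + κ • yosida R κ z := fun z => rfl
  rw [e, e, inner_add_left, inner_add_right, inner_smul_left, inner_smul_right] at h
  simpa [h0.ne'] using h

/-- The range of a unit resolvent is dense. -/
theorem IsUnitResolvent.dense_range (hR : IsUnitResolvent R) : DenseRange R := by
  have h : (LinearMap.range R.toLinearMap)ᗮ = ⊥ := by
    rw [Submodule.eq_bot_iff]
    intro x hx
    rw [Submodule.mem_orthogonal] at hx
    apply hR.inj
    have := hx (R (R x)) ⟨R x, rfl⟩
    rw [hR.symm, real_inner_self_eq_norm_sq] at this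
    simpa using this
  have h2 := (Submodule.dense_iff_topologicalClosure_eq_top).2
    ((Submodule.topologicalClosure_eq_top_iff).2 h)
  exact h2

/-- The elements `u = R (u - g)` of the domain are dense. -/
theorem IsUnitResolvent.exists_near (hR : IsUnitResolvent R) (x : H) {ε : ℝ} (hε : 0 < ε) :
    ∃ u g : H, u = R (u - g) ∧ ‖x - u‖ < ε := by
  obtain ⟨y, hy⟩ := hR.dense_range.exists_dist_lt x hε
  exact ⟨R y, R y - y, by simp, by simpa [dist_eq_norm] using hy⟩

/-- The semigroup generated by the Yosida approximation. -/
def yexp (R : H →L[ℝ] H) (κ t : ℝ) : H →L[ℝ] H := NormedSpace.exp (t • yosida R κ)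

theorem hasDerivAt_yexp (R : H →L[ℝ] H) (κ t : ℝ) (x : H) :
    HasDerivAt (fun s => yexp R κ s x) (yexp R κ t (yosida R κ x)) t := by
  have h := hasDerivAt_exp_smul_const (yosida R κ) t
  exact (ContinuousLinearMap.apply ℝ H x).hasFDerivAt.comp_hasDerivAt t h

omit [CompleteSpace H] in
theorem yexp_zero (R : H →L[ℝ] H) (κ : ℝ) : yexp R κ 0 = 1 := by simp [yexp]

theorem yexp_add (R : H →L[ℝ] H) (κ s t : ℝ) : yexp R κ (s + t) = yexp R κ s * yexp R κ t := by
  let _ := NormedAlgebra.restrictScalars ℚ ℝ (H →L[ℝ] H)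
  rw [yexp, add_smul, NormedSpace.exp_add_of_commute]
  · rfl
  · exact ((Commute.refl _).smul_left _).smul_right _

omit [CompleteSpace H] in
theorem commute_yexp {T : H →L[ℝ] H} {κ : ℝ} (hT : Commute T (yosida R κ)) (t : ℝ) :
    Commute T (yexp R κ t) := (hT.smul_right t).exp_right

/-- Since `t A_κ = (t/κ)(J_κ - 1)` with `J_κ` the resolvent, the exponential is an average of the
powers of `J_κ` with Poisson weights. Whatever convex property the resolvents preserve is thereby
inherited by the semigroup. -/
theorem yexp_hasSum (hR : IsUnitResolvent R) {κ : ℝ} (h0 : 0 < κ) (h1 : κ ≤ 1) (t : ℝ) (x : H) :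
    HasSum (fun n : ℕ => (Real.exp (-(t / κ)) * ((t / κ) ^ n / n.factorial)) •
      ((resolv R κ) ^ n) x) (yexp R κ t x) := by
  have e : t • yosida R κ = (t / κ) • resolv R κ + (-(t / κ)) • (1 : H →L[ℝ] H) := by
    rw [hR.resolv_eq h0 h1, smul_add, smul_smul, div_mul_cancel₀ _ h0.ne']
    module
  have e2 : NormedSpace.exp ((-(t / κ)) • (1 : H →L[ℝ] H)) = Real.exp (-(t / κ)) • 1 := by
    have := NormedSpace.algebraMap_exp_comm (𝕂 := ℝ) (𝔸 := H →L[ℝ] H) (-(t / κ))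
    rw [Algebra.algebraMap_eq_smul_one, Algebra.algebraMap_eq_smul_one, ← Real.exp_eq_exp_ℝ] at this
    exact this.symm
  have e3 : yexp R κ t = Real.exp (-(t / κ)) • NormedSpace.exp ((t / κ) • resolv R κ) := by
    let _ := NormedAlgebra.restrictScalars ℚ ℝ (H →L[ℝ] H)
    rw [yexp, e, NormedSpace.exp_add_of_commute, e2, mul_smul_comm, mul_one]
    exact ((Commute.one_right _).smul_right _)
  have h := NormedSpace.exp_series_hasSum_exp' (𝕂 := ℝ) ((t / κ) • resolv R κ)
  have h' := (ContinuousLinearMap.apply ℝ H x).hasSum h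
  have h'' := h'.const_smul (Real.exp (-(t / κ)))
  rw [e3]
  convert h'' using 2 with n
  · simp [smul_pow, smul_smul]
    ring_nf
  · rfl

theorem hasSum_exp_weights (s : ℝ) :
    HasSum (fun n : ℕ => Real.exp (-s) * (s ^ n / n.factorial)) 1 := by
  have h := (NormedSpace.expSeries_div_hasSum_exp (𝔸 := ℝ) s).mul_left (Real.exp (-s))
  rwa [← Real.exp_eq_exp_ℝ, ← Real.exp_add, neg_add_cancel, Real.exp_zero] at h

theorem IsUnitResolvent.norm_yexp_apply_le (hR : IsUnitResolvent R) {κ t : ℝ} (h0 : 0 < κ)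
    (h1 : κ ≤ 1) (ht : 0 ≤ t) (x : H) : ‖yexp R κ t x‖ ≤ ‖x‖ := by
  have h := (hasSum_exp_weights (t / κ)).mul_right ‖x‖
  rw [one_mul] at h
  refine (yexp_hasSum hR h0 h1 t x).norm_le_of_bounded h fun n => ?_
  have hw : 0 ≤ Real.exp (-(t / κ)) * ((t / κ) ^ n / n.factorial) := by positivity
  rw [norm_smul, Real.norm_of_nonneg hw]
  refine mul_le_mul_of_nonneg_left ?_ hw
  refine (ContinuousLinearMap.le_opNorm _ _).trans ?_
  have : ‖resolv R κ ^ n‖ ≤ 1 := by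
    rcases n.eq_zero_or_pos with rfl | hn
    · rw [pow_zero]; exact ContinuousLinearMap.norm_id_le
    · exact (norm_pow_le' _ hn).trans (pow_le_one₀ (norm_nonneg _) (hR.norm_resolv_le h0 h1))
  nlinarith [norm_nonneg x]

theorem IsUnitResolvent.norm_resolv_apply_le (hR : IsUnitResolvent R) {κ : ℝ} (h0 : 0 < κ)
    (h1 : κ ≤ 1) (x : H) : ‖resolv R κ x‖ ≤ ‖x‖ := by
  simpa using (resolv R κ).le_of_opNorm_le (hR.norm_resolv_le h0 h1) x

/-- Interpolate by `s ↦ e^{sA_κ} e^{(t-s)A_μ} x`; the operators commute, so its derivative is a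
product of two contractions applied to `A_κ x - A_μ x`. -/
theorem IsUnitResolvent.norm_yexp_sub_le (hR : IsUnitResolvent R) {κ μ t : ℝ} (h0 : 0 < κ)
    (h1 : κ ≤ 1) (h0' : 0 < μ) (h1' : μ ≤ 1) (ht : 0 ≤ t) (x : H) :
    ‖yexp R κ t x - yexp R μ t x‖ ≤ t * ‖yosida R κ x - yosida R μ x‖ := by
  have hd : ∀ s ∈ Icc 0 t, HasDerivWithinAt (fun s => (yexp R κ s * yexp R μ (t - s)) x)
      (yexp R κ s (yexp R μ (t - s) (yosida R κ x - yosida R μ x))) (Icc 0 t) s := by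
    intro s _
    have a := hasDerivAt_exp_smul_const (yosida R κ) s
    have b := (hasDerivAt_exp_smul_const (yosida R μ) (t - s)).scomp s
      ((hasDerivAt_id s).const_sub t)
    have h := (ContinuousLinearMap.apply ℝ H x).hasFDerivAt.comp_hasDerivAt s (a.mul b)
    refine (h.congr_deriv ?_).hasDerivWithinAt
    have c : Commute (yosida R κ) (yexp R μ (t - s)) := commute_yexp (yosida_commute κ μ) _
    change (yexp R κ s * yosida R κ * yexp R μ (t - s)
      + yexp R κ s * ((-1 : ℝ) • (yexp R μ (t - s) * yosida R μ))) x = _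
    rw [mul_assoc, c.eq]
    simp [sub_eq_add_neg]
  have h := norm_image_sub_le_of_norm_deriv_le_segment' hd
    (C := ‖yosida R κ x - yosida R μ x‖) (fun s hs =>
      (hR.norm_yexp_apply_le h0 h1 hs.1 _).trans
        (hR.norm_yexp_apply_le h0' h1' (by linarith [hs.2]) _)) t ⟨ht, le_rfl⟩
  simp only [sub_self, sub_zero, yexp_zero, mul_one, one_mul] at h
  rwa [mul_comm] at h

theorem IsUnitResolvent.norm_yexp_sub_self_le (hR : IsUnitResolvent R) {κ s t : ℝ} (h0 : 0 < κ)
    (h1 : κ ≤ 1) (hs : 0 ≤ s) (hst : s ≤ t) (x : H) :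
    ‖yexp R κ t x - yexp R κ s x‖ ≤ (t - s) * ‖yosida R κ x‖ := by
  rw [mul_comm]
  exact norm_image_sub_le_of_norm_deriv_le_segment' (C := ‖yosida R κ x‖)
    (fun r _ => (hasDerivAt_yexp R κ r x).hasDerivWithinAt)
    (fun r hr => hR.norm_yexp_apply_le h0 h1 (hs.trans hr.1) _) t ⟨hst, le_rfl⟩

theorem IsUnitResolvent.norm_yosida_le (hR : IsUnitResolvent R) {κ : ℝ} (h0 : 0 < κ)
    (h1 : κ ≤ 1) {u g : H} (h : u = R (u - g)) : ‖yosida R κ u‖ ≤ ‖g‖ := by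
  rw [yosida_apply κ h]
  exact hR.norm_resolv_apply_le h0 h1 g

/-- On the domain `J_κ u - u = κ A_κ u` is `O(κ)`, as `‖A_κ u‖ ≤ ‖A u‖`. Density of the domain and
the contraction property extend the limit to all vectors. -/
theorem IsUnitResolvent.tendsto_resolv (hR : IsUnitResolvent R) (x : H) :
    Tendsto (fun κ => resolv R κ x) (𝓝[>] 0) (𝓝 x) := by
  rw [Metric.tendsto_nhds]
  intro ε hε
  obtain ⟨u, g, hu, hxu⟩ := hR.exists_near x (show 0 < ε / 3 by positivity)
  have h1 : ∀ᶠ κ : ℝ in 𝓝[>] 0, κ < min 1 (ε / 3 / (‖g‖ + 1)) :=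
    mem_nhdsWithin_of_mem_nhds (Iio_mem_nhds (by positivity))
  filter_upwards [h1, self_mem_nhdsWithin] with κ hκ hκ0
  have hκ0 : 0 < κ := hκ0
  have hκ1 : κ ≤ 1 := (hκ.trans_le (min_le_left _ _)).le
  have hκ2 : κ * (‖g‖ + 1) < ε / 3 := by
    rw [← lt_div_iff₀ (by positivity)]
    exact hκ.trans_le (min_le_right _ _)
  have e1 : resolv R κ u - u = κ • yosida R κ u := by
    rw [hR.resolv_eq hκ0 hκ1]; simp
  have e2 : ‖resolv R κ u - u‖ ≤ κ * ‖g‖ := by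
    rw [e1, norm_smul, Real.norm_of_nonneg hκ0.le]
    exact mul_le_mul_of_nonneg_left (hR.norm_yosida_le hκ0 hκ1 hu) hκ0.le
  have e3 : ‖resolv R κ (x - u)‖ ≤ ‖x - u‖ := hR.norm_resolv_apply_le hκ0 hκ1 _
  have e4 : resolv R κ x - x = resolv R κ (x - u) + (resolv R κ u - u) - (x - u) := by
    rw [map_sub]; abel
  rw [dist_eq_norm, e4]
  have e5 := norm_sub_le (resolv R κ (x - u) + (resolv R κ u - u)) (x - u)
  have e6 := norm_add_le (resolv R κ (x - u)) (resolv R κ u - u)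
  nlinarith

/-- The parameters of the Yosida approximations. -/
def yseq (n : ℕ) : ℝ := 1 / ((n : ℝ) + 1)

theorem yseq_pos (n : ℕ) : 0 < yseq n := by unfold yseq; positivity

theorem yseq_le_one (n : ℕ) : yseq n ≤ 1 := by
  unfold yseq
  rw [div_le_one (by positivity)]
  linarith [(Nat.cast_nonneg n : (0 : ℝ) ≤ n)]

theorem tendsto_yseq : Tendsto yseq atTop (𝓝[>] 0) :=
  tendsto_nhdsWithin_iff.2 ⟨tendsto_one_div_add_atTop_nhds_zero_nat, .of_forall yseq_pos⟩

/-- `S t` is the strong limit of the exponentials of the Yosida approximations for `t ≥ 0`, and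
the identity for `t ≤ 0`. -/
def IsYosidaLimit (R : H →L[ℝ] H) (S : ℝ → H →L[ℝ] H) : Prop :=
  ∀ t x, Tendsto (fun n => yexp R (yseq n) (max t 0) x) atTop (𝓝 (S t x))

/-- For `u` in the domain `A_κ u` converges to `A u`, so the exponentials are Cauchy by
`norm_yexp_sub_le`; contractivity passes this on to every vector. -/
theorem IsUnitResolvent.exists_limit (hR : IsUnitResolvent R) :
    ∃ S : ℝ → H →L[ℝ] H, IsYosidaLimit R S := by
  have key : ∀ t : ℝ, 0 ≤ t → ∀ x, ∃ y, Tendsto (fun n => yexp R (yseq n) t x) atTop (𝓝 y) := by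
    intro t ht x
    refine cauchySeq_tendsto_of_complete (Metric.cauchySeq_iff'.2 fun ε hε => ?_)
    obtain ⟨u, g, hu, hxu⟩ := hR.exists_near x (show 0 < ε / 3 by positivity)
    have h1 : CauchySeq fun n => yosida R (yseq n) u := by
      simp_rw [yosida_apply _ hu]
      exact ((hR.tendsto_resolv g).comp tendsto_yseq).cauchySeq
    obtain ⟨N, hN⟩ := Metric.cauchySeq_iff'.1 h1 (ε / 3 / (t + 1)) (by positivity)
    refine ⟨N, fun n hn => ?_⟩
    have h2 := hN n hn
    rw [dist_eq_norm, lt_div_iff₀ (by positivity)] at h2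
    have h3 := hR.norm_yexp_sub_le (yseq_pos n) (yseq_le_one n) (yseq_pos N) (yseq_le_one N) ht u
    have h4 := hR.norm_yexp_apply_le (yseq_pos n) (yseq_le_one n) ht (x - u)
    have h5 := hR.norm_yexp_apply_le (yseq_pos N) (yseq_le_one N) ht (x - u)
    have e : yexp R (yseq n) t x - yexp R (yseq N) t x = yexp R (yseq n) t (x - u)
      - yexp R (yseq N) t (x - u) + (yexp R (yseq n) t u - yexp R (yseq N) t u) := by
      rw [map_sub, map_sub]; abel
    rw [dist_eq_norm, e]
    have h6 := norm_add_le (yexp R (yseq n) t (x - u) - yexp R (yseq N) t (x - u))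
      (yexp R (yseq n) t u - yexp R (yseq N) t u)
    have h7 := norm_sub_le (yexp R (yseq n) t (x - u)) (yexp R (yseq N) t (x - u))
    nlinarith [norm_nonneg (yosida R (yseq n) u - yosida R (yseq N) u)]
  choose f hf using key
  refine ⟨fun t => continuousLinearMapOfTendsto (l := atTop)
    (fun n => yexp R (yseq n) (max t 0)) (f := f (max t 0) (le_max_right _ _))
    (tendsto_pi_nhds.2 fun x => hf _ _ x), fun t x => hf _ _ x⟩

section Limit

variable {S : ℝ → H →L[ℝ] H}

omit [CompleteSpace H] in
theorem IsYosidaLimit.eq_one (hS : IsYosidaLimit R S) {t : ℝ} (ht : t ≤ 0) : S t = 1 := by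
  ext x
  refine tendsto_nhds_unique (hS t x) ?_
  simp [max_eq_right ht, yexp_zero]

theorem IsYosidaLimit.norm_apply_le (hS : IsYosidaLimit R S) (hR : IsUnitResolvent R) (t : ℝ)
    (x : H) : ‖S t x‖ ≤ ‖x‖ :=
  le_of_tendsto (hS t x).norm (.of_forall fun n =>
    hR.norm_yexp_apply_le (yseq_pos n) (yseq_le_one n) (le_max_right _ _) x)

theorem IsYosidaLimit.add (hS : IsYosidaLimit R S) (hR : IsUnitResolvent R) {s t : ℝ} (hs : 0 ≤ s)
    (ht : 0 ≤ t) : S (s + t) = (S s).comp (S t) := by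
  ext x
  have h1 := hS (s + t) x
  rw [max_eq_left (add_nonneg hs ht)] at h1
  refine tendsto_nhds_unique h1 ?_
  have h2 := hS s (S t x)
  have h3 := (hS t x).sub_const (S t x)
  rw [max_eq_left hs] at h2
  rw [max_eq_left ht, sub_self] at h3
  have h4 : Tendsto (fun n => yexp R (yseq n) s (yexp R (yseq n) t x - S t x)) atTop (𝓝 0) :=
    squeeze_zero_norm (fun n => hR.norm_yexp_apply_le (yseq_pos n) (yseq_le_one n) hs _)
      (by simpa using h3.norm)
  have h5 := h4.add h2
  rw [zero_add] at h5
  refine h5.congr fun n => ?_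
  rw [yexp_add, map_sub, sub_add_cancel]
  rfl

theorem IsYosidaLimit.norm_sub_le (hS : IsYosidaLimit R S) (hR : IsUnitResolvent R) {u g : H}
    (hu : u = R (u - g)) (s t : ℝ) : ‖S t u - S s u‖ ≤ |t - s| * ‖g‖ := by
  wlog hst : s ≤ t generalizing s t
  · rw [norm_sub_rev, abs_sub_comm]
    exact this t s (le_of_not_ge hst)
  refine le_of_tendsto ((hS t u).sub (hS s u)).norm (.of_forall fun n => ?_)
  refine (hR.norm_yexp_sub_self_le (yseq_pos n) (yseq_le_one n) (le_max_right _ _)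
    (max_le_max_right 0 hst) u).trans ?_
  refine mul_le_mul ?_ (hR.norm_yosida_le (yseq_pos n) (yseq_le_one n) hu) (norm_nonneg _)
    (abs_nonneg _)
  exact (le_abs_self _).trans (abs_max_sub_max_le_abs _ _ _)

theorem IsYosidaLimit.continuous_apply (hS : IsYosidaLimit R S) (hR : IsUnitResolvent R) (x : H) :
    Continuous fun t => S t x := by
  rw [Metric.continuous_iff]
  intro t ε hε
  obtain ⟨u, g, hu, hxu⟩ := hR.exists_near x (show 0 < ε / 3 by positivity)
  refine ⟨ε / 3 / (‖g‖ + 1), by positivity, fun s hs => ?_⟩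
  rw [Real.dist_eq, lt_div_iff₀ (by positivity)] at hs
  have h1 := hS.norm_sub_le hR hu t s
  have h2 := hS.norm_apply_le hR s (x - u)
  have h3 := hS.norm_apply_le hR t (x - u)
  have e : S s x - S t x = S s (x - u) - S t (x - u) + (S s u - S t u) := by
    rw [map_sub, map_sub]; abel
  rw [dist_eq_norm, e]
  have h6 := norm_add_le (S s (x - u) - S t (x - u)) (S s u - S t u)
  have h7 := _root_.norm_sub_le (S s (x - u)) (S t (x - u))
  nlinarith [abs_nonneg (s - t)]

/-- Strong continuity and a uniform bound give joint continuity, which makes Duhamel integrands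
measurable. -/
theorem IsYosidaLimit.continuous (hS : IsYosidaLimit R S) (hR : IsUnitResolvent R) :
    Continuous fun p : ℝ × H => S p.1 p.2 := by
  rw [continuous_iff_continuousAt]
  rintro ⟨t, x⟩
  have h1 : Tendsto (fun p : ℝ × H => S p.1 (p.2 - x)) (𝓝 (t, x)) (𝓝 0) := by
    refine squeeze_zero_norm (fun p => hS.norm_apply_le hR p.1 (p.2 - x)) ?_
    have : Continuous fun p : ℝ × H => ‖p.2 - x‖ := by fun_prop
    simpa using this.tendsto (t, x)
  have h2 : Tendsto (fun p : ℝ × H => S p.1 x) (𝓝 (t, x)) (𝓝 (S t x)) :=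
    ((hS.continuous_apply hR x).comp continuous_fst).tendsto (t, x)
  have h3 := h1.add h2
  rw [zero_add] at h3
  refine h3.congr fun p => ?_
  rw [map_sub, sub_add_cancel]

/-- A quantitative derivative at `0` for `u` in the domain with `A u = g`. As `g` need not lie in
the domain, it is compared with some `v` there, for which `‖e^{sA_κ} v - v‖ ≤ s ‖A v‖`. -/
theorem IsYosidaLimit.norm_sub_sub_le (hS : IsYosidaLimit R S) (hR : IsUnitResolvent R)
    {u g v h : H} (hu : u = R (u - g)) (hv : v = R (v - h)) {t : ℝ} (ht : 0 ≤ t) :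
    ‖S t u - u - t • g‖ ≤ t * (2 * ‖g - v‖ + t * ‖h‖) := by
  have h1 := hS t u
  rw [max_eq_left ht] at h1
  have h2 : Tendsto (fun n => yosida R (yseq n) u) atTop (𝓝 g) := by
    simp_rw [yosida_apply _ hu]
    exact (hR.tendsto_resolv g).comp tendsto_yseq
  refine le_of_tendsto ((h1.sub_const u).sub (h2.const_smul t)).norm (.of_forall fun n => ?_)
  have h0 := yseq_pos n
  have h1 := yseq_le_one n
  set κ := yseq n
  have hd : ∀ s ∈ Icc 0 t, HasDerivWithinAt (fun s => yexp R κ s u - u - s • yosida R κ u)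
      (yexp R κ s (yosida R κ u) - yosida R κ u) (Icc 0 t) s := fun s _ => by
    have := ((hasDerivAt_yexp R κ s u).sub_const u).sub
      ((hasDerivAt_id s).smul_const (yosida R κ u))
    rw [one_smul] at this
    exact this.hasDerivWithinAt
  have hb : ∀ s ∈ Ico 0 t, ‖yexp R κ s (yosida R κ u) - yosida R κ u‖
      ≤ 2 * ‖g - v‖ + t * ‖h‖ := by
    intro s hs
    rw [yosida_apply κ hu]
    have e : yexp R κ s (resolv R κ g) - resolv R κ g
        = resolv R κ (yexp R κ s (g - v) - (g - v) + (yexp R κ s v - v)) := by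
      have c : yexp R κ s (resolv R κ g) = resolv R κ (yexp R κ s g) :=
        (congrArg (fun T : H →L[ℝ] H => T g)
          (commute_yexp (yosida_commute_resolv κ κ).symm s).eq).symm
      rw [c, ← map_sub]
      congr 1
      rw [map_sub]; abel
    rw [e]
    refine (hR.norm_resolv_apply_le h0 h1 _).trans ((norm_add_le _ _).trans (add_le_add ?_ ?_))
    · refine (_root_.norm_sub_le _ _).trans ?_
      have := hR.norm_yexp_apply_le h0 h1 hs.1 (g - v)
      linarith
    · have a := hR.norm_yexp_sub_self_le h0 h1 le_rfl hs.1 v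
      have b := hR.norm_yosida_le h0 h1 hv
      rw [yexp_zero, sub_zero] at a
      exact a.trans (mul_le_mul hs.2.le b (norm_nonneg _) ht)
  have hm := norm_image_sub_le_of_norm_deriv_le_segment' hd hb t ⟨ht, le_rfl⟩
  rw [mul_comm]
  simpa [yexp_zero] using hm

/-- The infinitesimal generator of the limit semigroup is the operator `A` with
`(1 - A)⁻¹ = R`. -/
theorem IsYosidaLimit.generator_iff (hS : IsYosidaLimit R S) (hR : IsUnitResolvent R) (u g : H) :
    u = R (u - g) ↔ Tendsto (fun t : ℝ => t⁻¹ • (S t u - u)) (𝓝[>] 0) (𝓝 g) := by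
  have key : ∀ u g : H, u = R (u - g) →
      Tendsto (fun t : ℝ => t⁻¹ • (S t u - u)) (𝓝[>] 0) (𝓝 g) := by
    intro u g hu
    rw [Metric.tendsto_nhds]
    intro ε hε
    obtain ⟨v, h, hv, hgv⟩ := hR.exists_near g (show 0 < ε / 3 by positivity)
    have h1 : ∀ᶠ t : ℝ in 𝓝[>] 0, t < ε / 3 / (‖h‖ + 1) :=
      mem_nhdsWithin_of_mem_nhds (Iio_mem_nhds (by positivity))
    filter_upwards [h1, self_mem_nhdsWithin] with t ht ht0
    have ht0 : 0 < t := ht0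
    rw [lt_div_iff₀ (by positivity)] at ht
    have e : t⁻¹ • (S t u - u) - g = t⁻¹ • (S t u - u - t • g) := by
      rw [smul_sub _ _ (t • g), smul_smul, inv_mul_cancel₀ ht0.ne', one_smul]
    rw [dist_eq_norm, e, norm_smul, norm_inv, Real.norm_of_nonneg ht0.le,
      inv_mul_lt_iff₀ ht0]
    refine (hS.norm_sub_sub_le hR hu hv ht0.le).trans_lt ?_
    gcongr
    nlinarith
  -- For the converse, `y = R (u - g)` lies in the domain and `A y = y - (u - g)`. Hence `d = u - y`
  -- has difference quotients tending to `d` itself, whereas contractivity makes their inner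
  -- products with `d` nonpositive. So `d = 0`.
  refine ⟨key u g, fun h => ?_⟩
  set y := R (u - g) with hy
  have hyA : y = R (y - (y - (u - g))) := by rw [sub_sub_cancel]
  have h2 := h.sub (key _ _ hyA)
  have h3 : Tendsto (fun t : ℝ => ⟪t⁻¹ • (S t (u - y) - (u - y)), u - y⟫_ℝ) (𝓝[>] 0)
      (𝓝 ⟪u - y, u - y⟫_ℝ) := by
    refine Tendsto.inner ?_ tendsto_const_nhds
    convert h2 using 2
    · rw [map_sub, ← smul_sub]; congr 1; abel
    · abel
  have h4 : ⟪u - y, u - y⟫_ℝ ≤ 0 := by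
    refine le_of_tendsto h3 ?_
    filter_upwards [self_mem_nhdsWithin] with t ht
    have ht : 0 < t := ht
    rw [inner_smul_left, inner_sub_left]
    have a := real_inner_le_norm (S t (u - y)) (u - y)
    have b := hS.norm_apply_le hR t (u - y)
    have c := real_inner_self_eq_norm_sq (u - y)
    refine mul_nonpos_of_nonneg_of_nonpos (by simp [ht.le]) ?_
    nlinarith [norm_nonneg (u - y)]
  have h5 : u - y = 0 := real_inner_self_nonpos.1 h4
  exact sub_eq_zero.1 h5

end Limit

end Semigroup

/-! ### Multiples of convex sets through support functions, and invariance under the semigroup. -/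

section Polar

variable {H : Type*} [NormedAddCommGroup H] [InnerProductSpace ℝ H] [CompleteSpace H]

/-- `u ∈ r B`, expressed through the support function of `B`. -/
def PolarLE (B : Set H) (r : ℝ) (u : H) : Prop :=
  ∀ φ c, (∀ b ∈ B, ⟪φ, b⟫_ℝ ≤ c) → ⟪φ, u⟫_ℝ ≤ r * c

variable {B : Set H}

omit [CompleteSpace H] in
theorem polarLE_one_of_mem {u : H} (hu : u ∈ B) : PolarLE B 1 u := fun φ c h => by
  simpa using h u hu

/-- Hahn–Banach: a point outside a closed convex set is strictly separated from it. -/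
theorem PolarLE.mem (hc : Convex ℝ B) (hcl : IsClosed B) {u : H} (h : PolarLE B 1 u) : u ∈ B := by
  by_contra hu
  obtain ⟨f, c, h1, h2⟩ := geometric_hahn_banach_closed_point hc hcl hu
  have h3 := h ((InnerProductSpace.toDual ℝ H).symm f) c
    (fun b hb => by simpa using (h1 b hb).le)
  simp only [InnerProductSpace.toDual_symm_apply, one_mul] at h3
  linarith

omit [CompleteSpace H] in
theorem PolarLE.smul {r a : ℝ} {u : H} (h : PolarLE B r u) (ha : 0 ≤ a) :
    PolarLE B (a * r) (a • u) := fun φ c hb => by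
  rw [inner_smul_right, mul_assoc]
  exact mul_le_mul_of_nonneg_left (h φ c hb) ha

omit [CompleteSpace H] in
theorem PolarLE.add {r s : ℝ} {u v : H} (hu : PolarLE B r u) (hv : PolarLE B s v) :
    PolarLE B (r + s) (u + v) := fun φ c hb => by
  rw [inner_add_right, add_mul]
  exact add_le_add (hu φ c hb) (hv φ c hb)

omit [CompleteSpace H] in
theorem PolarLE.mono (h0 : 0 ∈ B) {r s : ℝ} {u : H} (h : PolarLE B r u) (hrs : r ≤ s) :
    PolarLE B s u := fun φ c hb => by
  have hc : 0 ≤ c := by simpa using hb 0 h0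
  exact (h φ c hb).trans (mul_le_mul_of_nonneg_right hrs hc)

/-- Move `T` to the functional as its adjoint, which has the same bound on `B` because `T` maps `B`
into itself. -/
theorem PolarLE.map {r : ℝ} {u : H} (h : PolarLE B r u) (T : H →L[ℝ] H)
    (hT : ∀ b ∈ B, T b ∈ B) : PolarLE B r (T u) := fun φ c hb => by
  rw [← ContinuousLinearMap.adjoint_inner_left]
  refine h _ c fun b hbB => ?_
  rw [ContinuousLinearMap.adjoint_inner_left]
  exact hb _ (hT b hbB)

omit [CompleteSpace H] in
theorem PolarLE.of_tendsto {ι : Type*} {l : Filter ι} [l.NeBot] {r : ι → ℝ} {u : ι → H} {r' : ℝ}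
    {u' : H} (hu : Tendsto u l (𝓝 u')) (hr : Tendsto r l (𝓝 r'))
    (h : ∀ᶠ i in l, PolarLE B (r i) (u i)) : PolarLE B r' u' := fun φ c hb =>
  le_of_tendsto_of_tendsto (tendsto_const_nhds.inner hu) (hr.mul_const c)
    (h.mono fun _ hi => hi φ c hb)

omit [CompleteSpace H] in
theorem PolarLE.hasSum {r : ℕ → ℝ} {u : ℕ → H} {r' : ℝ} {u' : H} (hu : HasSum u u')
    (hr : HasSum r r') (h : ∀ n, PolarLE B (r n) (u n)) : PolarLE B r' u' := fun φ c hb => by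
  have h1 : HasSum (fun n => ⟪φ, u n⟫_ℝ) ⟪φ, u'⟫_ℝ := (innerSL ℝ φ).hasSum hu
  exact hasSum_le (fun n => h n φ c hb) h1 (hr.mul_right c)

/-- The purpose of the support function: under an integral, the set inequality becomes a family of
scalar inequalities, without any integration theory for set-valued maps. -/
theorem PolarLE.intervalIntegral {f : ℝ → H} {r : ℝ → ℝ} {a b : ℝ} (hab : a ≤ b)
    (hf : IntervalIntegrable f volume a b) (hr : IntervalIntegrable r volume a b)
    (h : ∀ s ∈ Ioo a b, PolarLE B (r s) (f s)) : PolarLE B (∫ s in a..b, r s) (∫ s in a..b, f s) :=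
  fun φ c hb => by
  have h1 : ⟪φ, ∫ s in a..b, f s⟫_ℝ = ∫ s in a..b, ⟪φ, f s⟫_ℝ :=
    ((innerSL ℝ φ).intervalIntegral_comp_comm hf).symm
  rw [h1, ← intervalIntegral.integral_mul_const]
  refine intervalIntegral.integral_mono_on_of_le_Ioo hab ?_ (hr.mul_const c)
    fun s hs => h s hs φ c hb
  exact ⟨(innerSL ℝ φ).integrable_comp hf.1, (innerSL ℝ φ).integrable_comp hf.2⟩

variable {R : H →L[ℝ] H} {S : ℝ → H →L[ℝ] H}

/-- A closed convex set that is invariant under the resolvents is invariant under the semigroup. -/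
theorem IsYosidaLimit.mem_of_resolv_mem (hS : IsYosidaLimit R S) (hR : IsUnitResolvent R)
    (hc : Convex ℝ B) (hcl : IsClosed B)
    (hB : ∀ κ : ℝ, 0 < κ → κ ≤ 1 → ∀ b ∈ B, resolv R κ b ∈ B) (t : ℝ) {b : H} (hb : b ∈ B) :
    S t b ∈ B := by
  refine hcl.mem_of_tendsto (hS t b) (.of_forall fun n => ?_)
  have h0 := yseq_pos n
  have h1 := yseq_le_one n
  have ht : 0 ≤ max t 0 := le_max_right _ _
  -- The Poisson weights are nonnegative with sum `1`, so the infinite convex combination of `J_κ^k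
  -- b` stays in `1 · B`.
  refine PolarLE.mem hc hcl (PolarLE.hasSum (yexp_hasSum hR h0 h1 (max t 0) b)
    (hasSum_exp_weights (max t 0 / yseq n)) fun k => ?_)
  have hk : ((resolv R (yseq n)) ^ k) b ∈ B := by
    induction k with
    | zero => simpa using hb
    | succ k ih =>
      rw [pow_succ']
      exact hB _ h0 h1 _ ih
  simpa using (polarLE_one_of_mem hk).smul
    (a := Real.exp (-(max t 0 / yseq n)) * ((max t 0 / yseq n) ^ k / k.factorial))
    (by positivity)

/-- The smoothing estimate for the exponentials of the Yosida approximations. -/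
theorem IsUnitResolvent.neg_inner_yosida_le (hR : IsUnitResolvent R) {κ t : ℝ} (h0 : 0 < κ)
    (h1 : κ ≤ 1) (ht : 0 ≤ t) (x : H) :
    -(2 * t * ⟪yosida R κ (yexp R κ t x), yexp R κ t x⟫_ℝ) ≤ ‖x‖ ^ 2 := by
  set A := yosida R κ
  -- The functional `‖e^{sA_κ}x‖² - 2s⟪A_κ e^{sA_κ}x, e^{sA_κ}x⟫` decreases: by symmetry the terms
  -- without a factor `s` cancel and `-4s‖A_κ e^{sA_κ}x‖²` remains. At `s = 0` it equals `‖x‖²`.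
  have hd : ∀ s, HasDerivAt (fun s => ⟪yexp R κ s x, yexp R κ s x⟫_ℝ
      - 2 * s * ⟪yexp R κ s (A x), yexp R κ s x⟫_ℝ) (-(4 * s * ‖yexp R κ s (A x)‖ ^ 2)) s := by
    intro s
    have a := hasDerivAt_yexp R κ s x
    have b := hasDerivAt_yexp R κ s (A x)
    have h := (a.inner ℝ a).sub (((hasDerivAt_id s).const_mul 2).mul (b.inner ℝ a))
    refine h.congr_deriv ?_
    have c : ∀ y, yexp R κ s (A y) = A (yexp R κ s y) := fun y =>
      (congrArg (fun T : H →L[ℝ] H => T y) (commute_yexp (Commute.refl (yosida R κ)) s).eq).symm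
    have d : ⟪yexp R κ s (A (A x)), yexp R κ s x⟫_ℝ = ‖yexp R κ s (A x)‖ ^ 2 := by
      rw [c (A x), hR.yosida_symm h0 h1, ← c x, real_inner_self_eq_norm_sq]
    have e : ⟪yexp R κ s x, yexp R κ s (A x)⟫_ℝ = ⟪yexp R κ s (A x), yexp R κ s x⟫_ℝ :=
      real_inner_comm _ _
    change ⟪yexp R κ s x, yexp R κ s (A x)⟫_ℝ + ⟪yexp R κ s (A x), yexp R κ s x⟫_ℝ
      - (2 * 1 * ⟪yexp R κ s (A x), yexp R κ s x⟫_ℝ + 2 * s * (⟪yexp R κ s (A x), yexp R κ s (A x)⟫_ℝ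
        + ⟪yexp R κ s (A (A x)), yexp R κ s x⟫_ℝ)) = _
    rw [d, real_inner_self_eq_norm_sq, e]
    ring
  have hanti : AntitoneOn (fun s => ⟪yexp R κ s x, yexp R κ s x⟫_ℝ
      - 2 * s * ⟪yexp R κ s (A x), yexp R κ s x⟫_ℝ) (Ici 0) := by
    refine antitoneOn_of_deriv_nonpos (convex_Ici 0)
      (fun s _ => (hd s).continuousAt.continuousWithinAt)
      (fun s _ => (hd s).differentiableAt.differentiableWithinAt) fun s hs => ?_
    rw [interior_Ici] at hs
    have hs : 0 < s := hs
    rw [(hd s).deriv]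
    have : 0 ≤ 4 * s * ‖yexp R κ s (A x)‖ ^ 2 := by positivity
    linarith
  have h := hanti (self_mem_Ici (a := (0 : ℝ))) (show t ∈ Ici 0 from ht) ht
  have c : yexp R κ t (A x) = A (yexp R κ t x) :=
    (congrArg (fun T : H →L[ℝ] H => T x) (commute_yexp (Commute.refl (yosida R κ)) t).eq).symm
  simp only [yexp_zero, c] at h
  have e : ⟪(1 : H →L[ℝ] H) x, (1 : H →L[ℝ] H) x⟫_ℝ = ‖x‖ ^ 2 := real_inner_self_eq_norm_sq x
  rw [e, real_inner_self_eq_norm_sq] at h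
  nlinarith [sq_nonneg ‖yexp R κ t x‖]

end Polar

/-! ### The operator of a closed form, its resolvents and the smoothing of its semigroup. -/

section FormSpace

variable {H : Type*} [NormedAddCommGroup H] [InnerProductSpace ℝ H] [CompleteSpace H]
variable {V : Type*} [NormedAddCommGroup V] [InnerProductSpace ℝ V] [CompleteSpace V]

/-- `J` is the embedding of a form domain `V`, with the norm `‖v‖² = ‖J v‖² + a(v, v)`, into `H`. -/
structure IsFormEmbedding (J : V →L[ℝ] H) : Prop where
  norm_le : ∀ v, ‖J v‖ ≤ ‖v‖
  inj : Function.Injective J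
  dense : DenseRange J

/-- The resolvent `(1 - A)⁻¹` of the operator `A` associated with the form. -/
def formResolvent (J : V →L[ℝ] H) : H →L[ℝ] H := J.comp (ContinuousLinearMap.adjoint J)

variable {J : V →L[ℝ] H}

theorem inner_formResolvent (J : V →L[ℝ] H) (x y : H) : ⟪formResolvent J x, y⟫_ℝ
    = ⟪ContinuousLinearMap.adjoint J x, ContinuousLinearMap.adjoint J y⟫_ℝ := by
  rw [ContinuousLinearMap.adjoint_inner_right]
  rfl

theorem IsFormEmbedding.isUnitResolvent (hJ : IsFormEmbedding J) :
    IsUnitResolvent (formResolvent J) where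
  symm x y := by
    rw [inner_formResolvent, real_inner_comm, ← inner_formResolvent, real_inner_comm]
  sq_le x := by
    rw [inner_formResolvent, real_inner_self_eq_norm_sq]
    exact pow_le_pow_left₀ (norm_nonneg _) (hJ.norm_le _) 2
  inj x hx := by
    have h1 : ContinuousLinearMap.adjoint J x = 0 := by
      have := inner_formResolvent J x x
      rw [hx, inner_zero_left, real_inner_self_eq_norm_sq] at this
      simpa using this.symm
    refine hJ.dense.eq_zero_of_inner_left ℝ fun v => ?_
    rw [← ContinuousLinearMap.adjoint_inner_left, h1, inner_zero_left]

/-- The inequality says that `J* f ↦ ⟪f, u⟫` is well defined with norm at most `M` on the range of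
`J*`. Extend it to `V` by Hahn–Banach with the same norm; its Riesz representative is the preimage
of `u`. -/
theorem IsFormEmbedding.mem_image_closedBall_iff (hJ : IsFormEmbedding J) {M : ℝ} (hM : 0 ≤ M)
    (u : H) : u ∈ J '' Metric.closedBall 0 M ↔
      ∀ f, ⟪f, u⟫_ℝ ≤ M * ‖ContinuousLinearMap.adjoint J f‖ := by
  constructor
  · rintro ⟨w, hw, rfl⟩ f
    rw [← ContinuousLinearMap.adjoint_inner_left, mul_comm]
    exact (real_inner_le_norm _ _).trans
      (mul_le_mul_of_nonneg_left (by simpa using hw) (norm_nonneg _))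
  · intro h
    have hinj : Function.Injective (ContinuousLinearMap.adjoint J).toLinearMap := by
      rw [← LinearMap.ker_eq_bot, LinearMap.ker_eq_bot']
      intro x hx
      have hx : ContinuousLinearMap.adjoint J x = 0 := hx
      exact hJ.isUnitResolvent.inj x (by simp [formResolvent, hx])
    let e := LinearEquiv.ofInjective _ hinj
    let l : LinearMap.range (ContinuousLinearMap.adjoint J).toLinearMap →ₗ[ℝ] ℝ :=
      (innerSL ℝ u).toLinearMap.comp e.symm.toLinearMap
    have hl : ∀ y, ‖l y‖ ≤ M * ‖y‖ := by
      intro y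
      obtain ⟨f, rfl⟩ := e.surjective y
      have h1 : l (e f) = ⟪f, u⟫_ℝ := by
        simp [l, real_inner_comm]
      have h2 : ‖e f‖ = ‖ContinuousLinearMap.adjoint J f‖ := rfl
      rw [h1, h2, Real.norm_eq_abs, abs_le]
      refine ⟨?_, h f⟩
      have := h (-f)
      rw [inner_neg_left, map_neg, norm_neg] at this
      linarith
    obtain ⟨g, hg1, hg2⟩ := exists_extension_norm_eq _ (l.mkContinuous M hl)
    refine ⟨(InnerProductSpace.toDual ℝ V).symm g, ?_, ?_⟩
    · rw [mem_closedBall_zero_iff, LinearIsometryEquiv.norm_map, hg2]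
      exact l.mkContinuous_norm_le hM hl
    · refine ext_inner_right ℝ fun f => ?_
      rw [← ContinuousLinearMap.adjoint_inner_right, InnerProductSpace.toDual_symm_apply]
      have h1 := hg1 (e f)
      have h2 : l (e f) = ⟪u, f⟫_ℝ := by simp [l]
      rw [← h2]
      exact h1

/-- Lower semicontinuity of the form norm. -/
theorem IsFormEmbedding.isClosed_image (hJ : IsFormEmbedding J) {M : ℝ} (hM : 0 ≤ M) :
    IsClosed (J '' Metric.closedBall 0 M) := by
  have : J '' Metric.closedBall 0 M
      = ⋂ f, {u | ⟪f, u⟫_ℝ ≤ M * ‖ContinuousLinearMap.adjoint J f‖} := by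
    ext u
    rw [hJ.mem_image_closedBall_iff hM, mem_iInter]
    rfl
  rw [this]
  exact isClosed_iInter fun f => isClosed_le (by fun_prop) continuous_const

omit [CompleteSpace H] [CompleteSpace V] in
theorem convex_image_closedBall (J : V →L[ℝ] H) (M : ℝ) :
    Convex ℝ (J '' Metric.closedBall 0 M) :=
  (convex_closedBall 0 M).linear_image J.toLinearMap

/-- The substitute for weak compactness: convergence in `H` together with a bound in `V` puts the
limit in `V` with the same bound. -/
theorem IsFormEmbedding.exists_of_tendsto (hJ : IsFormEmbedding J) {ι : Type*} {l : Filter ι}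
    [l.NeBot] {M : ℝ} {v : ι → V} {u : H} (h : Tendsto (fun i => J (v i)) l (𝓝 u))
    (hM : ∀ᶠ i in l, ‖v i‖ ≤ M) : ∃ w, J w = u ∧ ‖w‖ ≤ M := by
  have hM0 : 0 ≤ M := by
    obtain ⟨i, hi⟩ := hM.exists
    exact (norm_nonneg _).trans hi
  obtain ⟨w, hw, rfl⟩ := (hJ.isClosed_image hM0).mem_of_tendsto h
    (hM.mono fun i hi => mem_image_of_mem _ (by simpa using hi))
  exact ⟨w, rfl, by simpa using hw⟩

theorem IsFormEmbedding.exists_of_polarLE (hJ : IsFormEmbedding J) {r : ℝ} {u : H} (hr : 0 ≤ r)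
    (h : PolarLE (J '' Metric.closedBall 0 1) r u) : ∃ w, J w = u ∧ ‖w‖ ≤ r := by
  have : u ∈ J '' Metric.closedBall 0 r := by
    rw [hJ.mem_image_closedBall_iff hr]
    refine fun f => h f _ fun b hb => ?_
    simpa using (hJ.mem_image_closedBall_iff zero_le_one b).1 hb f
  obtain ⟨w, hw, rfl⟩ := this
  exact ⟨w, rfl, by simpa using hw⟩

omit [CompleteSpace H] [CompleteSpace V] in
theorem polarLE_of_norm_le {v : V} {r : ℝ} (h : ‖v‖ ≤ r) :
    PolarLE (J '' Metric.closedBall 0 1) r (J v) := by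
  intro φ c hc
  have h0 : 0 ≤ c := by simpa using hc 0 ⟨0, by simp, by simp⟩
  have h1 : ⟪φ, J v⟫_ℝ ≤ ‖v‖ * c := by
    rcases eq_or_ne v 0 with rfl | hv
    · simp
    have hv : 0 < ‖v‖ := norm_pos_iff.2 hv
    have := hc (J (‖v‖⁻¹ • v)) ⟨_, by simp [norm_smul, hv.ne'], rfl⟩
    rw [map_smul, inner_smul_right, inv_mul_le_iff₀ hv] at this
    exact this
  exact h1.trans (mul_le_mul_of_nonneg_right h h0)

/-- For `J v = κ p + (1 - κ) J z` with `z = J* p`, one has `⟪v, z⟫ = κ‖p‖² + (1 - κ)‖z‖²`. As `‖z‖ ≤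
‖p‖`, this is at least `‖z‖²`. -/
theorem IsFormEmbedding.resolv_contraction (hJ : IsFormEmbedding J) {κ : ℝ} (h0 : 0 < κ)
    (h1 : κ ≤ 1) (v : V) : ∃ z, J z = resolv (formResolvent J) κ (J v) ∧ ‖z‖ ≤ ‖v‖ := by
  have hspec := hJ.isUnitResolvent.resInv_spec h0 h1 (J v)
  set p := resInv (formResolvent J) κ (J v)
  refine ⟨ContinuousLinearMap.adjoint J p, rfl, ?_⟩
  set z := ContinuousLinearMap.adjoint J p with hz
  have hRp : formResolvent J p = J z := rfl
  have a1 : ⟪v, z⟫_ℝ = κ * ‖p‖ ^ 2 + (1 - κ) * ‖z‖ ^ 2 := by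
    rw [hz, ContinuousLinearMap.adjoint_inner_right, hspec, inner_add_left, inner_smul_left,
      inner_smul_left, real_inner_self_eq_norm_sq, inner_formResolvent,
      real_inner_self_eq_norm_sq]
    simp
  have a2 : ‖z‖ ^ 2 = ⟪J z, p⟫_ℝ := by
    rw [← hRp, inner_formResolvent, real_inner_self_eq_norm_sq]
  have a3 := real_inner_le_norm (J z) p
  have a4 := hJ.norm_le z
  have a5 : ‖z‖ ≤ ‖p‖ := by
    by_contra! hlt
    nlinarith [norm_nonneg p, norm_nonneg (J z)]
  have a6 := real_inner_le_norm v z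
  by_contra! hlt
  nlinarith [norm_nonneg v, norm_nonneg z, mul_self_le_mul_self (norm_nonneg z) a5]

variable {S : ℝ → H →L[ℝ] H}

theorem IsFormEmbedding.semigroup_contraction (hJ : IsFormEmbedding J)
    (hS : IsYosidaLimit (formResolvent J) S) (t : ℝ) {b : H}
    (hb : b ∈ J '' Metric.closedBall 0 1) : S t b ∈ J '' Metric.closedBall 0 1 := by
  refine hS.mem_of_resolv_mem hJ.isUnitResolvent (convex_image_closedBall J 1)
    (hJ.isClosed_image zero_le_one) (fun κ h0 h1 b hb => ?_) t hb
  obtain ⟨v, hv, rfl⟩ := hb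
  obtain ⟨z, hz, hzv⟩ := hJ.resolv_contraction h0 h1 v
  exact ⟨z, by simpa using hzv.trans (by simpa using hv), hz⟩

/-- `‖(1 - κ A)⁻¹ y‖_V² ≤ ‖(1 - κ A)⁻¹ y‖² - ⟪A_κ y, y⟫`. -/
theorem IsFormEmbedding.exists_resolv (hJ : IsFormEmbedding J) {κ : ℝ} (h0 : 0 < κ)
    (h1 : κ ≤ 1) (y : H) : ∃ z, J z = resolv (formResolvent J) κ y ∧
      ‖z‖ ^ 2 ≤ ‖y‖ ^ 2 - ⟪yosida (formResolvent J) κ y, y⟫_ℝ := by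
  have hspec := hJ.isUnitResolvent.resInv_spec h0 h1 y
  have hle := hJ.isUnitResolvent.norm_resolv_apply_le h0 h1 y
  have e1 : resolv (formResolvent J) κ y = formResolvent J (resInv (formResolvent J) κ y) := rfl
  have e2 : yosida (formResolvent J) κ y = formResolvent J (resInv (formResolvent J) κ y)
    - resInv (formResolvent J) κ y := rfl
  rw [e1] at hle ⊢
  rw [e2]
  set p := resInv (formResolvent J) κ y
  refine ⟨ContinuousLinearMap.adjoint J p, rfl, ?_⟩
  have a1 : ⟪formResolvent J p, p⟫_ℝ = ‖ContinuousLinearMap.adjoint J p‖ ^ 2 := by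
    rw [inner_formResolvent, real_inner_self_eq_norm_sq]
  set z := formResolvent J p
  have e3 : y = z + κ • (p - z) := by rw [hspec]; module
  have a2 : ⟪z - p, y⟫_ℝ = ‖z‖ ^ 2 - ⟪z, p⟫_ℝ - κ * ‖p - z‖ ^ 2 := by
    rw [e3, inner_add_right, inner_smul_right, inner_sub_left, real_inner_self_eq_norm_sq,
      real_inner_comm z p, ← neg_sub p z, inner_neg_left, real_inner_self_eq_norm_sq]
    ring
  rw [a2, a1]
  have := mul_nonneg h0.le (sq_nonneg ‖p - z‖)
  nlinarith [norm_nonneg z, norm_nonneg y]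

/-- The semigroup maps `H` into the form domain. -/
theorem IsFormEmbedding.semigroup_smoothing (hJ : IsFormEmbedding J)
    (hS : IsYosidaLimit (formResolvent J) S) {t : ℝ} (ht : 0 < t) (f : H) :
    ∃ z, J z = S t f ∧ ‖z‖ ≤ √(1 + 1 / (2 * t)) * ‖f‖ := by
  -- Apply `exists_resolv` to `y = e^{tA_κ} f`: the energy term is at most `‖f‖²/(2t)` by
  -- `neg_inner_yosida_le`. Then let `κ → 0`, using lower semicontinuity of the form norm.
  have hR := hJ.isUnitResolvent
  have h := fun n => hJ.exists_resolv (yseq_pos n) (yseq_le_one n)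
    (yexp (formResolvent J) (yseq n) t f)
  choose z hz hzn using h
  have h1 := hS t f
  rw [max_eq_left ht.le] at h1
  refine hJ.exists_of_tendsto (l := atTop) (v := z) ?_ (.of_forall fun n => ?_)
  · simp_rw [hz]
    have h2 : Tendsto (fun n => resolv (formResolvent J) (yseq n)
        (yexp (formResolvent J) (yseq n) t f - S t f)) atTop (𝓝 0) := by
      refine squeeze_zero_norm (fun n =>
        hR.norm_resolv_apply_le (yseq_pos n) (yseq_le_one n) _) ?_
      simpa using (h1.sub_const (S t f)).norm
    have h3 := h2.add ((hR.tendsto_resolv (S t f)).comp tendsto_yseq)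
    rw [zero_add] at h3
    refine h3.congr fun n => ?_
    simp
  · have a := hR.neg_inner_yosida_le (yseq_pos n) (yseq_le_one n) ht.le f
    have b := hR.norm_yexp_apply_le (yseq_pos n) (yseq_le_one n) ht.le f
    have c : ‖z n‖ ^ 2 ≤ (1 + 1 / (2 * t)) * ‖f‖ ^ 2 := by
      have d : -⟪yosida (formResolvent J) (yseq n) (yexp (formResolvent J) (yseq n) t f),
          yexp (formResolvent J) (yseq n) t f⟫_ℝ ≤ 1 / (2 * t) * ‖f‖ ^ 2 := by
        rw [one_div_mul_eq_div, le_div_iff₀ (by positivity)]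
        linarith
      have e := pow_le_pow_left₀ (norm_nonneg _) b 2
      linarith [hzn n]
    rw [← Real.sqrt_sq (norm_nonneg f), ← Real.sqrt_mul (by positivity)]
    exact Real.le_sqrt_of_sq_le c

end FormSpace

/-! ### Mild solutions: continuity, restarting, and the exponential shift. -/

section Mild

variable {X : Type*} [NormedAddCommGroup X] [NormedSpace ℝ X]

/-- A strongly continuous semigroup, extended to negative times as a continuous family. -/
structure IsEvolution (S : ℝ → X →L[ℝ] X) : Prop where
  zero : S 0 = 1
  add : ∀ s t : ℝ, 0 ≤ s → 0 ≤ t → ∀ x, S (s + t) x = S s (S t x)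
  cont : Continuous fun p : ℝ × X => S p.1 p.2
  bdd : ∀ T : ℝ, ∃ C : ℝ, ∀ t ∈ Icc (-T) T, ‖S t‖ ≤ C

/-- The function `S t x + ∫₀ᵗ S (t - τ) (F τ) dτ`. -/
def mild (S : ℝ → X →L[ℝ] X) (x : X) (F : ℝ → X) (t : ℝ) : X :=
  S t x + ∫ τ in (0 : ℝ)..t, S (t - τ) (F τ)

/-- The semigroup `e^{-Kt} S t`. -/
def expShift (K : ℝ) (S : ℝ → X →L[ℝ] X) (t : ℝ) : X →L[ℝ] X := Real.exp (-(K * t)) • S t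

variable {S : ℝ → X →L[ℝ] X} {F : ℝ → X} {T : ℝ}

theorem IsEvolution.expShift (hS : IsEvolution S) (K : ℝ) : IsEvolution (expShift K S) where
  zero := by simp [NonlocalGL.expShift, hS.zero]
  add s t hs ht x := by
    simp only [NonlocalGL.expShift, smul_apply, hS.add s t hs ht, map_smul,
      smul_smul, ← Real.exp_add]
    ring_nf
  cont := by
    have := hS.cont
    simp only [NonlocalGL.expShift, smul_apply]
    fun_prop
  bdd T := by
    obtain ⟨C, hC⟩ := hS.bdd T
    refine ⟨Real.exp (|K| * T) * C, fun t ht => ?_⟩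
    rw [NonlocalGL.expShift, norm_smul, Real.norm_of_nonneg (Real.exp_pos _).le]
    refine mul_le_mul (Real.exp_le_exp.2 ?_) (hC t ht) (norm_nonneg _) (Real.exp_pos _).le
    refine (neg_le_abs _).trans ?_
    rw [abs_mul]
    exact mul_le_mul_of_nonneg_left (abs_le.2 ht) (abs_nonneg K)

theorem expShift_expShift (K K' : ℝ) (S : ℝ → X →L[ℝ] X) :
    expShift K (expShift K' S) = expShift (K + K') S := by
  ext t x
  simp only [expShift, smul_apply, smul_smul, ← Real.exp_add]
  ring_nf

theorem expShift_zero (S : ℝ → X →L[ℝ] X) : expShift 0 S = S := by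
  ext t x
  simp [expShift]

theorem IsEvolution.aestronglyMeasurable (hS : IsEvolution S) {μ : Measure ℝ}
    (hF : AEStronglyMeasurable F μ) (t : ℝ) :
    AEStronglyMeasurable (fun τ => S (t - τ) (F τ)) μ :=
  hS.cont.comp_aestronglyMeasurable
    ((show Continuous fun τ : ℝ => t - τ by fun_prop).aestronglyMeasurable.prodMk hF)

theorem IsEvolution.intervalIntegrable (hS : IsEvolution S) (hF : IntegrableOn F (Ioc 0 T))
    {t a b : ℝ} (ha : 0 ≤ a) (hab : a ≤ b) (hb : b ≤ T) :
    IntervalIntegrable (fun τ => S (t - τ) (F τ)) volume a b := by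
  rw [intervalIntegrable_iff_integrableOn_Ioc_of_le hab]
  have hF' : IntegrableOn F (Ioc a b) := hF.mono_set (Ioc_subset_Ioc ha hb)
  obtain ⟨C, hC⟩ := hS.bdd (|t| + |b|)
  refine (hF'.norm.const_mul C).mono' (hS.aestronglyMeasurable hF'.1 t) ?_
  filter_upwards [ae_restrict_mem measurableSet_Ioc] with τ hτ
  refine (S (t - τ)).le_of_opNorm_le (hC _ ?_) _
  have h1 := abs_le.1 (le_refl |t|)
  have h2 := le_abs_self b
  constructor <;> linarith [hτ.1, hτ.2]

theorem IsEvolution.intervalIntegrable_self (hS : IsEvolution S) (hF : IntegrableOn F (Ioc 0 T))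
    {t : ℝ} (ht : t ∈ Icc 0 T) :
    IntervalIntegrable (fun τ => S (t - τ) (F τ)) volume 0 t :=
  hS.intervalIntegrable hF le_rfl ht.1 ht.2

theorem IsEvolution.continuousOn_mild (hS : IsEvolution S) (hF : IntegrableOn F (Ioc 0 T))
    (x : X) : ContinuousOn (mild S x F) (Icc 0 T) := by
  -- With the forcing extended by zero to the line, `t` is unrestricted and the continuity theorem
  -- for parametric primitives applies.
  set F' := (Ioc 0 T).indicator F with hF'def
  have hF' : Integrable F' := (integrable_indicator_iff measurableSet_Ioc).2 hF
  have e : ∀ t ∈ Icc 0 T, mild S x F t = mild S x F' t := by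
    intro t ht
    unfold mild
    congr 1
    refine intervalIntegral.integral_congr_ae (.of_forall fun τ hτ => ?_)
    rw [uIoc_of_le ht.1] at hτ
    rw [hF'def, indicator_of_mem (show τ ∈ Ioc 0 T from ⟨hτ.1, hτ.2.trans ht.2⟩)]
  refine ContinuousOn.congr (Continuous.continuousOn ?_) e
  refine (hS.cont.comp (by fun_prop : Continuous fun t : ℝ => (t, x))).add ?_
  rw [continuous_iff_continuousAt]
  intro t
  obtain ⟨C, hC⟩ := hS.bdd (2 * |t| + 3)
  have h := intervalIntegral.continuousAt_parametric_primitive_of_dominated (μ := volume)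
    (F := fun t τ => S (t - τ) (F' τ)) (fun τ => C * ‖F' τ‖) (-(|t| + 1)) (|t| + 1) (a₀ := 0)
    (b₀ := t) (x₀ := t) (fun s => (hS.aestronglyMeasurable hF'.1 s).restrict) ?_
    (hF'.norm.const_mul C).intervalIntegrable ?_ ?_ ?_ (by simp)
  · exact ContinuousAt.comp (f := fun t : ℝ => (t, t)) h (by fun_prop)
  · filter_upwards [Metric.ball_mem_nhds t one_pos] with s hs
    filter_upwards [ae_restrict_mem measurableSet_uIoc] with τ hτ
    rw [uIoc_of_le (by linarith [abs_nonneg t])] at hτ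
    rw [Metric.mem_ball, Real.dist_eq, abs_lt] at hs
    refine (S (s - τ)).le_of_opNorm_le (hC _ ?_) _
    have h1 := abs_le.1 (le_refl |t|)
    constructor <;> linarith [hτ.1, hτ.2, hs.1, hs.2]
  · refine .of_forall fun τ => ?_
    exact (hS.cont.comp (by fun_prop : Continuous fun s : ℝ => (s - τ, F' τ))).continuousAt
  · constructor <;> linarith [abs_nonneg t]
  · constructor <;> linarith [abs_le.1 (le_refl |t|)]

variable [CompleteSpace X]

/-- The semigroup property of mild solutions. -/
theorem IsEvolution.mild_restart (hS : IsEvolution S) (hF : IntegrableOn F (Ioc 0 T)) (x : X)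
    {s t : ℝ} (hs : 0 ≤ s) (hst : s ≤ t) (ht : t ≤ T) :
    mild S x F t = S (t - s) (mild S x F s) + ∫ τ in s..t, S (t - τ) (F τ) := by
  have h1 : S (t - s) (∫ τ in (0 : ℝ)..s, S (s - τ) (F τ)) = ∫ τ in (0 : ℝ)..s, S (t - τ) (F τ) := by
    rw [← ContinuousLinearMap.intervalIntegral_comp_comm _
      (hS.intervalIntegrable_self hF ⟨hs, hst.trans ht⟩)]
    refine intervalIntegral.integral_congr_ae (.of_forall fun τ hτ => ?_)
    rw [uIoc_of_le hs] at hτ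
    rw [← hS.add _ _ (by linarith) (by linarith [hτ.2])]
    congr 2
    ring
  have h2 : S t x = S (t - s) (S s x) := by
    rw [← hS.add _ _ (by linarith) hs, sub_add_cancel]
  rw [mild, mild, map_add, h1, h2, add_assoc, intervalIntegral.integral_add_adjacent_intervals
    (hS.intervalIntegrable hF le_rfl hs (hst.trans ht)) (hS.intervalIntegrable hF hs hst ht)]

/-- Integration by parts against a primitive. -/
theorem integral_exp_smul_primitive (K : ℝ) {t : ℝ} (ht : 0 ≤ t) {y : ℝ → X}
    (hy : IntervalIntegrable y volume 0 t) :
    ∫ s in (0 : ℝ)..t, (K * Real.exp (-(K * (t - s)))) • ∫ r in (0 : ℝ)..s, y r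
      = ∫ r in (0 : ℝ)..t, (1 - Real.exp (-(K * (t - r)))) • y r := by
  rw [intervalIntegrable_iff_integrableOn_Ioc_of_le ht] at hy
  set μ := (volume : Measure ℝ).restrict (Ioc 0 t) with hμ
  set g : ℝ → ℝ := fun s => K * Real.exp (-(K * (t - s))) with hg
  have hgc : Continuous g := by fun_prop
  -- Fubini on the triangle `r ≤ s`: integrating the kernel over `s` from `r` to `t` gives `1 -
  -- e^{-K(t-r)}`.
  set f : ℝ → ℝ → X := fun s r => (Iic s).indicator (fun r => g s • y r) r with hf
  have hint : Integrable (Function.uncurry f) (μ.prod μ) := by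
    have h1 : Integrable g μ := by
      rw [hμ, ← IntegrableOn, ← intervalIntegrable_iff_integrableOn_Ioc_of_le ht]
      exact hgc.intervalIntegrable _ _
    have h2 : Integrable (fun p : ℝ × ℝ => g p.1 • y p.2) (μ.prod μ) := h1.smul_prod hy
    have hm : MeasurableSet {p : ℝ × ℝ | p.2 ≤ p.1} := measurableSet_le measurable_snd measurable_fst
    refine (h2.indicator hm).congr (.of_forall fun p => ?_)
    simp only [Function.uncurry, hf, indicator, mem_ofPred_eq, mem_Iic]
  have hswap := integral_integral_swap hint
  rw [intervalIntegral.integral_of_le ht, intervalIntegral.integral_of_le ht]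
  have e1 : ∀ s ∈ Ioc 0 t, ∫ r, f s r ∂μ = g s • ∫ r in (0 : ℝ)..s, y r := by
    intro s hs
    rw [hf, integral_indicator measurableSet_Iic, hμ, Measure.restrict_restrict measurableSet_Iic,
      integral_smul, intervalIntegral.integral_of_le hs.1.le, inter_comm, Ioc_inter_Iic,
      min_eq_right hs.2]
  have e2 : ∀ r ∈ Ioc 0 t, ∫ s, f s r ∂μ = (1 - Real.exp (-(K * (t - r)))) • y r := by
    intro r hr
    have e3 : ∀ s, f s r = (Ici r).indicator g s • y r := by
      intro s
      by_cases h : r ≤ s <;> simp [hf, indicator, h]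
    simp_rw [e3]
    rw [integral_smul_const, integral_indicator measurableSet_Ici, hμ,
      Measure.restrict_restrict measurableSet_Ici]
    congr 1
    have e4 : Ici r ∩ Ioc 0 t = Icc r t := by
      ext s
      simp only [mem_inter_iff, mem_Ici, mem_Ioc, mem_Icc]
      constructor
      · exact fun h => ⟨h.1, h.2.2⟩
      · exact fun h => ⟨h.1, hr.1.trans_le h.1, h.2⟩
    rw [e4, integral_Icc_eq_integral_Ioc, ← intervalIntegral.integral_of_le hr.2]
    have hd : ∀ s ∈ uIcc r t, HasDerivAt (fun s => Real.exp (-(K * (t - s)))) (g s) s := by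
      intro s _
      have := (((hasDerivAt_id s).const_sub t).const_mul K).neg.exp
      refine this.congr_deriv ?_
      simp [hg]
      ring
    rw [intervalIntegral.integral_eq_sub_of_hasDerivAt hd (hgc.intervalIntegrable _ _)]
    simp
  rw [← setIntegral_congr_fun measurableSet_Ioc e2, ← hswap, hμ,
    setIntegral_congr_fun measurableSet_Ioc e1]

/-- A mild solution for `S` is a mild solution for `e^{-Kt} S t` with the forcing `K u + F`. -/
theorem IsEvolution.mild_expShift (hS : IsEvolution S) (hF : IntegrableOn F (Ioc 0 T)) (x : X)
    (K : ℝ) {t : ℝ} (ht : t ∈ Icc 0 T) :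
    mild S x F t = mild (NonlocalGL.expShift K S) x (fun s => K • mild S x F s + F s) t := by
  have hT : 0 ≤ T := ht.1.trans ht.2
  set u := mild S x F
  set y : ℝ → X := fun r => S (t - r) (F r)
  have hy : IntervalIntegrable y volume 0 t := hS.intervalIntegrable_self hF ht
  -- Propagating `u s` to time `t` gives `S t x` plus a primitive of `y r = S (t - r) (F r)`. The
  -- forcing `K u` thus contributes `K e^{-K(t-s)}` times this primitive, and integration by parts
  -- restores what the factor `e^{-K(t-s)}` removed.
  have hu : ∀ s ∈ Icc 0 t, S (t - s) (u s) = S t x + ∫ r in (0 : ℝ)..s, y r := by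
    intro s hs
    have h : u t = S (t - s) (u s) + ∫ r in s..t, y r :=
      hS.mild_restart hF x hs.1 hs.2 ht.2
    have h2 : u t = S t x + ((∫ r in (0 : ℝ)..s, y r) + ∫ r in s..t, y r) := by
      rw [intervalIntegral.integral_add_adjacent_intervals
        (hS.intervalIntegrable hF le_rfl hs.1 (hs.2.trans ht.2))
        (hS.intervalIntegrable hF hs.1 hs.2 ht.2)]
      rfl
    rw [h2, ← add_assoc] at h
    exact (add_right_cancel h).symm
  have hprim : ContinuousOn (fun s => ∫ r in (0 : ℝ)..s, y r) (uIcc 0 t) :=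
    intervalIntegral.continuousOn_primitive_interval' hy (by simp [ht.1])
  have e1 : ∫ τ in (0 : ℝ)..t, NonlocalGL.expShift K S (t - τ) (K • u τ + F τ)
      = ∫ τ in (0 : ℝ)..t, ((K * Real.exp (-(K * (t - τ)))) • S t x
        + (K * Real.exp (-(K * (t - τ)))) • (∫ r in (0 : ℝ)..τ, y r)
        + Real.exp (-(K * (t - τ))) • y τ) := by
    refine intervalIntegral.integral_congr_ae (.of_forall fun τ hτ => ?_)
    rw [uIoc_of_le ht.1] at hτ
    simp only [NonlocalGL.expShift, smul_apply, map_add, map_smul,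
      hu τ ⟨hτ.1.le, hτ.2⟩, y]
    module
  have i1 : IntervalIntegrable (fun τ => (K * Real.exp (-(K * (t - τ)))) • S t x) volume 0 t :=
    Continuous.intervalIntegrable (by fun_prop) _ _
  have i2 : IntervalIntegrable (fun τ => (K * Real.exp (-(K * (t - τ)))) •
      (∫ r in (0 : ℝ)..τ, y r)) volume 0 t :=
    ContinuousOn.intervalIntegrable (ContinuousOn.smul (by fun_prop) hprim)
  have i3 : IntervalIntegrable (fun τ => Real.exp (-(K * (t - τ))) • y τ) volume 0 t :=
    hy.continuousOn_smul (by fun_prop)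
  have e2 : ∫ τ in (0 : ℝ)..t, (K * Real.exp (-(K * (t - τ)))) • S t x
      = (1 - Real.exp (-(K * t))) • S t x := by
    rw [intervalIntegral.integral_smul_const]
    congr 1
    have hd : ∀ s ∈ uIcc 0 t, HasDerivAt (fun s => Real.exp (-(K * (t - s))))
        (K * Real.exp (-(K * (t - s)))) s := by
      intro s _
      have := (((hasDerivAt_id s).const_sub t).const_mul K).neg.exp
      refine this.congr_deriv ?_
      simp
      ring
    rw [intervalIntegral.integral_eq_sub_of_hasDerivAt hd
      (Continuous.intervalIntegrable (by fun_prop) _ _)]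
    simp
  have e3 : ∫ r in (0 : ℝ)..t, (1 - Real.exp (-(K * (t - r)))) • y r
      = (∫ r in (0 : ℝ)..t, y r) - ∫ r in (0 : ℝ)..t, Real.exp (-(K * (t - r))) • y r := by
    rw [← intervalIntegral.integral_sub hy i3]
    refine intervalIntegral.integral_congr fun r _ => ?_
    module
  change u t = Real.exp (-(K * t)) • S t x + _
  rw [e1, intervalIntegral.integral_add (i1.add i2) i3, intervalIntegral.integral_add i1 i2, e2,
    integral_exp_smul_primitive K ht.1 hy, e3]
  change S t x + (∫ r in (0 : ℝ)..t, y r) = _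
  module

/-- The converse of `IsEvolution.mild_expShift`. -/
theorem IsEvolution.eq_mild_of_expShift (hS : IsEvolution S) {u : ℝ → X} {K : ℝ}
    (hF : IntegrableOn F (Ioc 0 T)) (hu : ContinuousOn u (Icc 0 T)) (x : X)
    (h : ∀ t ∈ Icc 0 T, u t = mild (NonlocalGL.expShift K S) x (fun s => K • u s + F s) t) {t : ℝ}
    (ht : t ∈ Icc 0 T) : u t = mild S x F t := by
  have hG : IntegrableOn (fun s => K • u s + F s) (Ioc 0 T) :=
    (((hu.const_smul K).integrableOn_Icc).mono_set Ioc_subset_Icc_self).add hF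
  -- Shifting back by `-K` cancels the exponential factors and the term `K u`.
  have h2 := (hS.expShift K).mild_expShift hG x (-K) ht
  rw [← h t ht, expShift_expShift, neg_add_cancel, expShift_zero] at h2
  rw [h2]
  change _ + _ = _ + _
  congr 1
  refine intervalIntegral.integral_congr_ae (.of_forall fun τ hτ => ?_)
  rw [uIoc_of_le ht.1] at hτ
  simp only [← h τ ⟨hτ.1.le, hτ.2.trans ht.2⟩]
  congr 1
  module

end Mild

/-! ### Gronwall's inequality in integral form. -/

section Gronwall

theorem isEvolution_exp : IsEvolution (fun t => Real.exp t • (1 : ℝ →L[ℝ] ℝ)) where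
  zero := by simp
  add s t _ _ x := by simp [Real.exp_add, mul_assoc]
  cont := by
    simp only [smul_apply]
    fun_prop
  bdd T := by
    refine ⟨Real.exp T, fun t ht => ?_⟩
    rw [norm_smul, Real.norm_of_nonneg (Real.exp_pos _).le]
    have : ‖(1 : ℝ →L[ℝ] ℝ)‖ = 1 := norm_one
    rw [this, mul_one]
    exact Real.exp_le_exp.2 ht.2

/-- Let `e^{-s} D s` attain its maximum `M` at `m`. Then `D s ≤ e^s M`, so the hypothesis at `m`
reads `e^m M ≤ M (e^m - e^{-Km})`, which forces `M ≤ 0`. -/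
theorem nonpos_of_le_integral {D : ℝ → ℝ} {T K : ℝ} (hK : 0 ≤ K) (hD : ContinuousOn D (Icc 0 T))
    (h : ∀ t ∈ Icc 0 T, D t ≤ ∫ s in (0 : ℝ)..t, Real.exp (-(K * (t - s))) * ((K + 1) * D s))
    {t : ℝ} (ht : t ∈ Icc 0 T) : D t ≤ 0 := by
  obtain ⟨m, hm, hmax⟩ := isCompact_Icc.exists_isMaxOn ⟨t, ht⟩
    (ContinuousOn.mul (f := fun s => Real.exp (-s)) (by fun_prop) hD)
  set M := Real.exp (-m) * D m with hM
  have hle : ∀ s ∈ Icc 0 T, D s ≤ Real.exp s * M := by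
    intro s hs
    have h1 : Real.exp (-s) * D s ≤ M := hmax hs
    have h2 := mul_le_mul_of_nonneg_left h1 (Real.exp_pos s).le
    rwa [← mul_assoc, ← Real.exp_add, add_neg_cancel, Real.exp_zero, one_mul] at h2
  suffices hM0 : M ≤ 0 from
    (hle t ht).trans (mul_nonpos_of_nonneg_of_nonpos (Real.exp_pos t).le hM0)
  have h1 := h m hm
  have h2 : ∫ s in (0 : ℝ)..m, Real.exp (-(K * (m - s))) * ((K + 1) * D s)
      ≤ ∫ s in (0 : ℝ)..m, M * ((K + 1) * Real.exp (-(K * m) + (K + 1) * s)) := by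
    have hDm : ContinuousOn D (uIcc 0 m) := by
      rw [uIcc_of_le hm.1]
      exact hD.mono (Icc_subset_Icc_right hm.2)
    refine intervalIntegral.integral_mono_on hm.1
      (ContinuousOn.intervalIntegrable (by fun_prop))
      (Continuous.intervalIntegrable (by fun_prop) _ _) fun s hs => ?_
    have h3 := hle s ⟨hs.1, hs.2.trans hm.2⟩
    have h4 : Real.exp (-(K * m) + (K + 1) * s) = Real.exp (-(K * (m - s))) * Real.exp s := by
      rw [← Real.exp_add]; ring_nf
    rw [h4]
    calc Real.exp (-(K * (m - s))) * ((K + 1) * D s)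
        ≤ Real.exp (-(K * (m - s))) * ((K + 1) * (Real.exp s * M)) := by gcongr
      _ = _ := by ring
  have h5 : ∫ s in (0 : ℝ)..m, M * ((K + 1) * Real.exp (-(K * m) + (K + 1) * s))
      = M * (Real.exp m - Real.exp (-(K * m))) := by
    rw [intervalIntegral.integral_const_mul]
    congr 1
    have hd : ∀ s ∈ uIcc 0 m, HasDerivAt (fun s => Real.exp (-(K * m) + (K + 1) * s))
        ((K + 1) * Real.exp (-(K * m) + (K + 1) * s)) s := by
      intro s _
      refine ((((hasDerivAt_id s).const_mul (K + 1)).const_add (-(K * m))).exp).congr_deriv ?_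
      simp only [id]
      ring
    rw [intervalIntegral.integral_eq_sub_of_hasDerivAt hd
      (Continuous.intervalIntegrable (by fun_prop) _ _)]
    ring_nf
  rw [h5] at h2
  have h6 : D m = Real.exp m * M := by
    rw [hM, ← mul_assoc, ← Real.exp_add, add_neg_cancel, Real.exp_zero, one_mul]
  have h7 : M * Real.exp (-(K * m)) ≤ 0 := by nlinarith
  by_contra! hlt
  have := mul_pos hlt (Real.exp_pos (-(K * m)))
  linarith

/-- Gronwall's inequality for `N' ≤ N + e`, in a form with an exponential shift. -/
theorem gronwall_expShift {N e : ℝ → ℝ} {T K N₀ : ℝ} (hK : 0 ≤ K) (hN : ContinuousOn N (Icc 0 T))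
    (he : IntegrableOn e (Ioc 0 T))
    (h : ∀ t ∈ Icc 0 T, N t ≤ Real.exp (-(K * t)) * N₀
      + ∫ s in (0 : ℝ)..t, Real.exp (-(K * (t - s))) * ((K + 1) * N s + e s))
    {t : ℝ} (ht : t ∈ Icc 0 T) :
    N t ≤ Real.exp t * N₀ + ∫ s in (0 : ℝ)..t, Real.exp (t - s) * e s := by
  -- The bound to be proved is the mild solution of `Z' = Z + e` for the scalar semigroup `e^t`.
  -- Shifted by `K + 1`, that semigroup becomes `e^{-Kt}`, so `Z` satisfies the hypothesis with
  -- equality and `N - Z` is nonpositive by comparison.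
  set Z := mild (fun t => Real.exp t • (1 : ℝ →L[ℝ] ℝ)) N₀ e with hZdef
  have hZ : ∀ t ∈ Icc 0 T, Z t = Real.exp (-(K * t)) * N₀
      + ∫ s in (0 : ℝ)..t, Real.exp (-(K * (t - s))) * ((K + 1) * Z s + e s) := by
    intro t ht
    rw [hZdef, isEvolution_exp.mild_expShift he N₀ (K + 1) ht, ← hZdef]
    have hone : ∀ r : ℝ, (1 : ℝ →L[ℝ] ℝ) r = r := fun _ => rfl
    unfold mild expShift
    simp only [smul_apply, hone, smul_eq_mul, ← mul_assoc, ← Real.exp_add]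
    congr 1
    · ring_nf
    · refine intervalIntegral.integral_congr fun s _ => ?_
      ring_nf
  have hZc : ContinuousOn Z (Icc 0 T) := isEvolution_exp.continuousOn_mild he N₀
  have key : N t - Z t ≤ 0 := by
    refine nonpos_of_le_integral hK (hN.sub hZc) (fun t ht => ?_) ht
    have hsub : uIcc 0 t ⊆ Icc 0 T := by
      rw [uIcc_of_le ht.1]; exact Icc_subset_Icc_right ht.2
    have hei : IntervalIntegrable e volume 0 t := by
      rw [intervalIntegrable_iff_integrableOn_Ioc_of_le ht.1]
      exact he.mono_set (Ioc_subset_Ioc_right ht.2)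
    have i1 : IntervalIntegrable (fun s => Real.exp (-(K * (t - s))) * ((K + 1) * N s + e s))
        volume 0 t :=
      IntervalIntegrable.continuousOn_mul
        (((hN.mono hsub).const_smul (K + 1)).intervalIntegrable.add hei) (by fun_prop)
    have i2 : IntervalIntegrable (fun s => Real.exp (-(K * (t - s))) * ((K + 1) * Z s + e s))
        volume 0 t :=
      IntervalIntegrable.continuousOn_mul
        (((hZc.mono hsub).const_smul (K + 1)).intervalIntegrable.add hei) (by fun_prop)
    have e1 : ∫ s in (0 : ℝ)..t, Real.exp (-(K * (t - s))) * ((K + 1) * (N s - Z s))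
        = (∫ s in (0 : ℝ)..t, Real.exp (-(K * (t - s))) * ((K + 1) * N s + e s))
          - ∫ s in (0 : ℝ)..t, Real.exp (-(K * (t - s))) * ((K + 1) * Z s + e s) := by
      rw [← intervalIntegral.integral_sub i1 i2]
      refine intervalIntegral.integral_congr fun s _ => ?_
      ring
    change N t - Z t ≤ ∫ s in (0 : ℝ)..t, Real.exp (-(K * (t - s))) * ((K + 1) * (N s - Z s))
    rw [e1]
    have := h t ht
    have := hZ t ht
    linarith
  have h2 : Z t = Real.exp t * N₀ + ∫ s in (0 : ℝ)..t, Real.exp (t - s) * e s := rfl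
  linarith

end Gronwall

/-! ### Picard iteration inside a family of closed sets. -/

section FixedPoint

variable {X : Type*} [NormedAddCommGroup X] [NormedSpace ℝ X] [CompleteSpace X]
variable {S : ℝ → X →L[ℝ] X}

/-- Picard iteration for `u = e^{-Kt} S t x + ∫₀ᵗ e^{-K(t-s)} S (t - s) (h (u s)) ds` with a
`(K + 1)`-Lipschitz nonlinearity `h`, within an invariant family of closed sets. -/
theorem IsEvolution.exists_fixedPoint (hS : IsEvolution S) (hS1 : ∀ t x, ‖S t x‖ ≤ ‖x‖) {K T : ℝ}
    (hK : 0 ≤ K) (hT : 0 ≤ T) {h : X → X} (hh : ∀ x y, ‖h x - h y‖ ≤ (K + 1) * ‖x - y‖) (x : X)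
    {C : ℝ → Set X} (hC : ∀ t ∈ Icc 0 T, IsClosed (C t)) (h0 : ∀ t ∈ Icc 0 T, (0 : X) ∈ C t)
    (hinv : ∀ u : ℝ → X, Continuous u → (∀ t ∈ Icc 0 T, u t ∈ C t) →
      ∀ t ∈ Icc 0 T, mild (NonlocalGL.expShift K S) x (fun s => h (u s)) t ∈ C t) :
    ∃ u : ℝ → X, Continuous u ∧ (∀ t ∈ Icc 0 T, u t ∈ C t) ∧
      ∀ t ∈ Icc 0 T, u t = mild (NonlocalGL.expShift K S) x (fun s => h (u s)) t := by
  have hhc : Continuous h := by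
    have : LipschitzWith (K + 1).toNNReal h := LipschitzWith.of_dist_le_mul fun x y => by
      rw [dist_eq_norm, dist_eq_norm, Real.coe_toNNReal _ (by linarith)]
      exact hh x y
    exact this.continuous
  -- The weight `e^{3t}` gives the contraction factor `(K+1)/(K+3)` on the whole interval at once:
  -- `(K+1) ∫₀ᵗ e^{-K(t-s)} e^{3s} ds ≤ (K+1)/(K+3) e^{3t}`. The projection onto `[0,T]` makes the
  -- path continuous on the line.
  let lift : C(Icc 0 T, X) → ℝ → X := fun w t => Real.exp (3 * t) • w (projIcc 0 T hT t)
  have hlift : ∀ w, Continuous (lift w) := fun w =>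
    (by fun_prop : Continuous fun t : ℝ => Real.exp (3 * t)).smul
      (w.continuous.comp continuous_projIcc)
  have hint : ∀ w, IntegrableOn (fun s => h (lift w s)) (Ioc 0 T) := fun w =>
    ((hhc.comp (hlift w)).integrableOn_Icc).mono_set Ioc_subset_Icc_self
  let G : C(Icc 0 T, X) → C(Icc 0 T, X) := fun w =>
    ⟨fun t => Real.exp (-(3 * (t : ℝ))) • mild (NonlocalGL.expShift K S) x
      (fun s => h (lift w s)) t, by
      have := continuousOn_iff_continuous_domRestrict.1 ((hS.expShift K).continuousOn_mild (hint w) x)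
      exact (by fun_prop : Continuous fun t : Icc 0 T => Real.exp (-(3 * (t : ℝ)))).smul this⟩
  have hGlift : ∀ w, ∀ t ∈ Icc 0 T, lift (G w) t
      = mild (NonlocalGL.expShift K S) x (fun s => h (lift w s)) t := by
    intro w t ht
    simp only [lift, G, ContinuousMap.coe_mk, projIcc_of_mem hT ht, smul_smul, ← Real.exp_add,
      add_neg_cancel, Real.exp_zero, one_smul]
  let A : Set C(Icc 0 T, X) := {w | ∀ t ∈ Icc 0 T, lift w t ∈ C t}
  have hA : IsClosed A := by
    have : A = ⋂ t ∈ Icc 0 T, {w | lift w t ∈ C t} := by ext; simp [A]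
    rw [this]
    refine isClosed_biInter fun t ht => (hC t ht).preimage ?_
    exact (continuous_eval_const (F := C(Icc 0 T, X)) _).const_smul _
  have hGA : MapsTo G A A := fun w hw t ht => by
    rw [hGlift w t ht]
    exact hinv _ (hlift w) hw t ht
  have hK3 : 0 < K + 3 := by linarith
  have hcontr : LipschitzWith ((K + 1) / (K + 3)).toNNReal G := by
    refine LipschitzWith.of_dist_le_mul fun w w' => ?_
    have hq : 0 ≤ (K + 1) / (K + 3) := by positivity
    rw [Real.coe_toNNReal _ hq, ContinuousMap.dist_le (by positivity)]
    rintro ⟨t, ht⟩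
    have hd : ∀ s ∈ Icc 0 T, ‖h (lift w s) - h (lift w' s)‖
        ≤ (K + 1) * (Real.exp (3 * s) * dist w w') := by
      intro s hs
      refine (hh _ _).trans (mul_le_mul_of_nonneg_left ?_ (by linarith))
      simp only [lift]
      rw [← smul_sub, norm_smul, Real.norm_of_nonneg (Real.exp_pos _).le, ← dist_eq_norm]
      exact mul_le_mul_of_nonneg_left (ContinuousMap.dist_apply_le_dist _) (Real.exp_pos _).le
    have hE := hS.expShift K
    have e1 : mild (NonlocalGL.expShift K S) x (fun s => h (lift w s)) t
        - mild (NonlocalGL.expShift K S) x (fun s => h (lift w' s)) t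
        = ∫ s in (0 : ℝ)..t, NonlocalGL.expShift K S (t - s) (h (lift w s) - h (lift w' s)) := by
      unfold mild
      rw [add_sub_add_left_eq_sub, ← intervalIntegral.integral_sub
        (hE.intervalIntegrable_self (hint w) ht) (hE.intervalIntegrable_self (hint w') ht)]
      simp
    have e2 : ‖∫ s in (0 : ℝ)..t, NonlocalGL.expShift K S (t - s)
          (h (lift w s) - h (lift w' s))‖
        ≤ ∫ s in (0 : ℝ)..t, (K + 1) * dist w w' * Real.exp (-(K * t) + (K + 3) * s) := by
      refine intervalIntegral.norm_integral_le_of_norm_le ht.1 (.of_forall fun s hs => ?_)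
        (Continuous.intervalIntegrable (by fun_prop) _ _)
      rw [NonlocalGL.expShift, smul_apply, norm_smul, Real.norm_of_nonneg (Real.exp_pos _).le]
      have h4 : Real.exp (-(K * t) + (K + 3) * s)
          = Real.exp (-(K * (t - s))) * Real.exp (3 * s) := by
        rw [← Real.exp_add]; ring_nf
      rw [h4]
      have := (hS1 (t - s) (h (lift w s) - h (lift w' s))).trans
        (hd s ⟨hs.1.le, hs.2.trans ht.2⟩)
      calc _ ≤ Real.exp (-(K * (t - s))) * ((K + 1) * (Real.exp (3 * s) * dist w w')) := by gcongr
        _ = _ := by ring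
    have e3 : ∫ s in (0 : ℝ)..t, (K + 1) * dist w w' * Real.exp (-(K * t) + (K + 3) * s)
        ≤ (K + 1) / (K + 3) * dist w w' * Real.exp (3 * t) := by
      have hd : ∀ s ∈ uIcc 0 t, HasDerivAt
          (fun s => (K + 1) / (K + 3) * dist w w' * Real.exp (-(K * t) + (K + 3) * s))
          ((K + 1) * dist w w' * Real.exp (-(K * t) + (K + 3) * s)) s := by
        intro s _
        refine (((((hasDerivAt_id s).const_mul (K + 3)).const_add (-(K * t))).exp).const_mul
          ((K + 1) / (K + 3) * dist w w')).congr_deriv ?_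
        simp only [id]
        field_simp
      rw [intervalIntegral.integral_eq_sub_of_hasDerivAt hd
        (Continuous.intervalIntegrable (by fun_prop) _ _)]
      have e4 : -(K * t) + (K + 3) * t = 3 * t := by ring
      rw [e4, sub_le_self_iff]
      positivity
    change dist (Real.exp (-(3 * t)) • mild (NonlocalGL.expShift K S) x (fun s => h (lift w s)) t)
      (Real.exp (-(3 * t)) • mild (NonlocalGL.expShift K S) x (fun s => h (lift w' s)) t) ≤ _
    rw [dist_eq_norm, ← smul_sub, norm_smul, Real.norm_of_nonneg (Real.exp_pos _).le, e1]
    calc _ ≤ Real.exp (-(3 * t)) * ((K + 1) / (K + 3) * dist w w' * Real.exp (3 * t)) := by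
          gcongr; exact e2.trans e3
      _ = (K + 1) / (K + 3) * dist w w' * Real.exp (-(3 * t) + 3 * t) := by
          rw [Real.exp_add]; ring
      _ = _ := by simp
  have hcw : ContractingWith ((K + 1) / (K + 3)).toNNReal (hGA.restrict G A A) := by
    refine ⟨?_, fun a b => hcontr a b⟩
    rw [Real.toNNReal_lt_one, div_lt_one hK3]
    linarith
  have h0A : (0 : C(Icc 0 T, X)) ∈ A := fun t ht => by
    simpa [lift] using h0 t ht
  obtain ⟨w, hwA, hw, -⟩ := hcw.exists_fixedPoint' hA.isComplete hGA h0A (edist_ne_top _ _)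
  refine ⟨lift w, hlift w, hwA, fun t ht => ?_⟩
  rw [← hGlift w t ht, hw.eq]

end FixedPoint

/-! ### The Lévy density and the jump measure. -/

section Kernel

/-- The truncated Lévy density `min (z², 1) / |z|^{1+α}`. -/
def levy (α z : ℝ) : ℝ := min (z ^ 2) 1 / |z| ^ (1 + α)

theorem levy_nonneg (α z : ℝ) : 0 ≤ levy α z := by unfold levy; positivity

theorem measurable_levy (α : ℝ) : Measurable (levy α) := by unfold levy; fun_prop

theorem levy_neg (α z : ℝ) : levy α (-z) = levy α z := by simp [levy]

/-- The density is at most `z^{1-α}` on `(0,1]` and at most `z^{-1-α}` beyond `1`: `α < 2` and `α >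
0` are what these two ranges need. Evenness covers the negative half-line. -/
theorem integrable_levy {α : ℝ} (hα : α ∈ Ioo (0 : ℝ) 2) : Integrable (levy α) := by
  have hα0 := hα.1
  have hα2 := hα.2
  have h1 : IntegrableOn (levy α) (Ioc 0 1) := by
    have h : IntegrableOn (fun z : ℝ => z ^ (1 - α)) (Ioc 0 1) := by
      rw [← intervalIntegrable_iff_integrableOn_Ioc_of_le zero_le_one]
      exact intervalIntegral.intervalIntegrable_rpow' (by linarith)
    refine h.mono' (measurable_levy α).aestronglyMeasurable ?_
    filter_upwards [ae_restrict_mem measurableSet_Ioc] with z hz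
    rw [Real.norm_of_nonneg (levy_nonneg α z), levy, abs_of_pos hz.1,
      div_le_iff₀ (Real.rpow_pos_of_pos hz.1 _), ← Real.rpow_add hz.1]
    have : 1 - α + (1 + α) = (2 : ℕ) := by push_cast; ring
    rw [this, Real.rpow_natCast]
    exact min_le_left _ _
  have h2 : IntegrableOn (levy α) (Ioi 1) := by
    have h : IntegrableOn (fun z : ℝ => z ^ (-(1 + α))) (Ioi 1) :=
      integrableOn_Ioi_rpow_of_lt (by linarith) one_pos
    refine h.mono' (measurable_levy α).aestronglyMeasurable ?_
    filter_upwards [ae_restrict_mem measurableSet_Ioi] with z hz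
    have hz0 : 0 < z := one_pos.trans hz
    rw [Real.norm_of_nonneg (levy_nonneg α z), levy, abs_of_pos hz0, Real.rpow_neg hz0.le,
      ← one_div]
    exact div_le_div_of_nonneg_right (min_le_right _ _) (Real.rpow_nonneg hz0.le _)
  have h3 : IntegrableOn (levy α) (Ioi 0) := by
    rw [← Ioc_union_Ioi_eq_Ioi zero_le_one]
    exact h1.union h2
  have h4 : IntegrableOn (levy α) (Iio 0) := by
    have := (Measure.measurePreserving_neg (volume : Measure ℝ)).integrableOn_comp_preimage
      (Homeomorph.neg ℝ).measurableEmbedding (f := levy α) (s := Ioi 0)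
    have e : (levy α) ∘ Neg.neg = levy α := funext fun z => levy_neg α z
    have e2 : (Neg.neg ⁻¹' Ioi 0 : Set ℝ) = Iio 0 := by ext; simp
    rw [e, e2] at this
    exact this.2 h3
  have h5 : IntegrableOn (levy α) (Iio 0 ∪ Ici 0) :=
    h4.union ((integrableOn_Ici_iff_integrableOn_Ioi).2 h3)
  rwa [Iio_union_Ici, integrableOn_univ] at h5

/-- The density `(c/2) |x - y|^{-1-α}`. -/
def kernel (c α : ℝ) (p : ℝ × ℝ) : ℝ := c / 2 / |p.1 - p.2| ^ (1 + α)

theorem kernel_nonneg {c : ℝ} (hc : 0 < c) (α : ℝ) (p : ℝ × ℝ) : 0 ≤ kernel c α p := by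
  unfold kernel; positivity

theorem measurable_kernel (c α : ℝ) : Measurable (kernel c α) := by unfold kernel; fun_prop

/-- The measure `(c/2) |x - y|^{-1-α} dx dy`. -/
def jumpMeasure (c α : ℝ) : Measure (ℝ × ℝ) :=
  ((volume : Measure ℝ).prod volume).withDensity fun p => ENNReal.ofReal (kernel c α p)

theorem measurable_ofReal_kernel (c α : ℝ) :
    Measurable fun p => ENNReal.ofReal (kernel c α p) := (measurable_kernel c α).ennreal_ofReal

theorem jumpMeasure_ac (c α : ℝ) : jumpMeasure c α ≪ (volume : Measure ℝ).prod volume :=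
  withDensity_absolutelyContinuous _ _

theorem integral_jumpMeasure {c : ℝ} (hc : 0 < c) (α : ℝ) (g : ℝ × ℝ → ℝ) :
    ∫ p, g p ∂(jumpMeasure c α) = ∫ p, kernel c α p * g p ∂((volume : Measure ℝ).prod volume) := by
  rw [jumpMeasure, integral_withDensity_eq_integral_toReal_smul (measurable_ofReal_kernel c α)
    (.of_forall fun p => ENNReal.ofReal_lt_top)]
  simp [ENNReal.toReal_ofReal (kernel_nonneg hc α _)]

theorem integrable_jumpMeasure_iff {c : ℝ} (hc : 0 < c) (α : ℝ) (g : ℝ × ℝ → ℝ) :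
    Integrable g (jumpMeasure c α)
      ↔ Integrable (fun p => kernel c α p * g p) ((volume : Measure ℝ).prod volume) := by
  rw [jumpMeasure, integrable_withDensity_iff_integrable_smul' (measurable_ofReal_kernel c α)
    (.of_forall fun p => ENNReal.ofReal_lt_top)]
  simp [ENNReal.toReal_ofReal (kernel_nonneg hc α _)]

/-- The difference `f(x) - f(y)`. -/
def diff (f : ℝ → ℝ) (p : ℝ × ℝ) : ℝ := f p.1 - f p.2

theorem aestronglyMeasurable_diff {f : ℝ → ℝ} (hf : AEStronglyMeasurable f) :
    AEStronglyMeasurable (diff f) ((volume : Measure ℝ).prod volume) :=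
  hf.comp_fst.sub hf.comp_snd

theorem diff_congr_ae (c α : ℝ) {f g : ℝ → ℝ} (h : f =ᵐ[volume] g) :
    diff f =ᵐ[jumpMeasure c α] diff g := by
  refine (jumpMeasure_ac c α).ae_le ?_
  have h1 := (Measure.quasiMeasurePreserving_fst (μ := (volume : Measure ℝ))
    (ν := (volume : Measure ℝ))).ae_eq_comp h
  have h2 := (Measure.quasiMeasurePreserving_snd (μ := (volume : Measure ℝ))
    (ν := (volume : Measure ℝ))).ae_eq_comp h
  filter_upwards [h1, h2] with p hp1 hp2
  simp only [Function.comp] at hp1 hp2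
  simp only [diff, hp1, hp2]

theorem lintegral_diff_jumpMeasure {c : ℝ} (hc : 0 < c) (α : ℝ) {f : ℝ → ℝ}
    (hf : AEStronglyMeasurable f) :
    ∫⁻ p, ENNReal.ofReal (diff f p ^ 2) ∂(jumpMeasure c α) = ENNReal.ofReal (c / 2) *
      ∫⁻ x, ∫⁻ y, ENNReal.ofReal ((f x - f y) ^ 2 / |x - y| ^ (1 + α)) := by
  have hm : AEMeasurable (fun p => ENNReal.ofReal (diff f p ^ 2))
      ((volume : Measure ℝ).prod volume) :=
    ((aestronglyMeasurable_diff hf).aemeasurable.pow_const 2).ennreal_ofReal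
  have hm2 : AEMeasurable (fun p : ℝ × ℝ =>
      ENNReal.ofReal ((f p.1 - f p.2) ^ 2 / |p.1 - p.2| ^ (1 + α)))
      ((volume : Measure ℝ).prod volume) :=
    (((aestronglyMeasurable_diff hf).aemeasurable.pow_const 2).div
      (by fun_prop)).ennreal_ofReal
  rw [jumpMeasure, lintegral_withDensity_eq_lintegral_mul₀
    (measurable_ofReal_kernel c α).aemeasurable hm,
    ← lintegral_prod (fun p : ℝ × ℝ => ENNReal.ofReal ((f p.1 - f p.2) ^ 2 / |p.1 - p.2| ^ (1 + α))) hm2,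
    ← lintegral_const_mul'' _ hm2]
  refine lintegral_congr fun p => ?_
  rw [Pi.mul_apply, ← ENNReal.ofReal_mul (kernel_nonneg hc α p),
    ← ENNReal.ofReal_mul (by positivity)]
  congr 1
  simp only [kernel, diff]
  ring

theorem ofReal_norm_sq {Ω : Type*} [MeasurableSpace Ω] {μ : Measure Ω} (f : Lp ℝ 2 μ) :
    ENNReal.ofReal (‖f‖ ^ 2) = ∫⁻ x, ENNReal.ofReal (f x ^ 2) ∂μ := by
  have h1 : ‖f‖ ^ 2 = ∫ x, f x ^ 2 ∂μ := by
    rw [← real_inner_self_eq_norm_sq, L2.inner_def]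
    refine integral_congr_ae (.of_forall fun x => ?_)
    simp [pow_two]
  rw [h1, ofReal_integral_eq_lintegral_ofReal]
  · exact (memLp_two_iff_integrable_sq (Lp.aestronglyMeasurable f)).1 (Lp.memLp f)
  · exact .of_forall fun x => sq_nonneg _

end Kernel

/-! ### Test functions have finite Gagliardo energy. -/

section TestFunctions

theorem measurableSet_dom : MeasurableSet dom := measurableSet_Ioo

theorem IsTest.exists_bound {φ : ℝ → ℝ} (hφ : IsTest φ) : ∃ C : ℝ, 0 ≤ C ∧ (∀ x, |φ x| ≤ C) ∧
    ∀ x y, |φ x - φ y| ≤ C * |x - y| := by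
  obtain ⟨C₁, h1⟩ := hφ.2.1.exists_bound_of_continuous hφ.1.continuous
  obtain ⟨C₂, h2⟩ := ContDiff.lipschitzWith_of_hasCompactSupport hφ.2.1 hφ.1 (by simp)
  refine ⟨max C₁ C₂, (h1 0 |> (norm_nonneg _).trans).trans (le_max_left _ _),
    fun x => (h1 x).trans (le_max_left _ _), fun x y => ?_⟩
  have := h2.dist_le_mul x y
  rw [Real.dist_eq, Real.dist_eq] at this
  exact this.trans (mul_le_mul_of_nonneg_right (le_max_right _ _) (abs_nonneg _))

theorem IsTest.eq_zero {φ : ℝ → ℝ} (hφ : IsTest φ) {x : ℝ} (hx : x ∉ dom) : φ x = 0 :=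
  image_eq_zero_of_notMem_tsupport fun h => hx (hφ.2.2 h)

theorem IsTest.memLp {φ : ℝ → ℝ} (hφ : IsTest φ) :
    MemLp φ 2 ((volume : Measure ℝ).restrict dom) :=
  (hφ.1.continuous.memLp_of_hasCompactSupport hφ.2.1).restrict _

theorem IsTest.zero : IsTest 0 :=
  ⟨contDiff_const, HasCompactSupport.zero, by simp [tsupport]⟩

theorem IsTest.add {φ ψ : ℝ → ℝ} (hφ : IsTest φ) (hψ : IsTest ψ) : IsTest (φ + ψ) :=
  ⟨hφ.1.add hψ.1, hφ.2.1.add hψ.2.1, (tsupport_add φ ψ).trans (union_subset hφ.2.2 hψ.2.2)⟩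

theorem IsTest.smul {φ : ℝ → ℝ} (hφ : IsTest φ) (a : ℝ) : IsTest (a • φ) :=
  ⟨contDiff_const.smul hφ.1, hφ.2.1.smul_left (f := fun _ => a),
    (tsupport_smul_subset_right (fun _ => a) φ).trans hφ.2.2⟩

theorem IsTest.comp {φ h : ℝ → ℝ} (hφ : IsTest φ) (hh : ContDiff ℝ ∞ h) (h0 : h 0 = 0) :
    IsTest (h ∘ φ) :=
  ⟨hh.comp hφ.1, hφ.2.1.comp_left h0, (tsupport_comp_subset h0 φ).trans hφ.2.2⟩

theorem sq_le_levy {φ : ℝ → ℝ} {C : ℝ} (h1 : ∀ x, |φ x| ≤ C)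
    (h2 : ∀ x y, |φ x - φ y| ≤ C * |x - y|) (x y : ℝ) :
    (φ x - φ y) ^ 2 ≤ 4 * C ^ 2 * min ((x - y) ^ 2) 1 := by
  have a := h2 x y
  have b : |φ x - φ y| ≤ 2 * C := by
    have := abs_sub (φ x) (φ y)
    linarith [h1 x, h1 y]
  have c0 : 0 ≤ C := (abs_nonneg _).trans (h1 0)
  rcases min_cases ((x - y) ^ 2) 1 with ⟨h, _⟩ | ⟨h, _⟩ <;> rw [h]
  · rw [← sq_abs, ← sq_abs (x - y)]
    nlinarith [abs_nonneg (φ x - φ y), abs_nonneg (x - y), sq_nonneg (C * |x - y|),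
      pow_le_pow_left₀ (abs_nonneg _) a 2]
  · rw [← sq_abs]
    nlinarith [pow_le_pow_left₀ (abs_nonneg _) b 2]

theorem lintegral_diff_lt_top {α : ℝ} (hα : α ∈ Ioo (0 : ℝ) 2) {φ : ℝ → ℝ} (hφ : IsTest φ) :
    ∫⁻ x, ∫⁻ y, ENNReal.ofReal ((φ x - φ y) ^ 2 / |x - y| ^ (1 + α)) < ⊤ := by
  obtain ⟨C, hC, h1, h2⟩ := hφ.exists_bound
  set q : ℝ → ℝ≥0∞ := fun z => ENNReal.ofReal (4 * C ^ 2 * levy α z) with hq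
  have hqm : Measurable q := ((measurable_levy α).const_mul _).ennreal_ofReal
  have hqi : ∫⁻ z, q z < ⊤ := by
    have := ((integrable_levy hα).const_mul (4 * C ^ 2)).hasFiniteIntegral
    rw [hasFiniteIntegral_iff_ofReal] at this
    · exact this
    · exact .of_forall fun z => mul_nonneg (by positivity) (levy_nonneg α z)
  -- The difference vanishes unless one of the points is in the domain. Each of the two resulting
  -- integrals is the length of the domain, `1`, times the integral of the Lévy majorant.
  have hle : ∀ x y, ENNReal.ofReal ((φ x - φ y) ^ 2 / |x - y| ^ (1 + α))
      ≤ dom.indicator 1 x * q (x - y) + dom.indicator 1 y * q (x - y) := by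
    intro x y
    have h3 : ENNReal.ofReal ((φ x - φ y) ^ 2 / |x - y| ^ (1 + α)) ≤ q (x - y) := by
      refine ENNReal.ofReal_le_ofReal ?_
      rw [levy, ← mul_div_assoc]
      exact div_le_div_of_nonneg_right (sq_le_levy h1 h2 x y) (by positivity)
    by_cases hx : x ∈ dom
    · simp only [hx, indicator_of_mem, Pi.one_apply, one_mul]
      exact h3.trans le_self_add
    by_cases hy : y ∈ dom
    · simp only [hy, indicator_of_mem, Pi.one_apply, one_mul]
      exact h3.trans le_add_self
    · simp [hφ.eq_zero hx, hφ.eq_zero hy]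
  have hind : Measurable (dom.indicator (1 : ℝ → ℝ≥0∞)) :=
    measurable_one.indicator measurableSet_dom
  have hdom : ∫⁻ x, dom.indicator (1 : ℝ → ℝ≥0∞) x = 1 := by
    rw [lintegral_indicator_one measurableSet_dom]
    simp [dom]
  calc _ ≤ ∫⁻ x, ∫⁻ y, (dom.indicator 1 x * q (x - y) + dom.indicator 1 y * q (x - y)) :=
        lintegral_mono fun x => lintegral_mono fun y => hle x y
    _ = (∫⁻ x, ∫⁻ y, dom.indicator 1 x * q (x - y))
        + ∫⁻ x, ∫⁻ y, dom.indicator 1 y * q (x - y) := by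
        rw [← lintegral_add_left]
        · refine lintegral_congr fun x => ?_
          rw [lintegral_add_left]
          exact (hqm.comp (measurable_const_sub x)).const_mul _
        · exact Measurable.lintegral_prod_right' (f := fun p : ℝ × ℝ =>
            dom.indicator 1 p.1 * q (p.1 - p.2))
            ((hind.comp measurable_fst).mul (hqm.comp (measurable_fst.sub measurable_snd)))
    _ = (∫⁻ z, q z) + ∫⁻ z, q z := by
        congr 1
        · have : ∀ x, ∫⁻ y, dom.indicator 1 x * q (x - y) = dom.indicator 1 x * ∫⁻ z, q z := by
            intro x
            rw [lintegral_const_mul (f := fun y => q (x - y)) _ (hqm.comp (measurable_const_sub x)),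
              lintegral_sub_left_eq_self]
          simp_rw [this]
          rw [lintegral_mul_const _ hind, hdom, one_mul]
        · rw [lintegral_lintegral_swap]
          · have : ∀ y, ∫⁻ x, dom.indicator 1 y * q (x - y) = dom.indicator 1 y * ∫⁻ z, q z := by
              intro y
              rw [lintegral_const_mul (f := fun x => q (x - y)) _ (hqm.comp (measurable_sub_const y)),
                lintegral_sub_right_eq_self]
            simp_rw [this]
            rw [lintegral_mul_const _ hind, hdom, one_mul]
          · exact ((hind.comp measurable_snd).mul
              (hqm.comp (measurable_fst.sub measurable_snd))).aemeasurable
    _ < ⊤ := ENNReal.add_lt_top.2 ⟨hqi, hqi⟩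

theorem memLp_two_of_lintegral {Ω : Type*} [MeasurableSpace Ω] {μ : Measure Ω} {f : Ω → ℝ}
    (hf : AEStronglyMeasurable f μ) (h : ∫⁻ x, ENNReal.ofReal (f x ^ 2) ∂μ < ⊤) :
    MemLp f 2 μ := by
  rw [memLp_two_iff_integrable_sq hf]
  refine ⟨hf.pow 2, ?_⟩
  rw [hasFiniteIntegral_iff_ofReal (.of_forall fun x => sq_nonneg _)]
  exact h

theorem memLp_diff {c α : ℝ} (hc : 0 < c) {f : ℝ → ℝ} (hf : AEStronglyMeasurable f)
    (h : ∫⁻ x, ∫⁻ y, ENNReal.ofReal ((f x - f y) ^ 2 / |x - y| ^ (1 + α)) < ⊤) :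
    MemLp (diff f) 2 (jumpMeasure c α) := by
  refine memLp_two_of_lintegral ((aestronglyMeasurable_diff hf).mono_ac (jumpMeasure_ac c α)) ?_
  rw [lintegral_diff_jumpMeasure hc α hf]
  exact ENNReal.mul_lt_top ENNReal.ofReal_lt_top h

end TestFunctions

/-! ### The form domain as a closed space of pairs, and its agreement with `MemH0`. -/

section FormSpaceOfJumps

instance : IsFiniteMeasure ((volume : Measure ℝ).restrict dom) := ⟨by simp [dom]⟩

/-- Pairs of a function on the domain and a function on the plane. -/
abbrev Pair (c α : ℝ) : Type := WithLp 2 (L2D × Lp ℝ 2 (jumpMeasure c α))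

theorem coeFn_zeroExt_ae (u : L2D) {f : ℝ → ℝ} (h : u =ᵐ[(volume : Measure ℝ).restrict dom] f)
    (h0 : ∀ x ∉ dom, f x = 0) : zeroExt u =ᵐ[volume] f := by
  have h1 := (ae_restrict_iff' measurableSet_dom).1 h
  filter_upwards [h1] with x hx
  by_cases hxd : x ∈ dom
  · rw [zeroExt, indicator_of_mem hxd, hx hxd]
  · rw [zeroExt, indicator_of_notMem hxd, h0 x hxd]

theorem zeroExt_ae_restrict (u : L2D) : zeroExt u =ᵐ[(volume : Measure ℝ).restrict dom] u := by
  filter_upwards [ae_restrict_mem measurableSet_dom] with x hx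
  rw [zeroExt, indicator_of_mem hx]

theorem zeroExt_of_notMem (u : L2D) {x : ℝ} (hx : x ∉ dom) : zeroExt u x = 0 :=
  indicator_of_notMem hx _

theorem aestronglyMeasurable_zeroExt (u : L2D) : AEStronglyMeasurable (zeroExt u) :=
  (aestronglyMeasurable_indicator_iff measurableSet_dom).2 (Lp.aestronglyMeasurable u)

theorem ae_eq_zeroExt {f : ℝ → ℝ} {u : L2D} (h : f =ᵐ[volume] zeroExt u) :
    u =ᵐ[(volume : Measure ℝ).restrict dom] f :=
  (EventuallyEq.trans (ae_restrict_of_ae h) (zeroExt_ae_restrict u)).symm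

theorem zeroExt_sub (u v : L2D) :
    zeroExt (u - v) =ᵐ[volume] fun x => zeroExt u x - zeroExt v x := by
  refine coeFn_zeroExt_ae _ ?_ fun x hx => by simp [zeroExt_of_notMem _ hx]
  filter_upwards [Lp.coeFn_sub u v, zeroExt_ae_restrict u, zeroExt_ae_restrict v] with x h1 h2 h3
  rw [h1, h2, h3, Pi.sub_apply]

theorem zeroExt_add (u v : L2D) :
    zeroExt (u + v) =ᵐ[volume] fun x => zeroExt u x + zeroExt v x := by
  refine coeFn_zeroExt_ae _ ?_ fun x hx => by simp [zeroExt_of_notMem _ hx]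
  filter_upwards [Lp.coeFn_add u v, zeroExt_ae_restrict u, zeroExt_ae_restrict v] with x h1 h2 h3
  rw [h1, h2, h3, Pi.add_apply]

theorem zeroExt_smul (a : ℝ) (u : L2D) :
    zeroExt (a • u) =ᵐ[volume] fun x => a * zeroExt u x := by
  refine coeFn_zeroExt_ae _ ?_ fun x hx => by simp [zeroExt_of_notMem _ hx]
  filter_upwards [Lp.coeFn_smul a u, zeroExt_ae_restrict u] with x h1 h2
  rw [h1, h2, Pi.smul_apply, smul_eq_mul]

/-- `p` represents the function `f` on the line, which vanishes outside the domain. -/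
structure Represents {c α : ℝ} (p : Pair c α) (f : ℝ → ℝ) : Prop where
  fst : f =ᵐ[volume] zeroExt p.fst
  snd : p.snd =ᵐ[jumpMeasure c α] diff f

variable {c α : ℝ}

theorem Represents.self {p : Pair c α} {f : ℝ → ℝ} (h : Represents p f) :
    Represents p (zeroExt p.fst) :=
  ⟨.rfl, h.snd.trans (diff_congr_ae c α h.fst)⟩

theorem Represents.fst_ae {p : Pair c α} {f : ℝ → ℝ} (h : Represents p f) :
    p.fst =ᵐ[(volume : Measure ℝ).restrict dom] f := ae_eq_zeroExt h.fst

theorem Represents.add {p q : Pair c α} {f g : ℝ → ℝ} (hp : Represents p f) (hq : Represents q g) :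
    Represents (p + q) (f + g) where
  fst := (hp.fst.add hq.fst).trans (zeroExt_add p.fst q.fst).symm
  snd := by
    filter_upwards [Lp.coeFn_add p.snd q.snd, hp.snd, hq.snd] with x h1 h2 h3
    rw [WithLp.add_snd, h1, Pi.add_apply, h2, h3]
    simp only [diff, Pi.add_apply]
    ring

theorem Represents.smul {p : Pair c α} {f : ℝ → ℝ} (hp : Represents p f) (a : ℝ) :
    Represents (a • p) (a • f) where
  fst := (hp.fst.const_smul a).trans (zeroExt_smul a p.fst).symm
  snd := by
    filter_upwards [Lp.coeFn_smul a p.snd, hp.snd] with x h1 h2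
    rw [WithLp.smul_snd, h1, Pi.smul_apply, h2]
    simp only [diff, Pi.smul_apply, smul_eq_mul]
    ring

theorem Represents.sub {p q : Pair c α} {f g : ℝ → ℝ} (hp : Represents p f) (hq : Represents q g) :
    Represents (p - q) (f - g) := by
  have := hp.add (hq.smul (-1))
  simpa [sub_eq_add_neg] using this

theorem Represents.lintegral_sq {p : Pair c α} {f : ℝ → ℝ} (hp : Represents p f) :
    ∫⁻ x, ENNReal.ofReal (f x ^ 2) = ENNReal.ofReal (‖p.fst‖ ^ 2) := by
  rw [ofReal_norm_sq, ← lintegral_indicator measurableSet_dom]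
  refine lintegral_congr_ae ?_
  filter_upwards [hp.fst] with x hx
  rw [hx, zeroExt]
  by_cases hxd : x ∈ dom <;> simp [hxd]

theorem Represents.lintegral_jump {p : Pair c α} {f : ℝ → ℝ} (hp : Represents p f) (hc : 0 < c) :
    ENNReal.ofReal (c / 2) * ∫⁻ x, ∫⁻ y, ENNReal.ofReal ((f x - f y) ^ 2 / |x - y| ^ (1 + α))
      = ENNReal.ofReal (‖p.snd‖ ^ 2) := by
  rw [ofReal_norm_sq, ← lintegral_diff_jumpMeasure hc α
    ((aestronglyMeasurable_zeroExt p.fst).congr hp.fst.symm)]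
  refine lintegral_congr_ae ?_
  filter_upwards [hp.snd] with x hx
  rw [hx]

theorem Represents.sobolevSq_le {p : Pair c α} {f : ℝ → ℝ} (hp : Represents p f) (hc : 0 < c) :
    sobolevSq α f ≤ ENNReal.ofReal ((1 + 2 / c) * ‖p‖ ^ 2) := by
  have h1 := hp.lintegral_jump hc
  have h2 : ∫⁻ x, ∫⁻ y, ENNReal.ofReal ((f x - f y) ^ 2 / |x - y| ^ (1 + α))
      = ENNReal.ofReal (2 / c * ‖p.snd‖ ^ 2) := by
    rw [ENNReal.ofReal_mul (by positivity), ← h1, ← mul_assoc, ← ENNReal.ofReal_mul (by positivity)]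
    have : 2 / c * (c / 2) = 1 := by field_simp
    simp [this]
  rw [sobolevSq, hp.lintegral_sq, h2, ← ENNReal.ofReal_add (by positivity) (by positivity),
    WithLp.prod_norm_sq_eq_of_L2]
  refine ENNReal.ofReal_le_ofReal ?_
  have h3 : 0 ≤ 2 / c * ‖p.fst‖ ^ 2 := by positivity
  nlinarith [sq_nonneg ‖p.snd‖]

theorem Represents.norm_sq_le {p : Pair c α} {f : ℝ → ℝ} (hp : Represents p f) (hc : 0 < c) :
    ENNReal.ofReal (‖p‖ ^ 2) ≤ ENNReal.ofReal (1 + c / 2) * sobolevSq α f := by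
  rw [WithLp.prod_norm_sq_eq_of_L2, ENNReal.ofReal_add (by positivity) (by positivity),
    ← hp.lintegral_sq, ← hp.lintegral_jump hc, sobolevSq, mul_add]
  refine add_le_add ?_ ?_
  · refine le_mul_of_one_le_left (by simp) ?_
    rw [ENNReal.one_le_ofReal]
    linarith
  · gcongr
    linarith

theorem exists_represents (hc : 0 < c) {f : ℝ → ℝ} {u : L2D} (hf : f =ᵐ[volume] zeroExt u)
    (h : ∫⁻ x, ∫⁻ y, ENNReal.ofReal ((f x - f y) ^ 2 / |x - y| ^ (1 + α)) < ⊤) :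
    ∃ p : Pair c α, p.fst = u ∧ Represents p f :=
  have hm := memLp_diff (α := α) hc ((aestronglyMeasurable_zeroExt u).congr hf.symm) h
  ⟨WithLp.toLp 2 (u, hm.toLp _), rfl, hf, hm.coeFn_toLp⟩

theorem IsTest.exists_represents (hc : 0 < c) (hα : α ∈ Ioo (0 : ℝ) 2) {φ : ℝ → ℝ}
    (hφ : IsTest φ) : ∃ p : Pair c α, Represents p φ := by
  obtain ⟨p, -, hp⟩ := NonlocalGL.exists_represents (α := α) hc (u := hφ.memLp.toLp φ)
    (coeFn_zeroExt_ae _ hφ.memLp.coeFn_toLp fun x hx => hφ.eq_zero hx).symm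
    (lintegral_diff_lt_top hα hφ)
  exact ⟨p, hp⟩

/-- Pass to a subsequence along which the first components converge a.e., then to one along which
the second do too; the limit of the differences is the difference of the limits, since the jump
measure is absolutely continuous. -/
theorem isClosed_represents : IsClosed {p : Pair c α | Represents p (zeroExt p.fst)} := by
  refine IsSeqClosed.isClosed fun p q hp hpq => ⟨.rfl, ?_⟩
  have h1 : Tendsto (fun n => (p n).fst) atTop (𝓝 q.fst) :=
    ((WithLp.fstL 2 ℝ L2D (Lp ℝ 2 (jumpMeasure c α))).continuous.tendsto q).comp hpq
  have h2 : Tendsto (fun n => (p n).snd) atTop (𝓝 q.snd) :=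
    ((WithLp.sndL 2 ℝ L2D (Lp ℝ 2 (jumpMeasure c α))).continuous.tendsto q).comp hpq
  obtain ⟨ns, hns, h3⟩ := (tendstoInMeasure_of_tendsto_Lp h1).exists_seq_tendsto_ae
  obtain ⟨ms, hms, h4⟩ := (tendstoInMeasure_of_tendsto_Lp
    (h2.comp hns.tendsto_atTop)).exists_seq_tendsto_ae
  have h5 : ∀ᵐ x, Tendsto (fun n => zeroExt (p (ns (ms n))).fst x) atTop
      (𝓝 (zeroExt q.fst x)) := by
    filter_upwards [(ae_restrict_iff' measurableSet_dom).1 h3] with x hx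
    by_cases hxd : x ∈ dom
    · simp only [zeroExt, indicator_of_mem hxd]
      exact (hx hxd).comp hms.tendsto_atTop
    · simp [zeroExt_of_notMem _ hxd]
  have h6 := (jumpMeasure_ac c α).ae_le ((Measure.quasiMeasurePreserving_fst
    (μ := (volume : Measure ℝ)) (ν := (volume : Measure ℝ))).ae h5)
  have h7 := (jumpMeasure_ac c α).ae_le ((Measure.quasiMeasurePreserving_snd
    (μ := (volume : Measure ℝ)) (ν := (volume : Measure ℝ))).ae h5)
  have h8 := ae_all_iff.2 fun n => (hp (ns (ms n))).snd
  filter_upwards [h4, h6, h7, h8] with x a1 a2 a3 a4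
  refine tendsto_nhds_unique a1 ?_
  simp only [Function.comp, a4]
  exact a2.sub a3

variable (c α) in
/-- The pairs `(φ, φ(x) - φ(y))` with a test function `φ`. -/
def testSpace : Submodule ℝ (Pair c α) where
  carrier := {p | ∃ φ, IsTest φ ∧ Represents p φ}
  add_mem' := by
    rintro p q ⟨φ, hφ, hp⟩ ⟨ψ, hψ, hq⟩
    exact ⟨φ + ψ, hφ.add hψ, hp.add hq⟩
  zero_mem' := by
    refine ⟨0, IsTest.zero, (coeFn_zeroExt_ae _ (Lp.coeFn_zero ..) fun _ _ => rfl).symm, ?_⟩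
    refine (Lp.coeFn_zero ..).trans (.of_forall fun p => ?_)
    simp [diff]
  smul_mem' := by
    rintro a p ⟨φ, hφ, hp⟩
    exact ⟨a • φ, hφ.smul a, hp.smul a⟩

variable (c α) in
/-- The form domain `H₀^{α/2}(D)`, as a space of pairs `(u, u(x) - u(y))`. -/
abbrev formSpace : Submodule ℝ (Pair c α) := (testSpace c α).topologicalClosure

instance : CompleteSpace (formSpace c α) := Submodule.topologicalClosure.completeSpace _

variable (c α) in
/-- The embedding of the form domain into `L²(D)`. -/
def emb : formSpace c α →L[ℝ] L2D :=
  (WithLp.fstL 2 ℝ L2D (Lp ℝ 2 (jumpMeasure c α))).comp (formSpace c α).subtypeL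

theorem emb_apply (v : formSpace c α) : emb c α v = (v : Pair c α).fst := rfl

/-- Without this, the second component of a limit of test pairs could be unrelated to the first, and
the embedding into `L²(D)` might fail to be injective. -/
theorem represents_formSpace (v : formSpace c α) :
    Represents (v : Pair c α) (zeroExt (emb c α v)) := by
  have h : (testSpace c α : Set (Pair c α)) ⊆ {p | Represents p (zeroExt p.fst)} := by
    rintro p ⟨φ, -, hp⟩
    exact hp.self
  have h2 : ((testSpace c α).topologicalClosure : Set (Pair c α))
      ⊆ {p | Represents p (zeroExt p.fst)} := by
    rw [Submodule.topologicalClosure_coe]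
    exact closure_minimal h isClosed_represents
  exact h2 v.2

theorem IsTest.exists_formSpace (hc : 0 < c) (hα : α ∈ Ioo (0 : ℝ) 2) {φ : ℝ → ℝ}
    (hφ : IsTest φ) : ∃ w : formSpace c α, Represents (w : Pair c α) φ := by
  obtain ⟨p, hp⟩ := hφ.exists_represents (c := c) hc hα
  exact ⟨⟨p, Submodule.le_topologicalClosure _ ⟨φ, hφ, hp⟩⟩, hp⟩

/-- Test functions are dense in the form domain. -/
theorem exists_test_near (v : formSpace c α) {ε : ℝ} (hε : 0 < ε) :
    ∃ (φ : ℝ → ℝ) (w : formSpace c α), IsTest φ ∧ Represents (w : Pair c α) φ ∧ ‖v - w‖ < ε := by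
  have h := v.2
  rw [← SetLike.mem_coe, Submodule.topologicalClosure_coe, Metric.mem_closure_iff] at h
  obtain ⟨p, ⟨φ, hφ, hp⟩, hd⟩ := h ε hε
  refine ⟨φ, ⟨p, Submodule.le_topologicalClosure _ ⟨φ, hφ, hp⟩⟩, hφ, hp, ?_⟩
  rw [dist_eq_norm] at hd
  exact hd

/-- The squared Sobolev norm and the squared norm of the pair bound each other up to constants
depending on `c`, so the two closures of the test functions coincide. -/
theorem memH0_iff (hc : 0 < c) (hα : α ∈ Ioo (0 : ℝ) 2) (u : L2D) :
    MemH0 α u ↔ ∃ v : formSpace c α, emb c α v = u := by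
  constructor
  · intro h
    -- A function at finite distance from a test function has finite energy itself; this is needed
    -- before a pair over `u` can be formed.
    have hfin : ∫⁻ x, ∫⁻ y, ENNReal.ofReal ((zeroExt u x - zeroExt u y) ^ 2
        / |x - y| ^ (1 + α)) < ⊤ := by
      obtain ⟨φ, hφ, hlt⟩ := h 1 one_pos
      obtain ⟨q, hq⟩ := hφ.exists_represents (c := c) hc hα
      have h1 : (fun x => zeroExt u x - φ x) =ᵐ[volume] zeroExt (u - q.fst) := by
        filter_upwards [zeroExt_sub u q.fst, hq.fst] with x h1 h2
        rw [h1, h2]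
      have h2 : ∫⁻ x, ∫⁻ y, ENNReal.ofReal (((fun x => zeroExt u x - φ x) x
          - (fun x => zeroExt u x - φ x) y) ^ 2 / |x - y| ^ (1 + α)) < ⊤ :=
        (le_add_self.trans_lt hlt).trans ENNReal.one_lt_top
      obtain ⟨p, hpu, hp⟩ := exists_represents hc h1 h2
      have h3 := (hp.add hq).lintegral_jump hc
      have h4 : (fun x => zeroExt u x - φ x) + φ = zeroExt u := by
        ext x; simp
      rw [h4] at h3
      by_contra hcon
      rw [not_lt, top_le_iff] at hcon
      rw [hcon, ENNReal.mul_top (by simp [hc])] at h3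
      exact ENNReal.ofReal_ne_top h3.symm
    obtain ⟨p, hpu, hp⟩ := exists_represents hc (Filter.EventuallyEq.refl _ (zeroExt u)) hfin
    refine ⟨⟨p, ?_⟩, hpu⟩
    rw [← SetLike.mem_coe, Submodule.topologicalClosure_coe, Metric.mem_closure_iff]
    intro ε hε
    obtain ⟨φ, hφ, hlt⟩ := h (ENNReal.ofReal (ε ^ 2) / ENNReal.ofReal (1 + c / 2))
      (ENNReal.div_pos (by simp [hε.ne']) ENNReal.ofReal_ne_top)
    obtain ⟨q, hq⟩ := hφ.exists_represents (c := c) hc hα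
    refine ⟨q, ⟨φ, hφ, hq⟩, ?_⟩
    have h1 := (hp.sub hq).norm_sq_le hc
    have h2 : ENNReal.ofReal (‖p - q‖ ^ 2) < ENNReal.ofReal (ε ^ 2) := by
      refine h1.trans_lt ?_
      rw [mul_comm]
      exact (ENNReal.lt_div_iff_mul_lt (by left; simp; positivity)
        (Or.inl ENNReal.ofReal_ne_top)).1 hlt
    rw [ENNReal.ofReal_lt_ofReal_iff (by positivity)] at h2
    rw [dist_eq_norm]
    exact lt_of_pow_lt_pow_left₀ 2 hε.le h2
  · rintro ⟨v, rfl⟩ ε hε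
    obtain ⟨δ, hδ, hδε⟩ : ∃ δ : ℝ, 0 < δ ∧ ENNReal.ofReal ((1 + 2 / c) * δ ^ 2) < ε := by
      have : Tendsto (fun δ : ℝ => ENNReal.ofReal ((1 + 2 / c) * δ ^ 2)) (𝓝[>] 0) (𝓝 0) := by
        have h : Continuous (fun δ : ℝ => ENNReal.ofReal ((1 + 2 / c) * δ ^ 2)) :=
          ENNReal.continuous_ofReal.comp (by fun_prop)
        simpa using (h.tendsto 0).mono_left nhdsWithin_le_nhds
      obtain ⟨δ, h1, h2⟩ := ((this.eventually (gt_mem_nhds hε)).and self_mem_nhdsWithin).exists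
      exact ⟨δ, h2, h1⟩
    obtain ⟨φ, w, hφ, hw, hvw⟩ := exists_test_near v hδ
    refine ⟨φ, hφ, ?_⟩
    have h1 := ((represents_formSpace v).sub hw).sobolevSq_le hc
    refine (h1.trans (ENNReal.ofReal_le_ofReal ?_)).trans_lt hδε
    have h2 : ‖(v : Pair c α) - w‖ < δ := hvw
    gcongr

theorem isFormEmbedding_emb (hc : 0 < c) (hα : α ∈ Ioo (0 : ℝ) 2) :
    IsFormEmbedding (emb c α) where
  norm_le v := by
    rw [emb_apply]
    have h1 : ‖v‖ ^ 2 = ‖(v : Pair c α).fst‖ ^ 2 + ‖(v : Pair c α).snd‖ ^ 2 :=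
      WithLp.prod_norm_sq_eq_of_L2 (v : Pair c α)
    refine le_of_sq_le_sq ?_ (norm_nonneg v)
    nlinarith [sq_nonneg ‖(v : Pair c α).snd‖]
  inj := by
    rw [injective_iff_map_eq_zero]
    intro v hv
    have h := represents_formSpace v
    have h1 : zeroExt (emb c α v) =ᵐ[volume] 0 := by
      rw [hv]
      exact coeFn_zeroExt_ae _ (Lp.coeFn_zero ..) fun _ _ => rfl
    have h2 : (v : Pair c α).snd = 0 := by
      refine Lp.ext (h.snd.trans ((diff_congr_ae c α h1).trans ?_))
      refine EventuallyEq.trans (.of_forall fun p => ?_) (Lp.coeFn_zero ..).symm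
      simp [diff]
    have h3 : ‖v‖ ^ 2 = ‖(v : Pair c α).fst‖ ^ 2 + ‖(v : Pair c α).snd‖ ^ 2 :=
      WithLp.prod_norm_sq_eq_of_L2 (v : Pair c α)
    rw [← emb_apply, hv, h2] at h3
    simpa using h3
  dense := by
    have h : (LinearMap.range (emb c α).toLinearMap)ᗮ = ⊥ := by
      rw [Submodule.eq_bot_iff]
      intro u hu
      rw [Submodule.mem_orthogonal] at hu
      -- A function orthogonal to the range is orthogonal to all test functions, hence zero a.e. on
      -- the domain.
      have hz : ∀ φ : ℝ → ℝ, IsTest φ → ∫ x in dom, φ x • u x = 0 := by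
        intro φ hφ
        obtain ⟨w, hw⟩ := hφ.exists_formSpace hc hα
        have h1 := hu (emb c α w) ⟨w, rfl⟩
        rw [L2.inner_def] at h1
        rw [← h1]
        refine integral_congr_ae ?_
        filter_upwards [hw.fst_ae] with x hx
        rw [emb_apply, hx]
        simp [mul_comm]
      have h2 := isOpen_Ioo.ae_eq_zero_of_integral_contDiff_smul_eq_zero
        (μ := (volume : Measure ℝ).restrict dom) (f := u) (U := Ioo 0 1)
        (((Lp.memLp u).integrable one_le_two).locallyIntegrable.locallyIntegrableOn _)
        fun g hg1 hg2 hg3 => hz g ⟨hg1, hg2, hg3⟩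
      refine Lp.ext ?_
      filter_upwards [h2, ae_restrict_mem measurableSet_dom, Lp.coeFn_zero ℝ 2
        ((volume : Measure ℝ).restrict dom)] with x h3 h4 h5
      rw [h3 h4, h5, Pi.zero_apply]
    exact (Submodule.dense_iff_topologicalClosure_eq_top).2
      ((Submodule.topologicalClosure_eq_top_iff).2 h)

end FormSpaceOfJumps

/-! ### Smoothing a Lipschitz function without increasing its constant. -/

section Mollify

open scoped NNReal Convolution

/-- Averaging against a bump of total mass `1` keeps the Lipschitz constant. Subtracting the value
at `0` costs another `ε/2` and restores the normalization that makes compositions with test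
functions test functions. -/
theorem exists_smooth_lipschitz_near {h : ℝ → ℝ} {L : ℝ≥0} (hh : LipschitzWith L h) (h0 : h 0 = 0)
    {ε : ℝ} (hε : 0 < ε) : ∃ g : ℝ → ℝ, ContDiff ℝ ∞ g ∧ g 0 = 0 ∧ LipschitzWith L g ∧
      ∀ x, |g x - h x| ≤ ε := by
  obtain ⟨δ, hδ, hδε⟩ : ∃ δ : ℝ, 0 < δ ∧ L * δ ≤ ε / 2 :=
    ⟨ε / 2 / (L + 1), by positivity, by
      rw [mul_div_assoc', div_le_iff₀ (by positivity)]; nlinarith [L.2]⟩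
  let b : ContDiffBump (0 : ℝ) := ⟨δ / 2, δ, by positivity, by linarith⟩
  set g₁ : ℝ → ℝ := b.normed volume ⋆[ContinuousLinearMap.lsmul ℝ ℝ, volume] h with hg₁
  have hs : ContDiff ℝ ∞ g₁ := b.hasCompactSupport_normed.contDiff_convolution_left _
    b.contDiff_normed hh.continuous.locallyIntegrable
  have hn : ∀ x, |g₁ x - h x| ≤ ε / 2 := by
    intro x
    rw [← Real.dist_eq]
    refine b.dist_normed_convolution_le hh.continuous.aestronglyMeasurable fun y hy => ?_
    refine (hh.dist_le_mul y x).trans (le_trans ?_ hδε)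
    exact mul_le_mul_of_nonneg_left (Metric.mem_ball.1 hy).le L.2
  have hint : ∀ x, Integrable fun t => b.normed volume t • h (x - t) := fun x =>
    (b.continuous_normed.smul (hh.continuous.comp (by fun_prop))).integrable_of_hasCompactSupport
      (b.hasCompactSupport_normed.smul_right)
  have hl : LipschitzWith L g₁ := by
    refine LipschitzWith.of_dist_le_mul fun x y => ?_
    have e : g₁ x - g₁ y = ∫ t, b.normed volume t • (h (x - t) - h (y - t)) := by
      simp only [hg₁, convolution_def, ContinuousLinearMap.lsmul_apply]
      rw [← integral_sub (hint x) (hint y)]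
      simp only [smul_sub]
    rw [dist_eq_norm, e]
    have hb : Integrable (fun t => b.normed volume t * (L * dist x y)) :=
      (b.integrable_normed).mul_const _
    refine (norm_integral_le_of_norm_le hb (.of_forall fun t => ?_)).trans ?_
    · rw [norm_smul, Real.norm_of_nonneg (b.nonneg_normed t), ← dist_eq_norm]
      refine mul_le_mul_of_nonneg_left ?_ (b.nonneg_normed t)
      simpa using hh.dist_le_mul (x - t) (y - t)
    · rw [integral_mul_const, b.integral_normed, one_mul]
  refine ⟨fun x => g₁ x - g₁ 0, hs.sub contDiff_const, sub_self _, ?_, fun x => ?_⟩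
  · refine LipschitzWith.of_dist_le_mul fun x y => ?_
    rw [dist_sub_right]
    exact hl.dist_le_mul x y
  · have h1 := abs_le.1 (hn x)
    have h2 := abs_le.1 (hn 0)
    rw [h0, sub_zero] at h2
    rw [abs_le]
    constructor <;> linarith [h1.1, h1.2, h2.1, h2.2]

end Mollify

/-! ### Lipschitz functions on the form domain, and the sub-Markov property. -/

section Contractions

open scoped NNReal

variable {c α : ℝ}

theorem Represents.norm_comp_le {p q : Pair c α} {f h : ℝ → ℝ} {L : ℝ≥0} (hp : Represents p f)
    (hq : Represents q (h ∘ f)) (hh : LipschitzWith L h) (h0 : h 0 = 0) : ‖q‖ ≤ L * ‖p‖ := by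
  have h1 : ‖q.fst‖ ≤ L * ‖p.fst‖ := by
    refine Lp.norm_le_mul_norm_of_ae_le_mul ?_
    filter_upwards [hp.fst_ae, hq.fst_ae] with x hx hx'
    rw [hx, hx']
    simpa [h0] using hh.norm_sub_le (f x) 0
  have h2 : ‖q.snd‖ ≤ L * ‖p.snd‖ := by
    refine Lp.norm_le_mul_norm_of_ae_le_mul ?_
    filter_upwards [hp.snd, hq.snd] with x hx hx'
    rw [hx, hx']
    exact hh.norm_sub_le (f x.1) (f x.2)
  refine le_of_sq_le_sq ?_ (by positivity)
  rw [mul_pow, WithLp.prod_norm_sq_eq_of_L2, WithLp.prod_norm_sq_eq_of_L2]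
  have h3 := pow_le_pow_left₀ (norm_nonneg _) h1 2
  have h4 := pow_le_pow_left₀ (norm_nonneg _) h2 2
  rw [mul_pow] at h3 h4
  linarith

theorem norm_le_of_ae_bound_dom {u : L2D} {C : ℝ} (hC : 0 ≤ C)
    (h : ∀ᵐ x ∂((volume : Measure ℝ).restrict dom), |u x| ≤ C) : ‖u‖ ≤ C := by
  have := Lp.norm_le_of_ae_bound (f := u) hC h
  have e : measureUnivNNReal ((volume : Measure ℝ).restrict dom) = 1 := by
    simp [measureUnivNNReal, dom]
  simpa [e] using this

/-- Lipschitz functions vanishing at `0` operate on the form domain. -/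
theorem exists_formSpace_comp (hc : 0 < c) (hα : α ∈ Ioo (0 : ℝ) 2) {h : ℝ → ℝ} {L : ℝ≥0}
    (hh : LipschitzWith L h) (h0 : h 0 = 0) (v : formSpace c α) :
    ∃ w : formSpace c α, emb c α w = hh.compLp h0 (emb c α v) ∧ ‖w‖ ≤ L * ‖v‖ := by
  have hJ := isFormEmbedding_emb hc hα
  -- Approximate `v` by test functions and `h` by smooth functions with the same constant. The form
  -- norms are only eventually below `M > L‖v‖`; injectivity of the embedding makes the limit
  -- independent of `M`, so `M` can decrease to `L‖v‖`.
  have key : ∀ M : ℝ, L * ‖v‖ < M →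
      ∃ w : formSpace c α, emb c α w = hh.compLp h0 (emb c α v) ∧ ‖w‖ ≤ M := by
    intro M hM
    have hpos : ∀ n : ℕ, (0 : ℝ) < 1 / (n + 1) := fun n => Nat.one_div_pos_of_nat
    choose φ w hφ hw hvw using fun n : ℕ => exists_test_near v (hpos n)
    choose g hg g0 hgL hgh using fun n : ℕ => exists_smooth_lipschitz_near hh h0 (hpos n)
    choose z hz using fun n => ((hφ n).comp (hg n) (g0 n)).exists_formSpace hc hα
    have hlim : Tendsto (fun n : ℕ => (1 : ℝ) / (n + 1)) atTop (𝓝 0) :=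
      tendsto_one_div_add_atTop_nhds_zero_nat
    refine hJ.exists_of_tendsto (l := atTop) (v := z) ?_ ?_
    · have hw1 : Tendsto w atTop (𝓝 v) := by
        rw [tendsto_iff_norm_sub_tendsto_zero]
        refine squeeze_zero (fun _ => norm_nonneg _) (fun n => ?_) hlim
        rw [norm_sub_rev]
        exact (hvw n).le
      have hw2 : Tendsto (fun n => hh.compLp h0 (emb c α (w n))) atTop
          (𝓝 (hh.compLp h0 (emb c α v))) :=
        ((hh.continuous_compLp h0).tendsto _).comp (((emb c α).continuous.tendsto v).comp hw1)
      have hd : Tendsto (fun n => emb c α (z n) - hh.compLp h0 (emb c α (w n))) atTop (𝓝 0) := by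
        refine squeeze_zero_norm (fun n => norm_le_of_ae_bound_dom (hpos n).le ?_) hlim
        filter_upwards [Lp.coeFn_sub (emb c α (z n)) (hh.compLp h0 (emb c α (w n))),
          hh.coeFn_compLp h0 (emb c α (w n)), (hz n).fst_ae, (hw n).fst_ae] with x h1 h2 h3 h4
        rw [h1, Pi.sub_apply, h2, emb_apply, emb_apply, h3, Function.comp, Function.comp, h4]
        exact hgh n (φ n x)
      simpa using hd.add hw2
    · have h1 : Tendsto (fun n : ℕ => (L : ℝ) * (‖v‖ + 1 / (n + 1))) atTop (𝓝 (L * ‖v‖)) := by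
        simpa using (hlim.const_add ‖v‖).const_mul (L : ℝ)
      filter_upwards [h1.eventually_lt_const hM] with n hn
      have h2 : ‖z n‖ ≤ L * ‖w n‖ := (hw n).norm_comp_le (hz n) (hgL n) (g0 n)
      refine h2.trans (le_trans ?_ hn.le)
      have h3 : ‖w n‖ ≤ ‖v‖ + ‖v - w n‖ := by
        have := norm_sub_le v (v - w n)
        rwa [sub_sub_cancel] at this
      exact mul_le_mul_of_nonneg_left (h3.trans (by linarith [hvw n])) L.2
  obtain ⟨w, hw, -⟩ := key (L * ‖v‖ + 1) (by linarith)
  refine ⟨w, hw, le_of_forall_pos_le_add fun ε hε => ?_⟩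
  obtain ⟨w', hw', hle⟩ := key (L * ‖v‖ + ε) (by linarith)
  rwa [hJ.inj (hw.trans hw'.symm)]

/-- The unit ball of `L^∞(D)`, as a set in `L²(D)`. -/
def supBall : Set L2D := {u | ∀ᵐ x ∂((volume : Measure ℝ).restrict dom), |u x| ≤ 1}

theorem zero_mem_supBall : (0 : L2D) ∈ supBall := by
  change ∀ᵐ x ∂((volume : Measure ℝ).restrict dom), |(0 : L2D) x| ≤ 1
  filter_upwards [Lp.coeFn_zero ℝ 2 ((volume : Measure ℝ).restrict dom)] with x hx
  rw [hx]
  simp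

theorem convex_supBall : Convex ℝ supBall := by
  intro u hu v hv a b ha hb hab
  change ∀ᵐ x ∂((volume : Measure ℝ).restrict dom), |(a • u + b • v : L2D) x| ≤ 1
  filter_upwards [hu, hv, Lp.coeFn_add (a • u) (b • v), Lp.coeFn_smul a u, Lp.coeFn_smul b v]
    with x h1 h2 h3 h4 h5
  rw [h3, Pi.add_apply, h4, h5, Pi.smul_apply, Pi.smul_apply, smul_eq_mul, smul_eq_mul]
  rw [abs_le] at *
  constructor <;> nlinarith

theorem isClosed_supBall : IsClosed supBall := by
  refine IsSeqClosed.isClosed fun u v hu huv => ?_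
  obtain ⟨ns, -, h3⟩ := (tendstoInMeasure_of_tendsto_Lp huv).exists_seq_tendsto_ae
  have h4 : ∀ᵐ x ∂((volume : Measure ℝ).restrict dom), ∀ n, |u (ns n) x| ≤ 1 :=
    ae_all_iff.2 fun n => hu (ns n)
  change ∀ᵐ x ∂((volume : Measure ℝ).restrict dom), |v x| ≤ 1
  filter_upwards [h3, h4] with x hx hb
  exact le_of_tendsto hx.abs (.of_forall hb)

theorem ae_abs_le_of_polarLE {u : L2D} {r : ℝ} (hr : 0 < r) (h : PolarLE supBall r u) :
    ∀ᵐ x ∂((volume : Measure ℝ).restrict dom), |u x| ≤ r := by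
  have h1 := h.smul (inv_nonneg.2 hr.le)
  rw [inv_mul_cancel₀ hr.ne'] at h1
  have h2 : ∀ᵐ x ∂((volume : Measure ℝ).restrict dom), |(r⁻¹ • u : L2D) x| ≤ 1 :=
    h1.mem convex_supBall isClosed_supBall
  filter_upwards [h2, Lp.coeFn_smul r⁻¹ u] with x hx hs
  rw [hs, Pi.smul_apply, smul_eq_mul, abs_mul, abs_of_pos (inv_pos.2 hr), inv_mul_le_iff₀ hr,
    mul_one] at hx
  exact hx

theorem polarLE_of_ae_abs_le {u : L2D} {r : ℝ} (hr : 0 < r)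
    (h : ∀ᵐ x ∂((volume : Measure ℝ).restrict dom), |u x| ≤ r) : PolarLE supBall r u := by
  have h2 : r⁻¹ • u ∈ supBall := by
    change ∀ᵐ x ∂((volume : Measure ℝ).restrict dom), |(r⁻¹ • u : L2D) x| ≤ 1
    filter_upwards [h, Lp.coeFn_smul r⁻¹ u] with x hx hs
    rw [hs, Pi.smul_apply, smul_eq_mul, abs_mul, abs_of_pos (inv_pos.2 hr), inv_mul_le_iff₀ hr,
      mul_one]
    exact hx
  have h3 := (polarLE_one_of_mem h2).smul hr.le
  rwa [mul_one, smul_smul, mul_inv_cancel₀ hr.ne', one_smul] at h3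

/-- Truncation at height `r`. -/
def clamp (r s : ℝ) : ℝ := max (-r) (min s r)

theorem clamp_zero {r : ℝ} (hr : 0 ≤ r) : clamp r 0 = 0 := by
  simp [clamp, hr]

theorem abs_clamp_le {r : ℝ} (hr : 0 ≤ r) (s : ℝ) : |clamp r s| ≤ r := by
  rw [abs_le, clamp]
  exact ⟨le_max_left _ _, max_le (by linarith) (min_le_right _ _)⟩

theorem clamp_of_abs_le {r s : ℝ} (h : |s| ≤ r) : clamp r s = s := by
  rw [abs_le] at h
  rw [clamp, min_eq_left h.2, max_eq_right h.1]

theorem monotone_clamp (r : ℝ) : Monotone (clamp r) := fun _ _ h =>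
  max_le_max_left _ (min_le_min_right _ h)

theorem clamp_sub_le {r s t : ℝ} (h : s ≤ t) : clamp r t - clamp r s ≤ t - s := by
  unfold clamp
  rcases max_cases (-r) (min t r) with h1 | h1 <;> rcases max_cases (-r) (min s r) with h2 | h2 <;>
  rcases min_cases t r with h3 | h3 <;> rcases min_cases s r with h4 | h4 <;> linarith

theorem lipschitzWith_clamp (r : ℝ) : LipschitzWith 1 (clamp r) := by
  refine LipschitzWith.of_le_add_mul 1 fun x y => ?_
  rcases le_total x y with h | h
  · have := monotone_clamp r h
    have := dist_nonneg (x := x) (y := y)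
    simp only [NNReal.coe_one, one_mul]
    linarith
  · have := clamp_sub_le (r := r) h
    simp only [NNReal.coe_one, one_mul, Real.dist_eq]
    linarith [le_abs_self (x - y)]

theorem monotone_sub_clamp (r : ℝ) : Monotone fun s => s - clamp r s := fun s t h => by
  have := clamp_sub_le (r := r) h
  simp only
  linarith

theorem lipschitzWith_sub_clamp (r : ℝ) : LipschitzWith 1 fun s => s - clamp r s := by
  refine LipschitzWith.of_le_add_mul 1 fun x y => ?_
  rcases le_total x y with h | h
  · have : x - clamp r x ≤ y - clamp r y := monotone_sub_clamp r h
    have := dist_nonneg (x := x) (y := y)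
    simp only [NNReal.coe_one, one_mul]
    linarith
  · have := monotone_clamp r h
    simp only [NNReal.coe_one, one_mul, Real.dist_eq]
    linarith [le_abs_self (x - y)]

/-- The variational inequality of the projection onto `[-1,1]`: `(s - P s)(P s - t) ≥ 0` for `t` in
the interval. -/
theorem mul_self_sub_clamp_le {s t : ℝ} (ht : |t| ≤ 1) :
    (s - clamp 1 s) * (s - clamp 1 s) ≤ (s - clamp 1 s) * (s - t) := by
  rw [abs_le] at ht
  rcases le_total s (-1) with h | h
  · have : clamp 1 s = -1 := by rw [clamp, min_eq_left (by linarith), max_eq_left h]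
    rw [this]
    nlinarith
  rcases le_total s 1 with h' | h'
  · rw [clamp_of_abs_le (abs_le.2 ⟨h, h'⟩), sub_self, zero_mul, zero_mul]
  · have : clamp 1 s = 1 := by rw [clamp, min_eq_right h', max_eq_right (by norm_num)]
    rw [this]
    nlinarith

theorem inner_formSpace (v w : formSpace c α) : ⟪v, w⟫_ℝ
    = ⟪emb c α v, emb c α w⟫_ℝ + ⟪(v : Pair c α).snd, (w : Pair c α).snd⟫_ℝ :=
  WithLp.prod_inner_apply (v : Pair c α) (w : Pair c α)

/-- The resolvents are sub-Markovian. -/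
theorem resolv_mem_supBall (hc : 0 < c) (hα : α ∈ Ioo (0 : ℝ) 2) {κ : ℝ} (h0 : 0 < κ)
    (h1 : κ ≤ 1) {f : L2D} (hf : f ∈ supBall) :
    resolv (formResolvent (emb c α)) κ f ∈ supBall := by
  have hJ := isFormEmbedding_emb hc hα
  have hspec := hJ.isUnitResolvent.resInv_spec h0 h1 f
  set p := resInv (formResolvent (emb c α)) κ f
  set z := ContinuousLinearMap.adjoint (emb c α) p with hz
  have e1 : resolv (formResolvent (emb c α)) κ f = emb c α z := rfl
  have e2 : formResolvent (emb c α) p = emb c α z := rfl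
  rw [e1]
  set u := emb c α z with hu
  have hc0 : (0 : ℝ) - clamp 1 0 = 0 := by rw [clamp_zero zero_le_one, sub_zero]
  -- Test the resolvent equation with the overshoot `w = u - clamp 1 u`. The form term is
  -- nonnegative because `s - clamp 1 s` is increasing, so `⟪u - f, w⟫ ≤ 0`; pointwise, `|f| ≤ 1`
  -- gives `w² ≤ (u - f) w`. Hence `w = 0`.
  obtain ⟨w, hw, -⟩ := exists_formSpace_comp hc hα (lipschitzWith_sub_clamp 1) hc0 z
  have hwu : emb c α w =ᵐ[(volume : Measure ℝ).restrict dom] fun x => u x - clamp 1 (u x) := by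
    rw [hw]
    exact (lipschitzWith_sub_clamp 1).coeFn_compLp hc0 u
  have hwr := represents_formSpace w
  have hzr := represents_formSpace z
  have hpos : 0 ≤ ⟪(z : Pair c α).snd, (w : Pair c α).snd⟫_ℝ := by
    rw [L2.inner_def]
    refine integral_nonneg_of_ae ?_
    have hww : zeroExt (emb c α w) =ᵐ[volume] fun x => zeroExt u x - clamp 1 (zeroExt u x) := by
      refine coeFn_zeroExt_ae _ ?_ fun x hx => by rw [zeroExt_of_notMem _ hx, hc0]
      filter_upwards [hwu, zeroExt_ae_restrict u] with x a b
      rw [a, b]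
    filter_upwards [hwr.snd, hzr.snd, diff_congr_ae c α hww] with x a b d
    rw [a, b, d]
    simp only [diff, Pi.zero_apply, RCLike.inner_apply, conj_trivial]
    rcases le_total (zeroExt u x.1) (zeroExt u x.2) with hle | hle
    · have := monotone_sub_clamp 1 hle
      exact mul_nonneg_of_nonpos_of_nonpos (by simp only at this; linarith) (by rw [← hu]; linarith)
    · have := monotone_sub_clamp 1 hle
      exact mul_nonneg (by simp only at this; linarith) (by rw [← hu]; linarith)
  have heq : ⟪f, emb c α w⟫_ℝ
      = ⟪u, emb c α w⟫_ℝ + κ * ⟪(z : Pair c α).snd, (w : Pair c α).snd⟫_ℝ := by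
    have h2 : ⟪p, emb c α w⟫_ℝ = ⟪z, w⟫_ℝ := by
      rw [hz, ContinuousLinearMap.adjoint_inner_left]
    rw [hspec, e2, inner_add_left, inner_smul_left, inner_smul_left, h2, inner_formSpace]
    simp only [conj_trivial]
    ring
  have hle : ⟪u - f, emb c α w⟫_ℝ ≤ 0 := by
    rw [inner_sub_left, heq]
    nlinarith
  have hge : ‖emb c α w‖ ^ 2 ≤ ⟪u - f, emb c α w⟫_ℝ := by
    rw [← real_inner_self_eq_norm_sq, L2.inner_def, L2.inner_def]
    refine integral_mono_ae (L2.integrable_inner _ _) (L2.integrable_inner _ _) ?_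
    filter_upwards [hwu, hf, Lp.coeFn_sub u f] with x a b d
    simp only [a, d, Pi.sub_apply, RCLike.inner_apply, conj_trivial]
    exact mul_self_sub_clamp_le b
  have hw0 : emb c α w = 0 := by
    have : ‖emb c α w‖ ^ 2 ≤ 0 := hge.trans hle
    simpa using this
  change ∀ᵐ x ∂((volume : Measure ℝ).restrict dom), |u x| ≤ 1
  rw [hw0] at hwu
  filter_upwards [hwu, Lp.coeFn_zero ℝ 2 ((volume : Measure ℝ).restrict dom)] with x a b
  rw [b, Pi.zero_apply] at a
  rw [sub_eq_zero.1 a.symm]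
  exact abs_clamp_le zero_le_one _

theorem semigroup_mem_supBall (hc : 0 < c) (hα : α ∈ Ioo (0 : ℝ) 2) {S : ℝ → L2D →L[ℝ] L2D}
    (hS : IsYosidaLimit (formResolvent (emb c α)) S) (t : ℝ) {f : L2D} (hf : f ∈ supBall) :
    S t f ∈ supBall :=
  hS.mem_of_resolv_mem (isFormEmbedding_emb hc hα).isUnitResolvent convex_supBall isClosed_supBall
    (fun _ h0 h1 _ hb => resolv_mem_supBall hc hα h0 h1 hb) t hf

end Contractions

/-! ### A Sobolev-type bound by a level set argument. -/

section Sobolev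

variable {c α : ℝ}

/-- Let `a = |f x|`. By Chebyshev `|f| ≥ a/2` on a set of measure at most `m = 4N/a²`, so at least
measure `m` of `(x, x+2m)` carries `|f| < a/2`. There the integrand is at least `(a/2)²/(2m)^{1+α}`;
times `m`, this is a constant times `a^{2+2α}`. -/
theorem rpow_le_lintegral {N : ℝ} (hN : 0 < N) (hα : 0 < α) {f : ℝ → ℝ} (hf : AEStronglyMeasurable f)
    (hfN : ∫⁻ y, ENNReal.ofReal (f y ^ 2) ≤ ENNReal.ofReal N) (x : ℝ) :
    ENNReal.ofReal (|f x| ^ (2 + 2 * α)) ≤ ENNReal.ofReal (8 * (8 * N) ^ α) *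
      ∫⁻ y, ENNReal.ofReal ((f x - f y) ^ 2 / |x - y| ^ (1 + α)) := by
  rcases eq_or_ne (f x) 0 with hx | hx
  · rw [hx, abs_zero, Real.zero_rpow (by linarith)]
    simp
  set a := |f x| with ha
  have ha0 : 0 < a := abs_pos.2 hx
  set m := 4 * N / a ^ 2 with hm
  have hm0 : 0 < m := by positivity
  set A := {y | ENNReal.ofReal ((a / 2) ^ 2) ≤ ENNReal.ofReal (f y ^ 2)}
  have hA : volume A ≤ ENNReal.ofReal m := by
    have h1 := mul_meas_ge_le_lintegral₀ (hf.aemeasurable.pow_const 2).ennreal_ofReal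
      (ENNReal.ofReal ((a / 2) ^ 2))
    have h2 : ENNReal.ofReal N = ENNReal.ofReal ((a / 2) ^ 2) * ENNReal.ofReal m := by
      rw [← ENNReal.ofReal_mul (by positivity)]
      congr 1
      rw [hm]
      field_simp
      norm_num
    have h3 := h1.trans hfN
    rw [h2] at h3
    exact (ENNReal.mul_le_mul_iff_right (by simp; positivity) ENNReal.ofReal_ne_top).1 h3
  have hI : ENNReal.ofReal m ≤ volume (Ioo x (x + 2 * m) \ A) := by
    refine le_trans ?_ le_measure_sdiff
    rw [Real.volume_Ioo, add_sub_cancel_left]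
    have h2 : ENNReal.ofReal (2 * m) = ENNReal.ofReal m + ENNReal.ofReal m := by
      rw [← ENNReal.ofReal_add hm0.le hm0.le, two_mul]
    rw [h2]
    exact (ENNReal.add_sub_cancel_right ENNReal.ofReal_ne_top).symm.le.trans
      (tsub_le_tsub_left hA _)
  set K := (a / 2) ^ 2 / (2 * m) ^ (1 + α) with hK
  have hsub : Ioo x (x + 2 * m) \ A ⊆
      {y | ENNReal.ofReal K ≤ ENNReal.ofReal ((f x - f y) ^ 2 / |x - y| ^ (1 + α))} := by
    rintro y ⟨⟨hy1, hy2⟩, hyA⟩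
    refine ENNReal.ofReal_le_ofReal ?_
    have hy : f y ^ 2 < (a / 2) ^ 2 := by
      by_contra! hcon
      exact hyA (ENNReal.ofReal_le_ofReal hcon)
    have hy' : |f y| < a / 2 := by
      rw [← sq_abs (f y)] at hy
      exact lt_of_pow_lt_pow_left₀ 2 (by positivity) hy
    have h1 : a / 2 ≤ |f x - f y| := by
      have := abs_sub_abs_le_abs_sub (f x) (f y)
      linarith
    have h2 : 0 < |x - y| := abs_pos.2 (by linarith)
    have h3 : |x - y| ≤ 2 * m := by
      rw [abs_le]
      constructor <;> linarith
    rw [hK, ← sq_abs (f x - f y)]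
    refine div_le_div₀ (by positivity) (pow_le_pow_left₀ (by positivity) h1 2)
      (Real.rpow_pos_of_pos h2 _) (Real.rpow_le_rpow h2.le h3 (by linarith))
  have hmeas : AEMeasurable fun y => ENNReal.ofReal ((f x - f y) ^ 2 / |x - y| ^ (1 + α)) :=
    (((aemeasurable_const.sub hf.aemeasurable).pow_const 2).div (by fun_prop)).ennreal_ofReal
  have h4 := mul_meas_ge_le_lintegral₀ hmeas (ENNReal.ofReal K)
  have h5 : ENNReal.ofReal K * ENNReal.ofReal m
      ≤ ∫⁻ y, ENNReal.ofReal ((f x - f y) ^ 2 / |x - y| ^ (1 + α)) :=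
    (mul_le_mul_right (hI.trans (measure_mono hsub)) _).trans h4
  refine le_trans (le_of_eq ?_) (mul_le_mul_right h5 _)
  rw [← ENNReal.ofReal_mul (by positivity), ← ENNReal.ofReal_mul (by positivity)]
  congr 1
  have e1 : (2 * m) ^ (1 + α) = 2 * m * (2 * m) ^ α := by
    rw [Real.rpow_add (by positivity), Real.rpow_one]
  have e2 : 2 * m = 8 * N / a ^ 2 := by rw [hm]; ring
  have e3 : (2 * m) ^ α = (8 * N) ^ α / a ^ (2 * α) := by
    rw [e2, Real.div_rpow (by positivity) (by positivity), ← Real.rpow_natCast a 2,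
      ← Real.rpow_mul ha0.le]
    norm_num
  have e4 : a ^ (2 + 2 * α) = a ^ 2 * a ^ (2 * α) := by
    rw [Real.rpow_add ha0, Real.rpow_two]
  have e5 : 0 < (8 * N) ^ α := by positivity
  have e6 : 0 < a ^ (2 * α) := by positivity
  rw [hK, e1, e3, e4]
  field_simp
  norm_num

/-- A bounded set of the form domain is bounded in `L^{2+2α}`. -/
theorem exists_lintegral_rpow_le (hc : 0 < c) (hα : 0 < α) (M : ℝ) : ∃ C : ℝ, 0 ≤ C ∧
    ∀ v : formSpace c α, ‖v‖ ≤ M →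
      ∫⁻ x in dom, ENNReal.ofReal (|emb c α v x| ^ (2 + 2 * α)) ≤ ENNReal.ofReal C := by
  set N := M ^ 2 + 1
  refine ⟨8 * (8 * N) ^ α * (2 / c * N), by positivity, fun v hv => ?_⟩
  have hr := represents_formSpace v
  have hvN : ‖(v : Pair c α)‖ ^ 2 ≤ N := by
    have : ‖(v : Pair c α)‖ ^ 2 ≤ M ^ 2 := pow_le_pow_left₀ (norm_nonneg _) hv 2
    exact this.trans (by simp [N])
  rw [WithLp.prod_norm_sq_eq_of_L2] at hvN
  have h1 : ∫⁻ y, ENNReal.ofReal (zeroExt (emb c α v) y ^ 2) ≤ ENNReal.ofReal N := by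
    rw [hr.lintegral_sq]
    exact ENNReal.ofReal_le_ofReal (by nlinarith [sq_nonneg ‖(v : Pair c α).snd‖])
  have h2 : ∫⁻ x, ∫⁻ y, ENNReal.ofReal ((zeroExt (emb c α v) x - zeroExt (emb c α v) y) ^ 2
      / |x - y| ^ (1 + α)) ≤ ENNReal.ofReal (2 / c * N) := by
    have h3 := hr.lintegral_jump hc
    have h4 : ENNReal.ofReal (‖(v : Pair c α).snd‖ ^ 2)
        ≤ ENNReal.ofReal (c / 2) * ENNReal.ofReal (2 / c * N) := by
      rw [← ENNReal.ofReal_mul (by positivity)]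
      refine ENNReal.ofReal_le_ofReal ?_
      have : c / 2 * (2 / c * N) = N := by field_simp
      rw [this]
      nlinarith [sq_nonneg ‖(v : Pair c α).fst‖]
    rw [← h3] at h4
    exact (ENNReal.mul_le_mul_iff_right (by simp [hc]) ENNReal.ofReal_ne_top).1 h4
  calc ∫⁻ x in dom, ENNReal.ofReal (|emb c α v x| ^ (2 + 2 * α))
      = ∫⁻ x in dom, ENNReal.ofReal (|zeroExt (emb c α v) x| ^ (2 + 2 * α)) := by
        refine lintegral_congr_ae ?_
        filter_upwards [zeroExt_ae_restrict (emb c α v)] with x hx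
        rw [hx]
    _ ≤ ∫⁻ x, ENNReal.ofReal (|zeroExt (emb c α v) x| ^ (2 + 2 * α)) :=
        setLIntegral_le_lintegral _ _
    _ ≤ ∫⁻ x, ENNReal.ofReal (8 * (8 * N) ^ α) * ∫⁻ y, ENNReal.ofReal
        ((zeroExt (emb c α v) x - zeroExt (emb c α v) y) ^ 2 / |x - y| ^ (1 + α)) :=
        lintegral_mono fun x => rpow_le_lintegral (by positivity) hα
          (aestronglyMeasurable_zeroExt _) h1 x
    _ ≤ ENNReal.ofReal (8 * (8 * N) ^ α) * ENNReal.ofReal (2 / c * N) := by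
        rw [lintegral_const_mul' _ _ ENNReal.ofReal_ne_top]
        gcongr
    _ = _ := by rw [← ENNReal.ofReal_mul (by positivity)]

end Sobolev

/-! ### The singular integral on test functions, and the identification of the generator. -/

section SingularIntegral

variable {c α : ℝ} {φ : ℝ → ℝ}

/-- As a function of `y`, the second difference vanishes at `0` and has derivative `φ'(x+y) -
φ'(x-y)`, which is `O(|y|)`; for large `y` boundedness of `φ` suffices. -/
theorem IsTest.exists_second_difference_bound (hφ : IsTest φ) : ∃ C : ℝ, 0 ≤ C ∧
    ∀ x y, |φ (x + y) + φ (x - y) - 2 * φ x| ≤ C * min (y ^ 2) 1 := by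
  obtain ⟨C₁, h0, h1, -⟩ := hφ.exists_bound
  have hd : ContDiff ℝ 1 (deriv φ) := by
    have h : ContDiff ℝ (1 + 1) φ := by
      rw [one_add_one_eq_two]
      exact_mod_cast contDiff_infty.1 hφ.1 2
    exact (contDiff_succ_iff_deriv.1 h).2.2
  obtain ⟨C₂, h2⟩ := ContDiff.lipschitzWith_of_hasCompactSupport hφ.2.1.deriv hd (by simp)
  refine ⟨max (4 * C₁) (2 * C₂), by positivity, fun x y => ?_⟩
  have ha : |φ (x + y) + φ (x - y) - 2 * φ x| ≤ 2 * C₂ * y ^ 2 := by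
    have hdiff : Differentiable ℝ φ := hφ.1.differentiable (by simp)
    have hF : ∀ t ∈ Icc (-|y|) |y|, HasDerivWithinAt (fun t => φ (x + t) + φ (x - t) - 2 * φ x)
        (deriv φ (x + t) - deriv φ (x - t)) (Icc (-|y|) |y|) t := by
      intro t _
      have a : HasDerivAt (fun t => φ (x + t)) (deriv φ (x + t)) t := by
        simpa using (hdiff (x + t)).hasDerivAt.comp_const_add x t
      have b : HasDerivAt (fun t => φ (x - t)) (-deriv φ (x - t)) t := by
        simpa using (hdiff (x - t)).hasDerivAt.comp_const_sub x t
      have := (a.add b).sub_const (2 * φ x)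
      rw [← sub_eq_add_neg] at this
      exact this.hasDerivWithinAt
    have hb : ∀ t ∈ Icc (-|y|) |y|, ‖deriv φ (x + t) - deriv φ (x - t)‖ ≤ 2 * C₂ * |y| := by
      intro t ht
      refine (h2.norm_sub_le _ _).trans ?_
      have : ‖x + t - (x - t)‖ ≤ 2 * |y| := by
        have e : x + t - (x - t) = 2 * t := by ring
        rw [e, norm_mul]
        simpa using abs_le.2 ht
      calc _ ≤ (C₂ : ℝ) * (2 * |y|) := mul_le_mul_of_nonneg_left this C₂.2
        _ = _ := by ring
    have := (convex_Icc (-|y|) |y|).norm_image_sub_le_of_norm_hasDerivWithin_le hF hb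
      (x := 0) (y := y) ⟨by simp, by simp⟩ (abs_le.1 le_rfl)
    have e : φ x + φ x - 2 * φ x = 0 := by ring
    simp only [add_zero, sub_zero, e, Real.norm_eq_abs] at this
    rw [← sq_abs y]
    calc _ ≤ _ := this
      _ = _ := by ring
  have hb : |φ (x + y) + φ (x - y) - 2 * φ x| ≤ 4 * C₁ := by
    have a := abs_le.1 (h1 (x + y))
    have b := abs_le.1 (h1 (x - y))
    have d := abs_le.1 (h1 x)
    rw [abs_le]
    constructor <;> linarith [a.1, a.2, b.1, b.2, d.1, d.2]
  rcases min_cases (y ^ 2) 1 with ⟨h, _⟩ | ⟨h, _⟩ <;> rw [h]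
  · exact ha.trans (mul_le_mul_of_nonneg_right (le_max_right _ _) (sq_nonneg y))
  · rw [mul_one]
    exact hb.trans (le_max_left _ _)

/-- The truncated singular integral. -/
def truncIntegral (c α : ℝ) (φ : ℝ → ℝ) (ε x : ℝ) : ℝ :=
  c * ∫ y in {y : ℝ | ε < |y|}, (φ (x + y) - φ x) / |y| ^ (1 + α)

theorem measurableSet_lt_abs (ε : ℝ) : MeasurableSet {y : ℝ | ε < |y|} :=
  measurableSet_lt measurable_const (by fun_prop)

theorem abs_div_le_levy {ε : ℝ} (hε : 0 < ε) (α : ℝ) {s C : ℝ} (hs : |s| ≤ C) {y : ℝ}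
    (hy : ε < |y|) : |s / |y| ^ (1 + α)| ≤ C / min (ε ^ 2) 1 * levy α y := by
  have hy0 : 0 < |y| := hε.trans hy
  have hp : 0 < |y| ^ (1 + α) := Real.rpow_pos_of_pos hy0 _
  have hm : 0 < min (ε ^ 2) 1 := by positivity
  have hC : 0 ≤ C := (abs_nonneg _).trans hs
  rw [abs_div, abs_of_pos hp, levy, ← mul_div_assoc]
  refine div_le_div_of_nonneg_right ?_ hp.le
  rw [div_mul_eq_mul_div, le_div_iff₀ hm]
  have : min (ε ^ 2) 1 ≤ min (y ^ 2) 1 := by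
    refine min_le_min_right 1 ?_
    rw [← sq_abs y]
    exact pow_le_pow_left₀ hε.le hy.le 2
  exact mul_le_mul hs this hm.le hC

theorem IsTest.integrableOn_difference (hα : α ∈ Ioo (0 : ℝ) 2) (hφ : IsTest φ) {ε : ℝ}
    (hε : 0 < ε) (x : ℝ) :
    IntegrableOn (fun y => (φ (x + y) - φ x) / |y| ^ (1 + α)) {y : ℝ | ε < |y|} := by
  obtain ⟨C, h0, h1, -⟩ := hφ.exists_bound
  have hm := hφ.1.continuous.measurable
  refine (((integrable_levy hα).const_mul (2 * C / min (ε ^ 2) 1)).integrableOn).mono'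
    (Measurable.aestronglyMeasurable (by fun_prop)) ?_
  filter_upwards [ae_restrict_mem (measurableSet_lt_abs ε)] with y hy
  refine abs_div_le_levy hε α ?_ hy
  have := abs_sub (φ (x + y)) (φ x)
  linarith [h1 (x + y), h1 x]

/-- Averaging over `y` and `-y` replaces the first difference, whose quotient need not be integrable
at `0`, by the second difference, whose quotient is. -/
theorem IsTest.truncIntegral_eq (hα : α ∈ Ioo (0 : ℝ) 2) (hφ : IsTest φ) {ε : ℝ}
    (hε : 0 < ε) (x : ℝ) : truncIntegral c α φ ε x = c / 2 * ∫ y, {y : ℝ | ε < |y|}.indicator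
      (fun y => (φ (x + y) + φ (x - y) - 2 * φ x) / |y| ^ (1 + α)) y := by
  have h1 := hφ.integrableOn_difference hα hε x
  set f := {y : ℝ | ε < |y|}.indicator (fun y => (φ (x + y) - φ x) / |y| ^ (1 + α)) with hf
  have h2 : Integrable f := (integrable_indicator_iff (measurableSet_lt_abs ε)).2 h1
  have h3 : ∫ y, f (-y) = ∫ y, f y := integral_neg_eq_self f volume
  have h4 : ∫ y, {y : ℝ | ε < |y|}.indicator
      (fun y => (φ (x + y) + φ (x - y) - 2 * φ x) / |y| ^ (1 + α)) y = ∫ y, (f y + f (-y)) := by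
    refine integral_congr_ae (.of_forall fun y => ?_)
    by_cases hy : ε < |y|
    · simp only [hf, indicator, mem_ofPred_eq, hy, abs_neg, if_true, ← sub_eq_add_neg]
      ring
    · simp only [hf, indicator, mem_ofPred_eq, hy, abs_neg, if_false, add_zero]
  rw [truncIntegral, ← integral_indicator (measurableSet_lt_abs ε), h4,
    integral_add h2 h2.comp_neg, h3]
  ring

/-- The symmetrized integrands are dominated by a multiple of the Lévy density, uniformly in `ε` and
`x`. Hence the principal value exists, so `limUnder` takes its intended value, and the truncations
may be integrated against `L¹` functions. -/
theorem IsTest.exists_truncIntegral_bound (hc : 0 < c) (hα : α ∈ Ioo (0 : ℝ) 2) (hφ : IsTest φ) :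
    ∃ B : ℝ, (∀ ε x, 0 < ε → |truncIntegral c α φ ε x| ≤ B) ∧
      ∀ x, Tendsto (fun ε => truncIntegral c α φ ε x) (𝓝[>] 0)
        (𝓝 (singularIntegral c α φ x)) := by
  obtain ⟨C, hC, h1⟩ := hφ.exists_second_difference_bound
  have hm := hφ.1.continuous.measurable
  have hb : ∀ ε x y, ‖{y : ℝ | ε < |y|}.indicator
      (fun y => (φ (x + y) + φ (x - y) - 2 * φ x) / |y| ^ (1 + α)) y‖ ≤ C * levy α y := by
    intro ε x y
    refine (norm_indicator_le_norm_self _ _).trans ?_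
    rw [norm_div, Real.norm_of_nonneg (Real.rpow_nonneg (abs_nonneg y) _), levy, ← mul_div_assoc]
    exact div_le_div_of_nonneg_right (h1 x y) (Real.rpow_nonneg (abs_nonneg y) _)
  have hi := (integrable_levy hα).const_mul C
  refine ⟨c / 2 * ∫ y, C * levy α y, fun ε x hε => ?_, fun x => ?_⟩
  · rw [hφ.truncIntegral_eq hα hε, abs_mul, abs_of_pos (by positivity)]
    exact mul_le_mul_of_nonneg_left (norm_integral_le_of_norm_le hi (.of_forall (hb ε x)))
      (by positivity)
  · have hlim : Tendsto (fun ε => truncIntegral c α φ ε x) (𝓝[>] 0) (𝓝 (c / 2 *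
        ∫ y, (φ (x + y) + φ (x - y) - 2 * φ x) / |y| ^ (1 + α))) := by
      have h2 : Tendsto (fun ε => ∫ y, {y : ℝ | ε < |y|}.indicator
          (fun y => (φ (x + y) + φ (x - y) - 2 * φ x) / |y| ^ (1 + α)) y) (𝓝[>] 0)
          (𝓝 (∫ y, (φ (x + y) + φ (x - y) - 2 * φ x) / |y| ^ (1 + α))) := by
        refine tendsto_integral_filter_of_dominated_convergence _
          (.of_forall fun ε => (Measurable.indicator (by fun_prop)
            (measurableSet_lt_abs ε)).aestronglyMeasurable)
          (.of_forall fun ε => .of_forall (hb ε x)) hi ?_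
        have hne : ∀ᵐ y : ℝ, y ≠ 0 := Measure.ae_ne volume 0
        filter_upwards [hne] with y hy
        refine tendsto_const_nhds.congr' ?_
        have : ∀ᶠ ε : ℝ in 𝓝[>] 0, ε < |y| :=
          mem_nhdsWithin_of_mem_nhds (Iio_mem_nhds (abs_pos.2 hy))
        filter_upwards [this] with ε hε
        rw [indicator_of_mem (show y ∈ {y : ℝ | ε < |y|} from hε)]
      refine (h2.const_mul (c / 2)).congr' ?_
      filter_upwards [self_mem_nhdsWithin] with ε hε
      rw [hφ.truncIntegral_eq hα hε]
    have : singularIntegral c α φ x = _ := hlim.limUnder_eq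
    rw [this]
    exact hlim

theorem measurable_truncIntegral (hφ : Measurable φ) (c α ε : ℝ) :
    Measurable (truncIntegral c α φ ε) := by
  have h : StronglyMeasurable fun p : ℝ × ℝ => (φ (p.1 + p.2) - φ p.1) / |p.2| ^ (1 + α) :=
    Measurable.stronglyMeasurable (by fun_prop)
  exact (h.integral_prod_right (ν := volume.restrict {y : ℝ | ε < |y|})).measurable.const_mul c

/-- Symmetrization of the truncated form. -/
theorem IsTest.integral_mul_truncIntegral (hα : α ∈ Ioo (0 : ℝ) 2) (hφ : IsTest φ)
    {U : ℝ → ℝ} (hU : Integrable U) {ε : ℝ} (hε : 0 < ε) :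
    ∫ x, U x * truncIntegral c α φ ε x = -∫ p, {p : ℝ × ℝ | ε < |p.1 - p.2|}.indicator
      (fun p => kernel c α p * (diff U p * diff φ p)) p ∂((volume : Measure ℝ).prod volume) := by
  obtain ⟨C, h0, h1, -⟩ := hφ.exists_bound
  have hm := hφ.1.continuous.measurable
  have hset : MeasurableSet {p : ℝ × ℝ | ε < |p.1 - p.2|} :=
    measurableSet_lt measurable_const (by fun_prop)
  -- Adding `G` and its reflection across the diagonal produces the product of differences with a
  -- minus sign. The full constant `c` against this sum of two equal integrals explains the factor
  -- `c/2` in `kernel`.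
  set G : ℝ × ℝ → ℝ := {p : ℝ × ℝ | ε < |p.1 - p.2|}.indicator
    (fun p => U p.1 * ((φ p.2 - φ p.1) / |p.1 - p.2| ^ (1 + α))) with hG
  have hGi : Integrable G ((volume : Measure ℝ).prod volume) := by
    have hI : Integrable (fun p : ℝ × ℝ => U p.1 * (2 * C / min (ε ^ 2) 1 * levy α (p.1 - p.2)))
        ((volume : Measure ℝ).prod volume) := by
      have a := (hU.convolution_integrand (ContinuousLinearMap.mul ℝ ℝ)
        ((integrable_levy hα).const_mul (2 * C / min (ε ^ 2) 1)) (μ := volume)).swap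
      refine a.congr (.of_forall fun p => ?_)
      simp only [Function.comp, Prod.fst_swap, Prod.snd_swap, ContinuousLinearMap.mul_apply']
      rw [← neg_sub p.1 p.2, levy_neg]
    refine hI.mono (AEStronglyMeasurable.indicator ?_ hset) (.of_forall fun p => ?_)
    · exact hU.1.comp_fst.mul (Measurable.aestronglyMeasurable (by fun_prop))
    · by_cases hp : ε < |p.1 - p.2|
      · rw [hG, indicator_of_mem (show p ∈ {p : ℝ × ℝ | ε < |p.1 - p.2|} from hp), norm_mul,
          norm_mul]
        refine mul_le_mul_of_nonneg_left ?_ (norm_nonneg _)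
        refine (abs_div_le_levy (C := 2 * C) hε α ?_ hp).trans (le_abs_self _)
        have := abs_sub (φ p.2) (φ p.1)
        linarith [h1 p.2, h1 p.1]
      · rw [hG, indicator_of_notMem (show p ∉ {p : ℝ × ℝ | ε < |p.1 - p.2|} from hp), norm_zero]
        exact norm_nonneg _
  have e1 : ∀ x, U x * truncIntegral c α φ ε x = c * ∫ y, G (x, y) := by
    intro x
    have a : ∫ y, G (x, y) = ∫ y, G (x, x + y) := (integral_add_left_eq_self _ x).symm
    have b : ∀ y, G (x, x + y) = U x * {y : ℝ | ε < |y|}.indicator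
        (fun y => (φ (x + y) - φ x) / |y| ^ (1 + α)) y := by
      intro y
      have e : x - (x + y) = -y := by ring
      by_cases hy : ε < |y| <;> simp [hG, indicator, hy, e]
    rw [a]
    simp_rw [b]
    rw [integral_const_mul, integral_indicator (measurableSet_lt_abs ε), truncIntegral]
    ring
  have e2 : ∫ p, G p.swap ∂((volume : Measure ℝ).prod volume)
      = ∫ p, G p ∂((volume : Measure ℝ).prod volume) := integral_prod_swap G
  have e3 : ∫ x, U x * truncIntegral c α φ ε x
      = c * ∫ p, G p ∂((volume : Measure ℝ).prod volume) := by
    simp_rw [e1]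
    rw [integral_const_mul, integral_prod _ hGi]
  have e4 : ∫ p, {p : ℝ × ℝ | ε < |p.1 - p.2|}.indicator
      (fun p => kernel c α p * (diff U p * diff φ p)) p ∂((volume : Measure ℝ).prod volume)
      = ∫ p, -(c / 2) * (G p + G p.swap) ∂((volume : Measure ℝ).prod volume) := by
    refine integral_congr_ae (.of_forall fun p => ?_)
    have e : |p.2 - p.1| = |p.1 - p.2| := abs_sub_comm _ _
    by_cases hp : ε < |p.1 - p.2|
    · simp only [hG, indicator, mem_ofPred_eq, hp, if_true, Prod.fst_swap, Prod.snd_swap, e, kernel,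
        diff]
      ring
    · simp [hG, indicator, hp, e]
  have e5 : ∫ p, (G p + G p.swap) ∂((volume : Measure ℝ).prod volume)
      = (∫ p, G p ∂((volume : Measure ℝ).prod volume))
        + ∫ p, G p.swap ∂((volume : Measure ℝ).prod volume) := integral_add hGi hGi.swap
  rw [e4, integral_const_mul, e5, e2, e3]
  ring

/-- `⟨u, A_α φ⟩ = -a(u, φ)` for `u` in the form domain and a test function `φ`. -/
theorem IsTest.integral_mul_singularIntegral (hc : 0 < c) (hα : α ∈ Ioo (0 : ℝ) 2)
    (hφ : IsTest φ) {v w : formSpace c α} (hw : Represents (w : Pair c α) φ) :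
    ∫ x in dom, emb c α v x * singularIntegral c α φ x
      = -⟪(v : Pair c α).snd, (w : Pair c α).snd⟫_ℝ := by
  set u := emb c α v
  have hv : Represents (v : Pair c α) (zeroExt u) := represents_formSpace v
  obtain ⟨B, hB, hlim⟩ := hφ.exists_truncIntegral_bound hc hα
  have hui : Integrable u ((volume : Measure ℝ).restrict dom) := (Lp.memLp u).integrable one_le_two
  have hUi : Integrable (zeroExt u) := (integrable_indicator_iff measurableSet_dom).2 hui
  have e0 : ∀ ε, ∫ x in dom, u x * truncIntegral c α φ ε x
      = ∫ x, zeroExt u x * truncIntegral c α φ ε x := by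
    intro ε
    rw [← integral_indicator measurableSet_dom]
    refine integral_congr_ae (.of_forall fun x => ?_)
    by_cases hx : x ∈ dom <;> simp [zeroExt, hx]
  have l1 : Tendsto (fun ε => ∫ x in dom, u x * truncIntegral c α φ ε x) (𝓝[>] 0)
      (𝓝 (∫ x in dom, u x * singularIntegral c α φ x)) := by
    refine tendsto_integral_filter_of_dominated_convergence (fun x => ‖u x‖ * B)
      (.of_forall fun ε => hui.1.mul
        (measurable_truncIntegral hφ.1.continuous.measurable c α ε).aestronglyMeasurable) ?_
      (hui.norm.mul_const B) (.of_forall fun x => (hlim x).const_mul (u x))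
    filter_upwards [self_mem_nhdsWithin] with ε hε
    refine .of_forall fun x => ?_
    rw [norm_mul]
    exact mul_le_mul_of_nonneg_left (hB ε x hε) (norm_nonneg _)
  have e1 : ⟪(v : Pair c α).snd, (w : Pair c α).snd⟫_ℝ
      = ∫ p, diff (zeroExt u) p * diff φ p ∂(jumpMeasure c α) := by
    rw [L2.inner_def]
    refine integral_congr_ae ?_
    filter_upwards [hv.snd, hw.snd] with p h1 h2
    rw [h1, h2, RCLike.inner_apply, conj_trivial, mul_comm]
  have hi : Integrable (fun p => kernel c α p * (diff (zeroExt u) p * diff φ p))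
      ((volume : Measure ℝ).prod volume) := by
    rw [← integrable_jumpMeasure_iff hc]
    refine (L2.integrable_inner (𝕜 := ℝ) (v : Pair c α).snd (w : Pair c α).snd).congr ?_
    filter_upwards [hv.snd, hw.snd] with p h1 h2
    rw [h1, h2, RCLike.inner_apply, conj_trivial, mul_comm]
  have l2 : Tendsto (fun ε => ∫ p, {p : ℝ × ℝ | ε < |p.1 - p.2|}.indicator
      (fun p => kernel c α p * (diff (zeroExt u) p * diff φ p)) p
        ∂((volume : Measure ℝ).prod volume)) (𝓝[>] 0)
      (𝓝 (∫ p, kernel c α p * (diff (zeroExt u) p * diff φ p)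
        ∂((volume : Measure ℝ).prod volume))) := by
    refine tendsto_integral_filter_of_dominated_convergence _
      (.of_forall fun ε => hi.1.indicator (measurableSet_lt measurable_const (by fun_prop)))
      (.of_forall fun ε => .of_forall fun p => norm_indicator_le_norm_self _ _) hi.norm
      (.of_forall fun p => ?_)
    refine tendsto_const_nhds.congr' ?_
    -- On the diagonal no truncation ever includes the point, but the differences vanish there.
    rcases eq_or_ne p.1 p.2 with hp | hp
    · refine .of_forall fun ε => ?_
      simp [indicator, diff, hp]
    · have : ∀ᶠ ε : ℝ in 𝓝[>] 0, ε < |p.1 - p.2| :=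
        mem_nhdsWithin_of_mem_nhds (Iio_mem_nhds (abs_pos.2 (sub_ne_zero.2 hp)))
      filter_upwards [this] with ε hε
      rw [indicator_of_mem (show p ∈ {p : ℝ × ℝ | ε < |p.1 - p.2|} from hε)]
  rw [e1, integral_jumpMeasure hc]
  refine tendsto_nhds_unique l1 (l2.neg.congr' ?_)
  filter_upwards [self_mem_nhdsWithin] with ε hε
  rw [e0, hφ.integral_mul_truncIntegral hα hUi hε]

/-- The nonlocal Laplacian is the operator associated with the form. -/
theorem isNonlocalLaplacian_iff (hc : 0 < c) (hα : α ∈ Ioo (0 : ℝ) 2) (u g : L2D) :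
    IsNonlocalLaplacian c α u g ↔ u = formResolvent (emb c α) (u - g) := by
  have hJ := isFormEmbedding_emb hc hα
  have hg : ∀ {φ : ℝ → ℝ} {w : formSpace c α}, Represents (w : Pair c α) φ →
      ∫ x in dom, g x * φ x = ⟪g, emb c α w⟫_ℝ := by
    intro φ w hw
    rw [L2.inner_def]
    refine integral_congr_ae ?_
    filter_upwards [hw.fst_ae] with x hx
    rw [emb_apply, hx, RCLike.inner_apply, conj_trivial, mul_comm]
  constructor
  · rintro ⟨hu, h⟩
    obtain ⟨v, rfl⟩ := (memH0_iff hc hα u).1 hu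
    -- The distributional identity is the weak equation `⟪v, w⟫ = ⟪J v - g, J w⟫` for test `w`; both
    -- sides are continuous in the form norm, so it holds for all `w` by density.
    have key : v = ContinuousLinearMap.adjoint (emb c α) (emb c α v - g) := by
      have hcl : ∀ w : formSpace c α, ⟪v, w⟫_ℝ = ⟪emb c α v - g, emb c α w⟫_ℝ := by
        intro w
        have hclosed : IsClosed {w : formSpace c α | ⟪v, w⟫_ℝ = ⟪emb c α v - g, emb c α w⟫_ℝ} :=
          isClosed_eq (by fun_prop) (by fun_prop)
        refine hclosed.closure_subset (Metric.mem_closure_iff.2 fun ε hε => ?_)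
        obtain ⟨φ, w', hφ, hw', hd⟩ := exists_test_near w hε
        refine ⟨w', ?_, by rwa [dist_eq_norm]⟩
        have h1 := h φ hφ
        rw [hφ.integral_mul_singularIntegral hc hα hw', hg hw'] at h1
        rw [mem_ofPred_eq, inner_formSpace, inner_sub_left, ← h1]
        ring
      refine ext_inner_right ℝ fun w => ?_
      rw [ContinuousLinearMap.adjoint_inner_left, hcl]
    exact congrArg (emb c α) key
  · intro h
    set v := ContinuousLinearMap.adjoint (emb c α) (u - g) with hv
    have hvu : emb c α v = u := h.symm
    refine ⟨(memH0_iff hc hα u).2 ⟨v, hvu⟩, fun φ hφ => ?_⟩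
    obtain ⟨w, hw⟩ := hφ.exists_formSpace (c := c) hc hα
    rw [hg hw, ← hvu, hφ.integral_mul_singularIntegral hc hα hw]
    have h1 : ⟪v, w⟫_ℝ = ⟪u - g, emb c α w⟫_ℝ := by
      rw [hv, ContinuousLinearMap.adjoint_inner_left]
    rw [inner_formSpace, hvu, inner_sub_left] at h1
    linarith

end SingularIntegral

/-! ### Comparison of two mild solutions. -/

section MildEstimates

variable {X : Type*} [NormedAddCommGroup X] [NormedSpace ℝ X] [CompleteSpace X]

/-- After a shift by `K` the difference is driven by `K(u-v) + (F-G)`. If this is bounded by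
`(K+1)‖u-v‖`, growth is only `e^t`, whatever `K` is; the positive part in the integral measures the
failure of that bound and serves as the source term in Gronwall's inequality. -/
theorem IsEvolution.norm_mild_sub_le {S : ℝ → X →L[ℝ] X} (hS : IsEvolution S)
    (hS1 : ∀ t x, ‖S t x‖ ≤ ‖x‖) {K T : ℝ} (hK : 0 ≤ K) {F G : ℝ → X}
    (hF : IntegrableOn F (Ioc 0 T)) (hG : IntegrableOn G (Ioc 0 T)) (x y : X) {t : ℝ}
    (ht : t ∈ Icc 0 T) :
    ‖mild S x F t - mild S y G t‖ ≤ Real.exp t * ‖x - y‖ + ∫ s in (0 : ℝ)..t, Real.exp (t - s) *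
      max 0 (‖K • (mild S x F s - mild S y G s) + (F s - G s)‖
        - (K + 1) * ‖mild S x F s - mild S y G s‖) := by
  have hu := hS.continuousOn_mild hF x
  have hv := hS.continuousOn_mild hG y
  have eu := fun t ht => hS.mild_expShift (t := t) hF x K ht
  have ev := fun t ht => hS.mild_expShift (t := t) hG y K ht
  set u := mild S x F
  set v := mild S y G
  have hsub : Ioc 0 T ⊆ Icc 0 T := Ioc_subset_Icc_self
  have hN : ContinuousOn (fun s => ‖u s - v s‖) (Icc 0 T) := (hu.sub hv).norm
  have hd : IntegrableOn (fun s => ‖K • (u s - v s) + (F s - G s)‖) (Ioc 0 T) :=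
    (((((hu.sub hv).const_smul K).integrableOn_Icc).mono_set hsub).add (hF.sub hG)).norm
  have he : IntegrableOn (fun s => max 0 (‖K • (u s - v s) + (F s - G s)‖
      - (K + 1) * ‖u s - v s‖)) (Ioc 0 T) := by
    have h1 : IntegrableOn (fun s => (K + 1) * ‖u s - v s‖) (Ioc 0 T) :=
      ((hN.const_smul (K + 1)).integrableOn_Icc).mono_set hsub
    exact (integrable_zero _ _ _).sup (hd.sub h1)
  refine gronwall_expShift (N := fun s => ‖u s - v s‖) hK hN he (fun t ht => ?_) ht
  have hFu : IntegrableOn (fun s => K • u s + F s) (Ioc 0 T) :=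
    (((hu.const_smul K).integrableOn_Icc).mono_set hsub).add hF
  have hGv : IntegrableOn (fun s => K • v s + G s) (Ioc 0 T) :=
    (((hv.const_smul K).integrableOn_Icc).mono_set hsub).add hG
  have hE := hS.expShift K
  have e1 : u t - v t = Real.exp (-(K * t)) • S t (x - y) + ∫ s in (0 : ℝ)..t,
      NonlocalGL.expShift K S (t - s) (K • (u s - v s) + (F s - G s)) := by
    rw [eu t ht, ev t ht]
    unfold mild
    rw [add_sub_add_comm, ← intervalIntegral.integral_sub (hE.intervalIntegrable_self hFu ht)
      (hE.intervalIntegrable_self hGv ht), ← map_sub]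
    congr 1
    refine intervalIntegral.integral_congr fun s _ => ?_
    rw [← map_sub]
    congr 1
    module
  have hsub' : uIcc 0 t ⊆ Icc 0 T := by
    rw [uIcc_of_le ht.1]; exact Icc_subset_Icc_right ht.2
  have hei : IntervalIntegrable (fun s => (K + 1) * ‖u s - v s‖ + max 0
      (‖K • (u s - v s) + (F s - G s)‖ - (K + 1) * ‖u s - v s‖)) volume 0 t := by
    refine (((hN.mono hsub').const_smul (K + 1)).intervalIntegrable).add ?_
    rw [intervalIntegrable_iff_integrableOn_Ioc_of_le ht.1]
    exact he.mono_set (Ioc_subset_Ioc_right ht.2)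
  have e2 : ‖∫ s in (0 : ℝ)..t, NonlocalGL.expShift K S (t - s) (K • (u s - v s) + (F s - G s))‖
      ≤ ∫ s in (0 : ℝ)..t, Real.exp (-(K * (t - s))) * ((K + 1) * ‖u s - v s‖ + max 0
      (‖K • (u s - v s) + (F s - G s)‖ - (K + 1) * ‖u s - v s‖)) := by
    refine intervalIntegral.norm_integral_le_of_norm_le ht.1 (.of_forall fun s _ => ?_)
      (hei.continuousOn_mul (by fun_prop))
    rw [NonlocalGL.expShift, smul_apply, norm_smul, Real.norm_of_nonneg (Real.exp_pos _).le]
    refine mul_le_mul_of_nonneg_left ((hS1 _ _).trans ?_) (Real.exp_pos _).le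
    linarith [le_max_right 0 (‖K • (u s - v s) + (F s - G s)‖ - (K + 1) * ‖u s - v s‖)]
  change ‖u t - v t‖ ≤ _
  rw [e1]
  refine (norm_add_le _ _).trans (add_le_add ?_ e2)
  rw [norm_smul, Real.norm_of_nonneg (Real.exp_pos _).le]
  exact mul_le_mul_of_nonneg_left (hS1 _ _) (Real.exp_pos _).le

end MildEstimates

/-! ### Mild solutions stay in moving multiples of an invariant convex set. -/

section MildPolar

variable {H : Type*} [NormedAddCommGroup H] [InnerProductSpace ℝ H] [CompleteSpace H]

/-- A comparison principle: `hR` says that `R` dominates the scalar mild solution with datum `r` and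
forcing `ρ`, and invariance of `B` transfers this to the vector equation. -/
theorem IsEvolution.polarLE_mild {S : ℝ → H →L[ℝ] H} (hS : IsEvolution S) {B : Set H} (hB0 : 0 ∈ B)
    (hSB : ∀ t, ∀ b ∈ B, S t b ∈ B) {K T r t R : ℝ} {x : H} {F : ℝ → H} {ρ : ℝ → ℝ}
    (hF : IntegrableOn F (Ioc 0 T)) (ht : t ∈ Icc 0 T) (hx : PolarLE B r x)
    (hρ : IntervalIntegrable ρ volume 0 t) (hFB : ∀ s ∈ Ioo 0 t, PolarLE B (ρ s) (F s))
    (hR : Real.exp (-(K * t)) * r + ∫ s in (0 : ℝ)..t, Real.exp (-(K * (t - s))) * ρ s ≤ R) :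
    PolarLE B R (mild (NonlocalGL.expShift K S) x F t) := by
  refine PolarLE.mono hB0 (PolarLE.add ?_ ?_) hR
  · exact (hx.map (S t) (hSB t)).smul (Real.exp_pos _).le
  · refine PolarLE.intervalIntegral ht.1 ((hS.expShift K).intervalIntegrable_self hF ht)
      (hρ.continuousOn_mul (by fun_prop)) fun s hs => ?_
    exact ((hFB s hs).map (S (t - s)) (hSB _)).smul (Real.exp_pos _).le

end MildPolar

/-! ### The truncated cubic and its monotone shift. -/

section Cubic

open scoped NNReal

/-- The nonlinearity `s - s³`, frozen outside `[-n, n]`. -/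
def truncCubic (n s : ℝ) : ℝ := clamp n s - clamp n s ^ 3

theorem truncCubic_zero {n : ℝ} (hn : 0 ≤ n) : truncCubic n 0 = 0 := by
  simp [truncCubic, clamp_zero hn]

theorem truncCubic_of_abs_le {n s : ℝ} (h : |s| ≤ n) : truncCubic n s = s - s ^ 3 := by
  rw [truncCubic, clamp_of_abs_le h]

/-- With `a`, `b` the clamped values, the difference factors as `(a-b)(1 - (a² + ab + b²))`, and the
quadratic form lies in `[0, 3n²]`. The upper slope `1` does not depend on the truncation. -/
theorem truncCubic_sub_bounds {n : ℝ} (hn : 0 ≤ n) {s t : ℝ} (h : s ≤ t) :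
    -(3 * n ^ 2 * (t - s)) ≤ truncCubic n t - truncCubic n s ∧
      truncCubic n t - truncCubic n s ≤ t - s := by
  have h1 := monotone_clamp n h
  have h2 := clamp_sub_le (r := n) h
  have h3 := abs_le.1 (abs_clamp_le hn s)
  have h4 := abs_le.1 (abs_clamp_le hn t)
  unfold truncCubic
  set a := clamp n t
  set b := clamp n s
  have e : a - a ^ 3 - (b - b ^ 3) = (a - b) * (1 - (a ^ 2 + a * b + b ^ 2)) := by ring
  have q0 : 0 ≤ a ^ 2 + a * b + b ^ 2 := by nlinarith [sq_nonneg (a + b)]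
  have a2 : a ^ 2 ≤ n ^ 2 := sq_le_sq' h4.1 h4.2
  have b2 : b ^ 2 ≤ n ^ 2 := sq_le_sq' h3.1 h3.2
  have q1 : a ^ 2 + a * b + b ^ 2 ≤ 3 * n ^ 2 := by nlinarith [sq_nonneg (a - b)]
  rw [e]
  have hab : 0 ≤ a - b := by linarith
  constructor
  · have := mul_le_mul h2 q1 q0 (by linarith)
    nlinarith
  · nlinarith [mul_nonneg hab q0]

/-- The Lipschitz constant of the truncated nonlinearity. -/
def cubicLip (n : ℝ) : ℝ≥0 := (3 * n ^ 2 + 1).toNNReal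

theorem coe_cubicLip (n : ℝ) : (cubicLip n : ℝ) = 3 * n ^ 2 + 1 :=
  Real.coe_toNNReal _ (by positivity)

theorem lipschitzWith_of_sub_bounds {h : ℝ → ℝ} {L : ℝ≥0}
    (hh : ∀ s t, s ≤ t → -(L * (t - s)) ≤ h t - h s ∧ h t - h s ≤ L * (t - s)) :
    LipschitzWith L h := by
  refine LipschitzWith.of_le_add_mul L fun x y => ?_
  rw [Real.dist_eq]
  rcases le_total x y with hxy | hxy
  · have := (hh x y hxy).1
    rw [abs_sub_comm, abs_of_nonneg (by linarith)]
    linarith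
  · have := (hh y x hxy).2
    rw [abs_of_nonneg (by linarith)]
    linarith

theorem lipschitzWith_truncCubic {n : ℝ} (hn : 0 ≤ n) :
    LipschitzWith (cubicLip n) (truncCubic n) := by
  refine lipschitzWith_of_sub_bounds fun s t h => ?_
  obtain ⟨h1, h2⟩ := truncCubic_sub_bounds hn h
  rw [coe_cubicLip]
  constructor <;> nlinarith [mul_nonneg (sq_nonneg n) (sub_nonneg.2 h)]

/-- The monotone nonlinearity `K s + s - s³`, with a truncation and `K = 3 n²`. -/
def shiftCubic (n s : ℝ) : ℝ := 3 * n ^ 2 * s + truncCubic n s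

theorem shiftCubic_zero {n : ℝ} (hn : 0 ≤ n) : shiftCubic n 0 = 0 := by
  simp [shiftCubic, truncCubic_zero hn]

theorem monotone_shiftCubic {n : ℝ} (hn : 0 ≤ n) : Monotone (shiftCubic n) := fun s t h => by
  have := (truncCubic_sub_bounds hn h).1
  unfold shiftCubic
  linarith

/-- Slopes lie between `0` and `K + 1` with `K = 3n²`, exactly the constant for which the shifted
equation grows like `e^t`. -/
theorem lipschitzWith_shiftCubic {n : ℝ} (hn : 0 ≤ n) :
    LipschitzWith (cubicLip n) (shiftCubic n) := by
  refine lipschitzWith_of_sub_bounds fun s t h => ?_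
  obtain ⟨h1, h2⟩ := truncCubic_sub_bounds hn h
  rw [coe_cubicLip]
  unfold shiftCubic
  constructor <;> nlinarith [mul_nonneg (sq_nonneg n) (sub_nonneg.2 h)]

/-- By monotonicity the extreme values on `[-r, r]` are at the endpoints, where the oddness of the
cubic gives opposite signs. -/
theorem abs_shiftCubic_le {n r s : ℝ} (hr : r ≤ n) (hs : |s| ≤ r) :
    |shiftCubic n s| ≤ 3 * n ^ 2 * r + (r - r ^ 3) := by
  have hr0 : 0 ≤ r := (abs_nonneg s).trans hs
  have hn : 0 ≤ n := hr0.trans hr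
  have h1 := monotone_shiftCubic hn (abs_le.1 hs).2
  have h2 := monotone_shiftCubic hn (abs_le.1 hs).1
  have e1 : shiftCubic n r = 3 * n ^ 2 * r + (r - r ^ 3) := by
    rw [shiftCubic, truncCubic_of_abs_le (by rwa [abs_of_nonneg hr0])]
  have e2 : shiftCubic n (-r) = -(3 * n ^ 2 * r + (r - r ^ 3)) := by
    rw [shiftCubic, truncCubic_of_abs_le (by rwa [abs_neg, abs_of_nonneg hr0])]
    ring
  rw [e1] at h1
  rw [e2] at h2
  exact abs_le.2 ⟨h2, h1⟩

/-- The substitution operator of the truncated nonlinearity on `L²(D)`. -/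
def cubicOp {n : ℝ} (hn : 0 ≤ n) (u : L2D) : L2D :=
  (lipschitzWith_truncCubic hn).compLp (truncCubic_zero hn) u

theorem coeFn_cubicOp {n : ℝ} (hn : 0 ≤ n) (u : L2D) :
    cubicOp hn u =ᵐ[(volume : Measure ℝ).restrict dom] fun x => truncCubic n (u x) :=
  (lipschitzWith_truncCubic hn).coeFn_compLp _ u

theorem coeFn_cubicOp_of_le {n : ℝ} (hn : 0 ≤ n) {u : L2D}
    (hu : ∀ᵐ x ∂((volume : Measure ℝ).restrict dom), |u x| ≤ n) :
    cubicOp hn u =ᵐ[(volume : Measure ℝ).restrict dom] fun x => u x - u x ^ 3 := by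
  filter_upwards [coeFn_cubicOp hn u, hu] with x h1 h2
  rw [h1, truncCubic_of_abs_le h2]

theorem cubicOp_congr {n m : ℝ} (hn : 0 ≤ n) (hm : 0 ≤ m) {u : L2D}
    (hun : ∀ᵐ x ∂((volume : Measure ℝ).restrict dom), |u x| ≤ n)
    (hum : ∀ᵐ x ∂((volume : Measure ℝ).restrict dom), |u x| ≤ m) : cubicOp hn u = cubicOp hm u :=
  Lp.ext ((coeFn_cubicOp_of_le hn hun).trans (coeFn_cubicOp_of_le hm hum).symm)

theorem continuous_cubicOp {n : ℝ} (hn : 0 ≤ n) : Continuous (cubicOp hn) :=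
  (lipschitzWith_truncCubic hn).continuous_compLp (truncCubic_zero hn)

/-- The substitution operator of the monotone nonlinearity. -/
def shiftOp {n : ℝ} (hn : 0 ≤ n) (u : L2D) : L2D :=
  (lipschitzWith_shiftCubic hn).compLp (shiftCubic_zero hn) u

theorem coeFn_shiftOp {n : ℝ} (hn : 0 ≤ n) (u : L2D) :
    shiftOp hn u =ᵐ[(volume : Measure ℝ).restrict dom] fun x => shiftCubic n (u x) :=
  (lipschitzWith_shiftCubic hn).coeFn_compLp _ u

theorem shiftOp_eq {n : ℝ} (hn : 0 ≤ n) (u : L2D) :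
    shiftOp hn u = (3 * n ^ 2) • u + cubicOp hn u := by
  refine Lp.ext ?_
  filter_upwards [coeFn_shiftOp hn u, coeFn_cubicOp hn u, Lp.coeFn_smul (3 * n ^ 2) u,
    Lp.coeFn_add ((3 * n ^ 2) • u) (cubicOp hn u)] with x h1 h2 h3 h4
  rw [h1, h4, Pi.add_apply, h3, h2, Pi.smul_apply, smul_eq_mul, shiftCubic]

theorem norm_shiftOp_sub_le {n : ℝ} (hn : 0 ≤ n) (u v : L2D) :
    ‖shiftOp hn u - shiftOp hn v‖ ≤ (3 * n ^ 2 + 1) * ‖u - v‖ := by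
  rw [← coe_cubicLip]
  exact (lipschitzWith_shiftCubic hn).norm_compLp_sub_le _ u v

theorem polarLE_shiftOp_sup {n r : ℝ} (hn : 0 ≤ n) (hr0 : 0 < r) (hr : r ≤ n)
    (hpos : 0 < 3 * n ^ 2 * r + (r - r ^ 3)) {u : L2D}
    (hu : PolarLE supBall r u) : PolarLE supBall (3 * n ^ 2 * r + (r - r ^ 3)) (shiftOp hn u) := by
  refine polarLE_of_ae_abs_le hpos ?_
  filter_upwards [ae_abs_le_of_polarLE hr0 hu, coeFn_shiftOp hn u] with x h1 h2
  rw [h2]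
  exact abs_shiftCubic_le hr h1

theorem polarLE_shiftOp_form {c α : ℝ} (hc : 0 < c) (hα : α ∈ Ioo (0 : ℝ) 2) {n r : ℝ} (hn : 0 ≤ n)
    (hr : 0 ≤ r) {u : L2D} (hu : PolarLE (emb c α '' Metric.closedBall 0 1) r u) :
    PolarLE (emb c α '' Metric.closedBall 0 1) ((3 * n ^ 2 + 1) * r) (shiftOp hn u) := by
  obtain ⟨v, rfl, hv⟩ := (isFormEmbedding_emb hc hα).exists_of_polarLE hr hu
  obtain ⟨w, hw, hwv⟩ := exists_formSpace_comp hc hα (lipschitzWith_shiftCubic hn)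
    (shiftCubic_zero hn) v
  rw [coe_cubicLip] at hwv
  have := polarLE_of_norm_le (J := emb c α) (hwv.trans
    (mul_le_mul_of_nonneg_left hv (by positivity)))
  rwa [hw] at this

end Cubic

/-! ### Scalar supersolutions. -/

section Barrier

/-- The decaying barrier `(n⁻² + t)^{-1/2}`. -/
def barrier (n t : ℝ) : ℝ := 1 / √((n ^ 2)⁻¹ + t)

theorem barrier_pos {n t : ℝ} (hn : 0 < n) (ht : 0 ≤ t) : 0 < barrier n t := by
  unfold barrier; positivity

theorem barrier_zero {n : ℝ} (hn : 0 < n) : barrier n 0 = n := by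
  rw [barrier, add_zero, Real.sqrt_inv, Real.sqrt_sq hn.le]
  simp

theorem barrier_le {n t : ℝ} (hn : 0 < n) (ht : 0 ≤ t) : barrier n t ≤ n := by
  conv_rhs => rw [← barrier_zero hn]
  unfold barrier
  refine one_div_le_one_div_of_le (Real.sqrt_pos.2 (by positivity)) (Real.sqrt_le_sqrt (by linarith))

theorem barrier_le_inv_sqrt {n t : ℝ} (ht : 0 < t) : barrier n t ≤ 1 / √t := by
  unfold barrier
  exact one_div_le_one_div_of_le (Real.sqrt_pos.2 ht)
    (Real.sqrt_le_sqrt (le_add_of_nonneg_left (by positivity)))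

theorem barrier_sq {n t : ℝ} (hn : 0 < n) (ht : 0 ≤ t) : barrier n t ^ 2 = ((n ^ 2)⁻¹ + t)⁻¹ := by
  rw [barrier, div_pow, one_pow, Real.sq_sqrt (by positivity), one_div]

theorem hasDerivAt_barrier {n t : ℝ} (hn : 0 < n) (ht : 0 ≤ t) :
    HasDerivAt (barrier n) (-(barrier n t ^ 3 / 2)) t := by
  have hp : 0 < (n ^ 2)⁻¹ + t := by positivity
  have h1 : HasDerivAt (fun t => (n ^ 2)⁻¹ + t) 1 t := (hasDerivAt_id t).const_add _
  have h2 := (h1.sqrt hp.ne').inv (Real.sqrt_pos.2 hp).ne'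
  have e : (fun t => (√((n ^ 2)⁻¹ + t))⁻¹) = barrier n := by
    ext s; simp [barrier]
  change HasDerivAt (fun t => (√((n ^ 2)⁻¹ + t))⁻¹) _ t at h2
  rw [e] at h2
  refine h2.congr_deriv ?_
  unfold barrier
  have := Real.sqrt_pos.2 hp
  field_simp

/-- This fixes the lifetime: `n⁻² + t ≤ 1/2` for `n ≥ 2` and `t ≤ 1/4`, so that `ψ² ≥ 2` and
therefore `ψ - ψ³ ≤ -ψ³/2 = ψ'`. -/
theorem two_le_barrier_sq {n t : ℝ} (hn : 2 ≤ n) (ht : t ∈ Icc (0 : ℝ) (1 / 4)) :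
    2 ≤ barrier n t ^ 2 := by
  rw [barrier_sq (by linarith) ht.1]
  have h1 : (n ^ 2)⁻¹ ≤ 1 / 4 := by
    rw [inv_le_comm₀ (by positivity) (by norm_num)]
    nlinarith
  rw [le_inv_comm₀ (by norm_num) (add_pos_of_pos_of_nonneg (by positivity) ht.1)]
  linarith [ht.2]

theorem continuousOn_barrier {n : ℝ} (hn : 0 < n) : ContinuousOn (barrier n) (Ici 0) := fun _ ht =>
  (hasDerivAt_barrier hn ht).continuousAt.continuousWithinAt

/-- The barrier is a supersolution of `ψ' = ψ - ψ³`. -/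
theorem barrier_supersolution {n t K : ℝ} (hn : 2 ≤ n) (ht : t ∈ Icc (0 : ℝ) (1 / 4)) :
    Real.exp (-(K * t)) * n + ∫ s in (0 : ℝ)..t, Real.exp (-(K * (t - s))) *
      (K * barrier n s + (barrier n s - barrier n s ^ 3)) ≤ barrier n t := by
  have hn0 : 0 < n := by linarith
  have hsub : uIcc 0 t ⊆ Ici 0 := by
    rw [uIcc_of_le ht.1]; exact Icc_subset_Ici_self
  have hcont : ContinuousOn (barrier n) (uIcc 0 t) := (continuousOn_barrier hn0).mono hsub
  have hd : ∀ s ∈ uIcc 0 t, HasDerivAt (fun s => Real.exp (-(K * (t - s))) * barrier n s)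
      (Real.exp (-(K * (t - s))) * (K * barrier n s - barrier n s ^ 3 / 2)) s := by
    intro s hs
    have h1 : HasDerivAt (fun s => Real.exp (-(K * (t - s)))) (Real.exp (-(K * (t - s))) * K) s := by
      refine ((((hasDerivAt_id s).const_sub t).const_mul K).neg.exp).congr_deriv ?_
      simp
    refine (h1.mul (hasDerivAt_barrier hn0 (hsub hs))).congr_deriv ?_
    ring
  have hi : IntervalIntegrable (fun s => Real.exp (-(K * (t - s))) *
      (K * barrier n s - barrier n s ^ 3 / 2)) volume 0 t :=
    ContinuousOn.intervalIntegrable (by fun_prop)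
  have h1 := intervalIntegral.integral_eq_sub_of_hasDerivAt hd hi
  have h2 : ∫ s in (0 : ℝ)..t, Real.exp (-(K * (t - s))) *
      (K * barrier n s + (barrier n s - barrier n s ^ 3))
      ≤ ∫ s in (0 : ℝ)..t, Real.exp (-(K * (t - s))) *
      (K * barrier n s - barrier n s ^ 3 / 2) := by
    refine intervalIntegral.integral_mono_on ht.1 (ContinuousOn.intervalIntegrable (by fun_prop)) hi
      fun s hs => ?_
    have h3 := two_le_barrier_sq hn ⟨hs.1, hs.2.trans ht.2⟩
    have h4 := barrier_pos hn0 hs.1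
    refine mul_le_mul_of_nonneg_left ?_ (Real.exp_pos _).le
    nlinarith [mul_le_mul_of_nonneg_left h3 h4.le]
  rw [h1, sub_self, mul_zero, neg_zero, Real.exp_zero, one_mul, sub_zero, barrier_zero hn0] at h2
  linarith

/-- The scalar solution `e^t r` of `r' = r` in shifted mild form; it bounds the form norm. -/
theorem exp_supersolution {K t r : ℝ} : Real.exp (-(K * t)) * r + ∫ s in (0 : ℝ)..t,
    Real.exp (-(K * (t - s))) * ((K + 1) * (Real.exp s * r)) = Real.exp t * r := by
  have hd : ∀ s ∈ uIcc 0 t, HasDerivAt (fun s => Real.exp (-(K * t) + (K + 1) * s) * r)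
      (Real.exp (-(K * (t - s))) * ((K + 1) * (Real.exp s * r))) s := by
    intro s _
    refine ((((hasDerivAt_id s).const_mul (K + 1)).const_add (-(K * t))).exp.mul_const
      r).congr_deriv ?_
    have e : Real.exp (-(K * t) + (K + 1) * s) = Real.exp (-(K * (t - s))) * Real.exp s := by
      rw [← Real.exp_add]; ring_nf
    simp only [id]
    rw [e]
    ring
  rw [intervalIntegral.integral_eq_sub_of_hasDerivAt hd
    (Continuous.intervalIntegrable (by fun_prop) _ _)]
  ring_nf

end Barrier

/-! ### Continuity of mild solutions in the form domain. -/

section Abstract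

variable {H : Type*} [NormedAddCommGroup H] [InnerProductSpace ℝ H] [CompleteSpace H]
variable {V : Type*} [NormedAddCommGroup V] [InnerProductSpace ℝ V] [CompleteSpace V]
variable {R : H →L[ℝ] H} {S : ℝ → H →L[ℝ] H} {J : V →L[ℝ] H}

omit [CompleteSpace H] in
theorem isClosed_polarLE (B : Set H) (r : ℝ) : IsClosed {u | PolarLE B r u} := by
  simp only [PolarLE, ofPred_forall]
  exact isClosed_iInter fun φ => isClosed_iInter fun c => isClosed_iInter fun _ =>
    isClosed_le (by fun_prop) (by fun_prop)

omit [CompleteSpace H] in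
theorem polarLE_zero {B : Set H} (h0 : 0 ∈ B) {r : ℝ} (hr : 0 ≤ r) : PolarLE B r 0 := by
  simpa using ((polarLE_one_of_mem h0).smul hr).mono h0 (by simp)

theorem IsYosidaLimit.isEvolution (hS : IsYosidaLimit R S) (hR : IsUnitResolvent R) :
    IsEvolution S where
  zero := hS.eq_one le_rfl
  add s t hs ht x := by rw [hS.add hR hs ht]; rfl
  cont := hS.continuous hR
  bdd T := ⟨1, fun t _ => ContinuousLinearMap.opNorm_le_bound _ zero_le_one
    (by simpa using hS.norm_apply_le hR t)⟩

/-- Convergence in `H` and convergence of upper bounds of the norms in `V` give convergence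
in `V`. -/
theorem IsFormEmbedding.tendsto_of_norm_le (hJ : IsFormEmbedding J) {ι : Type*} {l : Filter ι}
    {w : ι → V} {w₀ : V} {r : ι → ℝ} (hw : Tendsto (fun i => J (w i)) l (𝓝 (J w₀)))
    (hr : Tendsto r l (𝓝 ‖w₀‖)) (h : ∀ᶠ i in l, ‖w i‖ ≤ r i) : Tendsto w l (𝓝 w₀) := by
  -- If `‖w i + w₀‖` stayed below some `a < 2‖w₀‖` frequently, lower semicontinuity along that
  -- subfamily would give `2‖w₀‖ ≤ a`. Once these norms converge, the parallelogram law yields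
  -- strong convergence.
  have h1 : Tendsto (fun i => ‖w i + w₀‖) l (𝓝 (‖w₀‖ + ‖w₀‖)) := by
    rw [tendsto_order]
    constructor
    · intro a ha
      by_contra hcon
      rw [not_eventually] at hcon
      have hne : (l ⊓ 𝓟 {i | ¬ a < ‖w i + w₀‖}).NeBot := frequently_mem_iff_neBot.1 hcon
      have h2 : Tendsto (fun i => J (w i + w₀)) (l ⊓ 𝓟 {i | ¬ a < ‖w i + w₀‖}) (𝓝 (J (w₀ + w₀))) := by
        simp only [map_add]
        exact (hw.add_const _).mono_left inf_le_left
      obtain ⟨z, hz, hza⟩ := hJ.exists_of_tendsto h2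
        (eventually_inf_principal.2 (.of_forall fun i hi => not_lt.1 hi))
      rw [hJ.inj hz, ← two_smul ℝ w₀, norm_smul, Real.norm_ofNat] at hza
      linarith
    · intro a ha
      have h2 : ∀ᶠ i in l, r i + ‖w₀‖ < a := (hr.add_const ‖w₀‖).eventually (gt_mem_nhds ha)
      filter_upwards [h, h2] with i hi hi2
      linarith [norm_add_le (w i) w₀]
  have h3 : Tendsto (fun i => 2 * (r i * r i + ‖w₀‖ * ‖w₀‖) - ‖w i + w₀‖ * ‖w i + w₀‖) l (𝓝 0) := by
    have := (((hr.mul hr).add_const (‖w₀‖ * ‖w₀‖)).const_mul 2).sub (h1.mul h1)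
    convert this using 2
    ring
  have h4 : Tendsto (fun i => ‖w i - w₀‖ * ‖w i - w₀‖) l (𝓝 0) := by
    refine tendsto_of_tendsto_of_tendsto_of_le_of_le' tendsto_const_nhds h3
      (.of_forall fun i => by positivity) ?_
    filter_upwards [h] with i hi
    have := parallelogram_law_with_norm ℝ (w i) w₀
    nlinarith [mul_le_mul hi hi (norm_nonneg _) ((norm_nonneg _).trans hi)]
  rw [tendsto_iff_norm_sub_tendsto_zero]
  have h5 := h4.sqrt
  simpa [Real.sqrt_mul_self (norm_nonneg _)] using h5

theorem integral_sub_rpow_neg_half (a s : ℝ) :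
    IntervalIntegrable (fun τ => (s - τ) ^ (-(1 / 2) : ℝ)) volume a s ∧
      ∫ τ in a..s, (s - τ) ^ (-(1 / 2) : ℝ) = 2 * √(s - a) := by
  constructor
  · have := (intervalIntegral.intervalIntegrable_rpow' (a := s - a) (b := 0)
      (r := -(1 / 2)) (by norm_num)).comp_sub_left s
    simpa using this
  · rw [intervalIntegral.integral_comp_sub_left (fun x => x ^ (-(1 / 2) : ℝ)) s, sub_self,
      integral_rpow (.inl (by norm_num))]
    norm_num [Real.sqrt_eq_rpow]
    ring

theorem sqrt_one_add_le {r : ℝ} (h0 : 0 < r) (h1 : r ≤ 1 / 2) :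
    √(1 + 1 / (2 * r)) ≤ r ^ (-(1 / 2) : ℝ) := by
  rw [Real.rpow_neg h0.le, ← Real.sqrt_eq_rpow, ← Real.sqrt_inv]
  refine Real.sqrt_le_sqrt ?_
  rw [← sub_nonneg]
  have : r⁻¹ - (1 + 1 / (2 * r)) = (1 / 2 - r) / r := by field_simp; ring
  rw [this]
  exact div_nonneg (by linarith) h0.le

/-- The smoothing norm is at most `(s-τ)^{-1/2}` on intervals of length at most `1/2`, and this
singularity is integrable. The support function replaces a Bochner integral in `V`, for which
measurability would have to be proved. -/
theorem IsFormEmbedding.exists_integral (hJ : IsFormEmbedding J)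
    (hS : IsYosidaLimit (formResolvent J) S) {F : ℝ → H} {T B a s : ℝ}
    (hF : IntegrableOn F (Ioc 0 T)) (ha : 0 ≤ a) (has : a ≤ s) (hsT : s ≤ T)
    (hsa : s - a ≤ 1 / 2) (hB0 : 0 ≤ B) (hB : ∀ τ ∈ Ioo a s, ‖F τ‖ ≤ B) :
    ∃ z, J z = ∫ τ in a..s, S (s - τ) (F τ) ∧ ‖z‖ ≤ 2 * B * √(s - a) := by
  obtain ⟨i1, i2⟩ := integral_sub_rpow_neg_half a s
  refine hJ.exists_of_polarLE (by positivity) ?_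
  have e : 2 * B * √(s - a) = ∫ τ in a..s, B * (s - τ) ^ (-(1 / 2) : ℝ) := by
    rw [intervalIntegral.integral_const_mul, i2]
    ring
  rw [e]
  refine PolarLE.intervalIntegral has
    ((hS.isEvolution hJ.isUnitResolvent).intervalIntegrable hF ha has hsT) (i1.const_mul B)
    fun τ hτ => ?_
  have hpos : 0 < s - τ := sub_pos.2 hτ.2
  obtain ⟨z, hz, hzn⟩ := hJ.semigroup_smoothing hS hpos (F τ)
  rw [← hz]
  refine polarLE_of_norm_le (hzn.trans ?_)
  rw [mul_comm B]
  exact mul_le_mul (sqrt_one_add_le hpos (by linarith [hτ.1])) (hB τ hτ) (norm_nonneg _)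
    (by positivity)

/-- Mild solutions with a bounded forcing are continuous in the form domain at positive times. -/
theorem IsFormEmbedding.tendsto_mild (hJ : IsFormEmbedding J)
    (hS : IsYosidaLimit (formResolvent J) S) {F : ℝ → H} {x : H} {T B t : ℝ}
    (hF : IntegrableOn F (Ioc 0 T)) (ht : t ∈ Ioc 0 T)
    (hB : ∀ τ ∈ Ioo (t / 2) T, ‖F τ‖ ≤ B) {w : ℝ → V}
    (hw : ∀ s ∈ Icc 0 T, J (w s) = mild S x F s) : Tendsto w (𝓝[Icc 0 T] t) (𝓝 (w t)) := by
  have hE := hS.isEvolution hJ.isUnitResolvent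
  rw [Metric.tendsto_nhdsWithin_nhds]
  intro ε hε
  set b := max B 0
  have hb0 : 0 ≤ b := le_max_right _ _
  have hb : ∀ τ ∈ Ioo (t / 2) T, ‖F τ‖ ≤ b := fun τ hτ => (hB τ hτ).trans (le_max_left _ _)
  obtain ⟨η, hη0, hηt, hη4, hηε⟩ : ∃ η : ℝ, 0 < η ∧ η ≤ t / 2 ∧ η ≤ 1 / 4 ∧
      2 * b * √(2 * η) < ε / 3 := by
    have h1 : Tendsto (fun η : ℝ => 2 * b * √(2 * η)) (𝓝[>] 0) (𝓝 0) := by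
      have : Continuous fun η : ℝ => 2 * b * √(2 * η) := by fun_prop
      have h2 := this.tendsto 0
      simp only [mul_zero, Real.sqrt_zero] at h2
      exact h2.mono_left nhdsWithin_le_nhds
    have h2 : ∀ᶠ η : ℝ in 𝓝[>] 0, η ∈ Ioo 0 (min (t / 2) (1 / 4)) :=
      Ioo_mem_nhdsGT (lt_min (half_pos ht.1) (by norm_num))
    obtain ⟨η, h3, h4⟩ := ((h1.eventually (gt_mem_nhds (by positivity : 0 < ε / 3))).and h2).exists
    exact ⟨η, h4.1, (h4.2.le).trans (min_le_left _ _), (h4.2.le).trans (min_le_right _ _), h3⟩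
  -- Restart slightly before `t`. The Duhamel part accumulated since `a` is small in `V`; the
  -- remainder `S (s - a) y` passes through a fixed smoothing `S (η/2)`, so its continuity in `V`
  -- reduces to strong continuity in `H`.
  set a := t - η with ha
  have ha0 : 0 ≤ a := by linarith [ht.1]
  set y := mild S x F a
  have hlift : ∀ s ∈ Icc 0 T, a ≤ s → s ≤ t + η → ∃ z, J (w s - z) = S (s - a) y ∧
      ‖z‖ < ε / 3 := by
    intro s hs has hst
    obtain ⟨z, hz, hzn⟩ := hJ.exists_integral hS hF ha0 has hs.2 (by linarith) hb0
      fun τ hτ => hb τ ⟨by linarith [hτ.1], hτ.2.trans_le hs.2⟩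
    refine ⟨z, ?_, hzn.trans_lt (lt_of_le_of_lt ?_ hηε)⟩
    · rw [map_sub, hz, hw s hs, hE.mild_restart hF x ha0 has hs.2, add_sub_cancel_right]
    · exact mul_le_mul_of_nonneg_left (Real.sqrt_le_sqrt (by linarith)) (by positivity)
  have hcont : Tendsto (fun s => √(1 + 1 / (2 * (η / 2))) * ‖S (s - a - η / 2) y - S (η / 2) y‖)
      (𝓝 t) (𝓝 0) := by
    have hc : Continuous fun s => S (s - a - η / 2) y :=
      hE.cont.comp (by fun_prop : Continuous fun s : ℝ => (s - a - η / 2, y))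
    have h1 := (((hc.sub (continuous_const (y := S (η / 2) y))).norm).const_mul
      (√(1 + 1 / (2 * (η / 2))))).tendsto t
    have e : t - a - η / 2 = η / 2 := by rw [ha]; ring
    simpa [e] using h1
  obtain ⟨δ, hδ, hδε⟩ := Metric.eventually_nhds_iff.1
    (hcont.eventually (gt_mem_nhds (by positivity : 0 < ε / 3)))
  refine ⟨min δ (η / 2), by positivity, fun s hs hst => ?_⟩
  have h1 := hδε (hst.trans_le (min_le_left _ _))
  have h2 := hst.trans_le (min_le_right _ _)
  rw [Real.dist_eq, abs_lt] at h2
  obtain ⟨z₁, hz₁, hn₁⟩ := hlift s hs (by linarith) (by linarith)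
  obtain ⟨z₂, hz₂, hn₂⟩ := hlift t ⟨ht.1.le, ht.2⟩ (by linarith) (by linarith)
  obtain ⟨z, hz, hn⟩ := hJ.semigroup_smoothing hS (half_pos hη0)
    (S (s - a - η / 2) y - S (η / 2) y)
  have e1 : S (s - a) y = S (η / 2) (S (s - a - η / 2) y) := by
    rw [← hE.add _ _ (by linarith) (by linarith), add_sub_cancel]
  have e2 : S (t - a) y = S (η / 2) (S (η / 2) y) := by
    rw [← hE.add _ _ (by linarith) (by linarith)]
    congr 2
    rw [ha]
    ring
  have e3 : (w s - z₁) - (w t - z₂) = z := by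
    refine hJ.inj ?_
    rw [map_sub, hz₁, hz₂, hz, map_sub, e1, e2]
  have e4 : w s - w t = z + z₁ - z₂ := by
    rw [← e3]
    abel
  rw [dist_eq_norm, e4]
  have := norm_sub_le (z + z₁) z₂
  have := norm_add_le z z₁
  linarith

end Abstract

/-! ### The semigroup of the nonlocal Laplacian, and the two notions of continuity. -/

section Generation

variable {c α : ℝ} {S : ℝ → L2D →L[ℝ] L2D}

theorem isGeneratedSemigroup (hc : 0 < c) (hα : α ∈ Ioo (0 : ℝ) 2)
    (hS : IsYosidaLimit (formResolvent (emb c α)) S) : IsGeneratedSemigroup c α S := by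
  have hR := (isFormEmbedding_emb hc hα).isUnitResolvent
  refine ⟨⟨hS.eq_one le_rfl, fun s t hs ht => hS.add hR hs ht, fun f => ?_⟩, fun f g => ?_⟩
  · have := (hS.continuous_apply hR f).tendsto 0
    rw [hS.eq_one le_rfl] at this
    exact this.mono_left nhdsWithin_le_nhds
  · rw [isNonlocalLaplacian_iff hc hα, hS.generator_iff hR]

theorem continuousH0_of_continuousOn (hc : 0 < c) (hα : α ∈ Ioo (0 : ℝ) 2) {T : ℝ}
    {w : ℝ → formSpace c α} {u : ℝ → L2D} (hu : ∀ t ∈ Icc 0 T, emb c α (w t) = u t)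
    (hw : ContinuousOn w (Icc 0 T)) : ContinuousH0 α T u := by
  refine ⟨fun t ht => (memH0_iff hc hα _).2 ⟨w t, hu t ht⟩, fun t ht => ?_⟩
  have h1 : Tendsto (fun s => ENNReal.ofReal ((1 + 2 / c) * ‖w s - w t‖ ^ 2)) (𝓝[Icc 0 T] t)
      (𝓝 0) := by
    have h2 : Tendsto (fun s => (1 + 2 / c) * ‖w s - w t‖ ^ 2) (𝓝[Icc 0 T] t) (𝓝 0) := by
      have := ((((hw t ht).tendsto.sub_const (w t)).norm).pow 2).const_mul (1 + 2 / c)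
      simpa using this
    simpa using ENNReal.tendsto_ofReal h2
  refine tendsto_of_tendsto_of_tendsto_of_le_of_le' tendsto_const_nhds h1
    (.of_forall fun _ => zero_le) ?_
  filter_upwards [self_mem_nhdsWithin] with s hs
  have h3 := (represents_formSpace (w s - w t)).sobolevSq_le hc
  rwa [map_sub, hu s hs, hu t ht] at h3

theorem ContinuousH0.continuousOn {T : ℝ} {u : ℝ → L2D} (hu : ContinuousH0 α T u) :
    ContinuousOn u (Icc 0 T) := by
  intro t ht
  have h1 := hu.2 t ht
  have h2 : ∀ s, ENNReal.ofReal (‖u s - u t‖ ^ 2) ≤ sobolevSq α (zeroExt (u s - u t)) := by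
    intro s
    rw [ofReal_norm_sq, sobolevSq]
    refine le_trans (le_of_eq ?_) le_self_add
    rw [← lintegral_indicator measurableSet_dom]
    refine lintegral_congr fun x => ?_
    by_cases hx : x ∈ dom <;> simp [zeroExt, hx]
  have h3 : Tendsto (fun s => ENNReal.ofReal (‖u s - u t‖ ^ 2)) (𝓝[Icc 0 T] t) (𝓝 0) :=
    tendsto_of_tendsto_of_tendsto_of_le_of_le tendsto_const_nhds h1 (fun _ => zero_le) h2
  have h4 := ((ENNReal.tendsto_toReal ENNReal.zero_ne_top).comp h3).sqrt
  rw [ContinuousWithinAt, tendsto_iff_norm_sub_tendsto_zero]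
  refine (h4.congr fun s => ?_).trans (by simp)
  simp only [Function.comp]
  rw [ENNReal.toReal_ofReal (by positivity), Real.sqrt_sq (norm_nonneg _)]

end Generation

/-! ### Truncated solutions and the bounds independent of the truncation. -/

section Existence

variable {c α : ℝ} {S : ℝ → L2D →L[ℝ] L2D}

/-- Picard iteration for the monotone shifted equation with `K = 3n²`, within the sets given by the
barrier in `L^∞(D)` and by `e^t ρ` in the form norm. Both are invariant because their scalar
counterparts are supersolutions. -/
theorem exists_truncated_solution (hc : 0 < c) (hα : α ∈ Ioo (0 : ℝ) 2)
    (hS : IsYosidaLimit (formResolvent (emb c α)) S) {n ρ : ℝ} (hn : 2 ≤ n) (hn0 : 0 ≤ n)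
    (hρ : 0 ≤ ρ) {x : L2D} (hx : PolarLE supBall n x)
    (hxρ : PolarLE (emb c α '' Metric.closedBall 0 1) ρ x) :
    ∃ u : ℝ → L2D, Continuous u ∧ (∀ t ∈ Icc (0 : ℝ) (1 / 4),
      PolarLE supBall (barrier n t) (u t) ∧
      PolarLE (emb c α '' Metric.closedBall 0 1) (Real.exp t * ρ) (u t)) ∧
      ∀ t ∈ Icc (0 : ℝ) (1 / 4), u t = mild S x (fun s => cubicOp hn0 (u s)) t := by
  have hJ := isFormEmbedding_emb hc hα
  have hR := hJ.isUnitResolvent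
  have hE := hS.isEvolution hR
  have hnpos : 0 < n := by linarith
  have h0B : (0 : L2D) ∈ emb c α '' Metric.closedBall 0 1 := ⟨0, by simp, by simp⟩
  set K := 3 * n ^ 2 with hK
  have key := hE.exists_fixedPoint (hS.norm_apply_le hR) (K := K) (T := 1 / 4)
    (by positivity) (by norm_num) (norm_shiftOp_sub_le hn0) x
    (C := fun t => {u | PolarLE supBall (barrier n t) u ∧
      PolarLE (emb c α '' Metric.closedBall 0 1) (Real.exp t * ρ) u})
    (fun t _ => (isClosed_polarLE _ _).inter (isClosed_polarLE _ _))
    (fun t ht => ⟨polarLE_zero zero_mem_supBall (barrier_pos hnpos ht.1).le,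
      polarLE_zero h0B (by positivity)⟩) fun u hu huC t ht => ?_
  · obtain ⟨u, hu, huC, hum⟩ := key
    refine ⟨u, hu, huC, fun t ht => ?_⟩
    refine hE.eq_mild_of_expShift (K := K) (T := 1 / 4) ?_ hu.continuousOn x (fun t ht => ?_) ht
    · exact (((continuous_cubicOp hn0).comp hu).integrableOn_Icc).mono_set Ioc_subset_Icc_self
    · rw [hum t ht]
      simp only [shiftOp_eq, ← hK]
  · have hint : IntegrableOn (fun s => shiftOp hn0 (u s)) (Ioc 0 (1 / 4)) := by
      have : Continuous fun s => shiftOp hn0 (u s) := by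
        simp only [shiftOp_eq]
        exact (hu.const_smul (3 * n ^ 2)).add ((continuous_cubicOp hn0).comp hu)
      exact this.integrableOn_Icc.mono_set Ioc_subset_Icc_self
    constructor
    · have hbc : ContinuousOn (barrier n) (uIcc 0 t) := by
        refine (continuousOn_barrier hnpos).mono ?_
        rw [uIcc_of_le ht.1]
        exact Icc_subset_Ici_self
      refine hE.polarLE_mild zero_mem_supBall (fun s b hb => semigroup_mem_supBall hc hα hS s hb)
        hint ht hx (ρ := fun s => K * barrier n s + (barrier n s - barrier n s ^ 3))
        (ContinuousOn.intervalIntegrable (by fun_prop)) (fun s hs => ?_)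
        (barrier_supersolution hn ht)
      have hs' : s ∈ Icc (0 : ℝ) (1 / 4) := ⟨hs.1.le, hs.2.le.trans ht.2⟩
      have h1 := barrier_pos hnpos hs'.1
      have h2 := barrier_le hnpos hs'.1
      refine polarLE_shiftOp_sup hn0 h1 h2 ?_ (huC s hs').1
      have h3 : barrier n s ^ 2 ≤ n ^ 2 := pow_le_pow_left₀ h1.le h2 2
      nlinarith [mul_le_mul_of_nonneg_left h3 h1.le, mul_pos h1 (pow_pos hnpos 2)]
    · refine hE.polarLE_mild h0B (fun s b hb => hJ.semigroup_contraction hS s hb) hint ht hxρ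
        (ρ := fun s => (K + 1) * (Real.exp s * ρ))
        (Continuous.intervalIntegrable (by fun_prop) _ _) (fun s hs => ?_) exp_supersolution.le
      exact polarLE_shiftOp_form hc hα hn0 (by positivity)
        (huC s ⟨hs.1.le, hs.2.le.trans ht.2⟩).2

/-- As `|u| ≤ n ≤ m`, the truncation at `m` also acts on `u` as the true cubic; with the common
shift `3m²` the defect in `norm_mild_sub_le` vanishes identically. -/
theorem norm_sub_le_of_eq_mild (hc : 0 < c) (hα : α ∈ Ioo (0 : ℝ) 2)
    (hS : IsYosidaLimit (formResolvent (emb c α)) S) {n m T : ℝ} (hn : 0 ≤ n) (hnm : n ≤ m)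
    (hm : 0 ≤ m) {x y : L2D} {u v : ℝ → L2D} (hu : Continuous u) (hv : Continuous v)
    (hun : ∀ t ∈ Icc 0 T, ∀ᵐ x ∂((volume : Measure ℝ).restrict dom), |u t x| ≤ n)
    (hum : ∀ t ∈ Icc 0 T, u t = mild S x (fun s => cubicOp hn (u s)) t)
    (hvm : ∀ t ∈ Icc 0 T, v t = mild S y (fun s => cubicOp hm (v s)) t) {t : ℝ}
    (ht : t ∈ Icc 0 T) : ‖u t - v t‖ ≤ Real.exp t * ‖x - y‖ := by
  have hR := (isFormEmbedding_emb hc hα).isUnitResolvent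
  have hint : ∀ {k : ℝ} (hk : 0 ≤ k) {w : ℝ → L2D}, Continuous w →
      IntegrableOn (fun s => cubicOp hk (w s)) (Ioc 0 T) := fun hk w hw =>
    (((continuous_cubicOp hk).comp hw).integrableOn_Icc).mono_set Ioc_subset_Icc_self
  have h := (hS.isEvolution hR).norm_mild_sub_le (hS.norm_apply_le hR) (K := 3 * m ^ 2)
    (by positivity) (hint hn hu) (hint hm hv) x y ht
  rw [← hum t ht, ← hvm t ht] at h
  refine h.trans ?_
  rw [add_le_iff_nonpos_right]
  refine le_of_eq ?_
  refine (intervalIntegral.integral_congr (g := fun _ => 0) fun s hs => ?_).trans (by simp)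
  rw [uIcc_of_le ht.1] at hs
  have hs' : s ∈ Icc 0 T := ⟨hs.1, hs.2.trans ht.2⟩
  simp only
  rw [← hum s hs', ← hvm s hs', max_eq_left, mul_zero]
  have e : (3 * m ^ 2) • (u s - v s) + (cubicOp hn (u s) - cubicOp hm (v s))
      = shiftOp hm (u s) - shiftOp hm (v s) := by
    rw [shiftOp_eq, shiftOp_eq, cubicOp_congr hn hm (hun s hs')
      ((hun s hs').mono fun x hx => hx.trans hnm)]
    module
  rw [e, sub_nonpos]
  exact norm_shiftOp_sub_le hm _ _

/-- For `|s| ≥ 1` the square is at most `|s|⁶ = |s|^{4-2α} |s|^{2+2α}`: the first factor is paid by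
the sup bound, the second by the form norm. -/
theorem sq_cubic_le {A s : ℝ} (hα : α ≤ 2) (hA : 1 ≤ A) (hs : |s| ≤ A) :
    (s - s ^ 3) ^ 2 ≤ A ^ (4 - 2 * α) * (1 + |s| ^ (2 + 2 * α)) := by
  have hA1 : 1 ≤ A ^ (4 - 2 * α) := Real.one_le_rpow hA (by linarith)
  have e : (s - s ^ 3) ^ 2 = |s| ^ 2 * (1 - |s| ^ 2) ^ 2 := by
    rw [sq_abs]; ring
  have hp : 0 ≤ |s| ^ (2 + 2 * α) := by positivity
  rw [e]
  rcases le_total |s| 1 with h | h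
  · have h1 : |s| ^ 2 ≤ 1 := pow_le_one₀ (abs_nonneg s) h
    have h2 : |s| ^ 2 * (1 - |s| ^ 2) ^ 2 ≤ 1 := by
      have : (1 - |s| ^ 2) ^ 2 ≤ 1 := pow_le_one₀ (by linarith) (by linarith [sq_nonneg |s|])
      nlinarith [sq_nonneg |s|, sq_nonneg (1 - |s| ^ 2)]
    nlinarith
  · have h1 : 1 ≤ |s| ^ 2 := one_le_pow₀ h
    have hpos : 0 < |s| := by linarith
    have h2 : |s| ^ 2 * (1 - |s| ^ 2) ^ 2 ≤ |s| ^ (6 : ℝ) := by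
      have : |s| ^ (6 : ℝ) = |s| ^ 2 * (|s| ^ 2) ^ 2 := by
        rw [show (6 : ℝ) = ((6 : ℕ) : ℝ) by norm_num, Real.rpow_natCast]; ring
      rw [this]
      exact mul_le_mul_of_nonneg_left (by nlinarith) (sq_nonneg _)
    have h3 : |s| ^ (6 : ℝ) = |s| ^ (4 - 2 * α) * |s| ^ (2 + 2 * α) := by
      rw [← Real.rpow_add hpos]; ring_nf
    have h4 : |s| ^ (4 - 2 * α) ≤ A ^ (4 - 2 * α) :=
      Real.rpow_le_rpow hpos.le hs (by linarith)
    rw [h3] at h2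
    have := mul_le_mul_of_nonneg_right h4 hp
    linarith [mul_add (A ^ (4 - 2 * α)) 1 (|s| ^ (2 + 2 * α))]

/-- With `A = t^{-1/2}` the right side becomes `C t^{α/2-1}`, integrable at `0` because `α > 0`. -/
theorem exists_norm_cubic_le (hc : 0 < c) (hα : α ∈ Ioo (0 : ℝ) 2) (M : ℝ) : ∃ C : ℝ, 0 ≤ C ∧
    ∀ v : formSpace c α, ‖v‖ ≤ M → ∀ A : ℝ, 1 ≤ A →
      (∀ᵐ x ∂((volume : Measure ℝ).restrict dom), |emb c α v x| ≤ A) → ∀ f : L2D,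
      (f =ᵐ[(volume : Measure ℝ).restrict dom] fun x => emb c α v x - emb c α v x ^ 3) →
      ‖f‖ ≤ C * A ^ (2 - α) := by
  obtain ⟨C, hC, h⟩ := exists_lintegral_rpow_le hc hα.1 M
  refine ⟨√(1 + C), by positivity, fun v hv A hA hvA f hf => ?_⟩
  have hA0 : 0 < A := by linarith
  have hA2 : 0 ≤ A ^ (4 - 2 * α) := by positivity
  have h1 : ENNReal.ofReal (‖f‖ ^ 2) ≤ ENNReal.ofReal (A ^ (4 - 2 * α) * (1 + C)) := by
    rw [ofReal_norm_sq]
    calc ∫⁻ x in dom, ENNReal.ofReal (f x ^ 2)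
        ≤ ∫⁻ x in dom, ENNReal.ofReal (A ^ (4 - 2 * α)) *
          (1 + ENNReal.ofReal (|emb c α v x| ^ (2 + 2 * α))) := by
          refine lintegral_mono_ae ?_
          filter_upwards [hf, hvA] with x h1 h2
          rw [h1, ← ENNReal.ofReal_one, ← ENNReal.ofReal_add zero_le_one (by positivity),
            ← ENNReal.ofReal_mul hA2]
          exact ENNReal.ofReal_le_ofReal (sq_cubic_le hα.2.le hA h2)
      _ = ENNReal.ofReal (A ^ (4 - 2 * α)) *
          (1 + ∫⁻ x in dom, ENNReal.ofReal (|emb c α v x| ^ (2 + 2 * α))) := by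
          rw [lintegral_const_mul' _ _ ENNReal.ofReal_ne_top, lintegral_add_left measurable_const]
          simp [dom]
      _ ≤ _ := by
          rw [ENNReal.ofReal_mul hA2, ENNReal.ofReal_add zero_le_one hC, ENNReal.ofReal_one]
          gcongr
          exact h v hv
  rw [ENNReal.ofReal_le_ofReal_iff (by positivity)] at h1
  refine le_of_sq_le_sq (h1.trans_eq ?_) (by positivity)
  rw [mul_pow, Real.sq_sqrt (by positivity), ← Real.rpow_natCast (A ^ (2 - α)),
    ← Real.rpow_mul hA0.le, mul_comm]
  congr 2
  push_cast
  ring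

theorem tendsto_norm_of_ae_tendsto {g : ℕ → L2D} {b : L2D}
    (hb : ∀ n, ∀ᵐ x ∂((volume : Measure ℝ).restrict dom), |g n x| ≤ |b x|)
    (hg : ∀ᵐ x ∂((volume : Measure ℝ).restrict dom), Tendsto (fun n => g n x) atTop (𝓝 0)) :
    Tendsto (fun n => ‖g n‖) atTop (𝓝 0) := by
  have h1 : Tendsto (fun n => ∫⁻ x in dom, ENNReal.ofReal (g n x ^ 2)) atTop
      (𝓝 (∫⁻ _ in dom, 0)) := by
    refine tendsto_lintegral_of_dominated_convergence' (fun x => ENNReal.ofReal (b x ^ 2))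
      (fun n => ((Lp.aestronglyMeasurable (g n)).aemeasurable.pow_const 2).ennreal_ofReal)
      (fun n => ?_) ?_ ?_
    · filter_upwards [hb n] with x hx
      exact ENNReal.ofReal_le_ofReal (sq_le_sq.2 hx)
    · rw [← ofReal_norm_sq]
      exact ENNReal.ofReal_ne_top
    · filter_upwards [hg] with x hx
      simpa using ENNReal.tendsto_ofReal (hx.pow 2)
  simp only [← ofReal_norm_sq, lintegral_zero] at h1
  have h4 := ((ENNReal.tendsto_toReal ENNReal.zero_ne_top).comp h1).sqrt
  refine (h4.congr fun s => ?_).trans (by simp)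
  simp only [Function.comp]
  rw [ENNReal.toReal_ofReal (by positivity), Real.sqrt_sq (norm_nonneg _)]

/-- The truncation of `u ∈ L²(D)` at height `r`. -/
def clampOp {r : ℝ} (hr : 0 ≤ r) (u : L2D) : L2D := (lipschitzWith_clamp r).compLp (clamp_zero hr) u

theorem coeFn_clampOp {r : ℝ} (hr : 0 ≤ r) (u : L2D) :
    clampOp hr u =ᵐ[(volume : Measure ℝ).restrict dom] fun x => clamp r (u x) :=
  (lipschitzWith_clamp r).coeFn_compLp (clamp_zero hr) u

theorem tendsto_clampOp (u : L2D) :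
    Tendsto (fun k : ℕ => clampOp (r := k + 2) (by positivity) u) atTop (𝓝 u) := by
  rw [tendsto_iff_norm_sub_tendsto_zero]
  have hcoe : ∀ k : ℕ, (clampOp (r := k + 2) (by positivity) u - u : L2D)
      =ᵐ[(volume : Measure ℝ).restrict dom] fun x => clamp (k + 2) (u x) - u x := by
    intro k
    filter_upwards [Lp.coeFn_sub (clampOp (r := k + 2) (by positivity) u) u,
      coeFn_clampOp (r := k + 2) (by positivity) u] with x h1 h2
    rw [h1, Pi.sub_apply, h2]
  refine tendsto_norm_of_ae_tendsto (b := u) (fun k => ?_) ?_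
  · filter_upwards [hcoe k] with x hx
    rw [hx]
    have hk : (0 : ℝ) < k + 2 := by positivity
    unfold clamp
    rcases max_cases (-((k : ℝ) + 2)) (min (u x) (k + 2)) with h1 | h1 <;>
    rcases min_cases (u x) ((k : ℝ) + 2) with h2 | h2 <;>
    rw [h1.1] <;> try rw [h2.1]
    all_goals
      rcases abs_cases (u x) with h3 | h3 <;> rw [h3.1, abs_le] <;> constructor <;> linarith
  · filter_upwards [ae_all_iff.2 hcoe] with x hx
    refine tendsto_const_nhds.congr' ?_
    filter_upwards [eventually_ge_atTop ⌈|u x|⌉₊] with k hk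
    rw [hx, clamp_of_abs_le, sub_self]
    have := Nat.ceil_le.1 hk
    linarith

end Existence

/-! ### Uniqueness through the vanishing defect. -/

section Uniqueness

variable {c α : ℝ} {S : ℝ → L2D →L[ℝ] L2D}

/-- The one-sided Lipschitz bound of `s - s³`, in a form that is stable under mild formulations. -/
theorem tendsto_defect {u v f g : L2D}
    (hf : ∀ᵐ x ∂((volume : Measure ℝ).restrict dom), f x = u x - u x ^ 3)
    (hg : ∀ᵐ x ∂((volume : Measure ℝ).restrict dom), g x = v x - v x ^ 3) :
    Tendsto (fun k : ℕ => max 0 (‖(k : ℝ) • (u - v) + (f - g)‖ - (k + 1) * ‖u - v‖)) atTop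
      (𝓝 0) := by
  -- Pointwise `f - g = (1 - q)(u - v)`. The product `q (u - v)` is in `L²(D)` because `f` and `g`
  -- are, although neither cubic is assumed bounded.
  set q : ℝ → ℝ := fun x => u x ^ 2 + u x * v x + v x ^ 2 with hq
  have hq0 : ∀ x, 0 ≤ q x := fun x => by
    simp only [hq]
    nlinarith [sq_nonneg (u x + v x), sq_nonneg (u x), sq_nonneg (v x)]
  set b : L2D := (u - v) - (f - g)
  have hw := Lp.coeFn_sub u v
  have hd := Lp.coeFn_sub f g
  have hb : ∀ᵐ x ∂((volume : Measure ℝ).restrict dom), b x = q x * (u x - v x) := by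
    filter_upwards [hf, hg, hw, hd, Lp.coeFn_sub (u - v) (f - g)] with x h1 h2 h3 h4 h5
    rw [h5, Pi.sub_apply, h3, h4, Pi.sub_apply, Pi.sub_apply, h1, h2]
    simp only [hq]
    ring
  have hum := (Lp.aestronglyMeasurable u).aemeasurable
  have hvm := (Lp.aestronglyMeasurable v).aemeasurable
  have hle : ∀ (k : ℕ) x, |max (q x - 2 * (k + 1)) 0 * (u x - v x)| ≤ |q x * (u x - v x)| := by
    intro k x
    rw [abs_mul, abs_mul, abs_of_nonneg (le_max_right _ _), abs_of_nonneg (hq0 x)]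
    exact mul_le_mul_of_nonneg_right (max_le (by linarith [k.cast_nonneg (α := ℝ)]) (hq0 x))
      (abs_nonneg _)
  have hmem : ∀ k : ℕ, MemLp (fun x => max (q x - 2 * (k + 1)) 0 * (u x - v x)) 2
      ((volume : Measure ℝ).restrict dom) := by
    intro k
    refine (Lp.memLp b).of_le (AEMeasurable.aestronglyMeasurable ?_) ?_
    · have hqm : AEMeasurable q ((volume : Measure ℝ).restrict dom) :=
        ((hum.pow_const 2).add (hum.mul hvm)).add (hvm.pow_const 2)
      exact ((hqm.sub_const _).max aemeasurable_const).mul (hum.sub hvm)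
    · filter_upwards [hb] with x hx
      rw [hx, Real.norm_eq_abs, Real.norm_eq_abs]
      exact hle k x
  -- `G k` is the least multiple of `u - v` that brings the multiplier `k + 1 - q` back into
  -- `[-(k+1), k+1]`. It is dominated by `q |u - v|` and vanishes at each point once `2(k+1) ≥ q`,
  -- so its norm tends to `0` and bounds the defect.
  set G : ℕ → L2D := fun k => (hmem k).toLp _
  have hG : ∀ k, G k =ᵐ[(volume : Measure ℝ).restrict dom]
      fun x => max (q x - 2 * (k + 1)) 0 * (u x - v x) := fun k => (hmem k).coeFn_toLp
  have hlim : Tendsto (fun k => ‖G k‖) atTop (𝓝 0) := by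
    refine tendsto_norm_of_ae_tendsto (b := b) (fun k => ?_) ?_
    · filter_upwards [hb, hG k] with x h1 h2
      rw [h1, h2]
      exact hle k x
    · filter_upwards [ae_all_iff.2 hG] with x hx
      refine tendsto_const_nhds.congr' ?_
      filter_upwards [eventually_ge_atTop ⌈q x⌉₊] with k hk
      have := Nat.ceil_le.1 hk
      rw [hx, max_eq_right (by linarith [hq0 x]), zero_mul]
  refine tendsto_of_tendsto_of_tendsto_of_le_of_le tendsto_const_nhds hlim
    (fun k => le_max_left _ _) (fun k => max_le (norm_nonneg _) ?_)
  have h1 : ‖(k : ℝ) • (u - v) + (f - g) + G k‖ ≤ ‖((k : ℝ) + 1) • (u - v)‖ := by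
    refine Lp.norm_le_norm_of_ae_le ?_
    filter_upwards [hf, hg, hw, hd, hG k, Lp.coeFn_smul (k : ℝ) (u - v),
      Lp.coeFn_smul ((k : ℝ) + 1) (u - v), Lp.coeFn_add ((k : ℝ) • (u - v)) (f - g),
      Lp.coeFn_add ((k : ℝ) • (u - v) + (f - g)) (G k)] with x h1 h2 h3 h4 h5 h6 h7 h8 h9
    rw [h9, Pi.add_apply, h8, Pi.add_apply, h6, h7, Pi.smul_apply, Pi.smul_apply, h3, h4, h5,
      Pi.sub_apply, Pi.sub_apply, h1, h2, smul_eq_mul, smul_eq_mul]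
    have e : (k : ℝ) * (u x - v x) + (u x - u x ^ 3 - (v x - v x ^ 3))
        + max (q x - 2 * (k + 1)) 0 * (u x - v x)
        = (k + 1 - q x + max (q x - 2 * (k + 1)) 0) * (u x - v x) := by
      simp only [hq]
      ring
    rw [e, norm_mul, norm_mul]
    refine mul_le_mul_of_nonneg_right ?_ (norm_nonneg _)
    have hk : (0 : ℝ) ≤ k := k.cast_nonneg
    rw [Real.norm_eq_abs, Real.norm_of_nonneg (by positivity), abs_le]
    rcases max_cases (q x - 2 * ((k : ℝ) + 1)) 0 with h | h <;> rw [h.1] <;>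
    constructor <;> linarith [hq0 x]
  have h2 := norm_sub_le ((k : ℝ) • (u - v) + (f - g) + G k) (G k)
  rw [add_sub_cancel_right] at h2
  rw [norm_smul, Real.norm_of_nonneg (by positivity)] at h1
  linarith

theorem IsSolution.unique (hc : 0 < c) (hα : α ∈ Ioo (0 : ℝ) 2)
    (hS : IsYosidaLimit (formResolvent (emb c α)) S) {T : ℝ} {u₀ : L2D} {u v : ℝ → L2D}
    (hu : IsSolution α T S u₀ u) (hv : IsSolution α T S u₀ v) {t : ℝ} (ht : t ∈ Icc 0 T) :
    u t = v t := by
  have hR := (isFormEmbedding_emb hc hα).isUnitResolvent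
  have huc := hu.1.continuousOn
  have hvc := hv.1.continuousOn
  obtain ⟨-, F, hF, hFu, hum⟩ := hu
  obtain ⟨-, G, hG, hGv, hvm⟩ := hv
  have hsub : Ioc 0 t ⊆ Ioc 0 T := Ioc_subset_Ioc_right ht.2
  have hd : IntegrableOn (fun s => ‖F s - G s‖) (Ioc 0 t) := ((hF.sub hG).mono_set hsub).norm
  set e : ℕ → ℝ → ℝ := fun k s => Real.exp (t - s) *
    max 0 (‖(k : ℝ) • (u s - v s) + (F s - G s)‖ - (k + 1) * ‖u s - v s‖)
  have hle : ∀ k : ℕ, ‖u t - v t‖ ≤ ∫ s in (0 : ℝ)..t, e k s := by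
    intro k
    have h := (hS.isEvolution hR).norm_mild_sub_le (hS.norm_apply_le hR) (K := k) k.cast_nonneg hF hG
      u₀ u₀ ht
    have h1 : ∀ s ∈ Icc 0 T, mild S u₀ F s = u s := fun s hs => (hum s hs).symm
    have h2 : ∀ s ∈ Icc 0 T, mild S u₀ G s = v s := fun s hs => (hvm s hs).symm
    rw [h1 t ht, h2 t ht, sub_self, norm_zero, mul_zero, zero_add] at h
    refine h.trans_eq (intervalIntegral.integral_congr fun s hs => ?_)
    rw [uIcc_of_le ht.1] at hs
    have hs' : s ∈ Icc 0 T := ⟨hs.1, hs.2.trans ht.2⟩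
    simp only [h1 s hs', h2 s hs', e]
  have hlim : Tendsto (fun k => ∫ s in (0 : ℝ)..t, e k s) atTop (𝓝 (∫ _ in (0 : ℝ)..t, 0)) := by
    simp only [intervalIntegral.integral_of_le ht.1]
    -- The triangle inequality bounds the defect by `‖F s - G s‖` for every `k`, and this is
    -- integrable since both forcings are.
    refine tendsto_integral_of_dominated_convergence (fun s => Real.exp t * ‖F s - G s‖)
      (fun k => ?_) (hd.const_mul _) (fun k => ?_) ?_
    · have hw : AEStronglyMeasurable (fun s => u s - v s) (volume.restrict (Ioc 0 t)) :=
        (((huc.sub hvc).mono (Icc_subset_Icc_right ht.2)).mono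
          Ioc_subset_Icc_self).aestronglyMeasurable measurableSet_Ioc
      have hFG := ((hF.sub hG).mono_set hsub).aestronglyMeasurable
      refine AEStronglyMeasurable.mul (Continuous.aestronglyMeasurable (by fun_prop)) ?_
      exact aestronglyMeasurable_const.sup
        (((hw.const_smul (k : ℝ)).add hFG).norm.sub (hw.norm.const_mul _))
    · filter_upwards [ae_restrict_mem measurableSet_Ioc] with s hs
      rw [Real.norm_of_nonneg (by positivity)]
      refine mul_le_mul (Real.exp_le_exp.2 (by linarith [hs.1])) (max_le (norm_nonneg _) ?_)
        (le_max_left _ _) (Real.exp_pos _).le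
      have := norm_add_le ((k : ℝ) • (u s - v s)) (F s - G s)
      rw [norm_smul, Real.norm_of_nonneg k.cast_nonneg] at this
      linarith [norm_nonneg (u s - v s)]
    · filter_upwards [ae_restrict_of_ae_restrict_of_subset hsub hFu,
        ae_restrict_of_ae_restrict_of_subset hsub hGv] with s h1 h2
      simpa using (tendsto_defect h1 h2).const_mul (Real.exp (t - s))
  rw [intervalIntegral.integral_zero] at hlim
  have := ge_of_tendsto' hlim hle
  exact sub_eq_zero.1 (norm_le_zero_iff.1 this)

end Uniqueness

/-! ### Passage to the limit, and existence for data in the form domain. -/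

section Existence

variable {c α : ℝ} {S : ℝ → L2D →L[ℝ] L2D}

/-- Clamping the datum does not increase its form norm, so both bounds on the approximations are
uniform in `k`. At each positive time all solutions lie below `t^{-1/2}`, so the truncated cubics
agree with one fixed Lipschitz operator; this gives convergence of the forcing, dominated by `C
t^{α/2-1}`. -/
theorem exists_mild_solution (hc : 0 < c) (hα : α ∈ Ioo (0 : ℝ) 2)
    (hS : IsYosidaLimit (formResolvent (emb c α)) S) (v₀ : formSpace c α) :
    ∃ (u F : ℝ → L2D) (C : ℝ), 0 ≤ C ∧ IntegrableOn F (Ioc 0 (1 / 4)) ∧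
      (∀ t ∈ Ioc (0 : ℝ) (1 / 4), F t =ᵐ[(volume : Measure ℝ).restrict dom]
        fun x => u t x - u t x ^ 3) ∧
      (∀ t ∈ Ioc (0 : ℝ) (1 / 4), ‖F t‖ ≤ C * t ^ (α / 2 - 1)) ∧
      (∀ t ∈ Icc (0 : ℝ) (1 / 4), u t = mild S (emb c α v₀) F t) ∧
      ∀ t ∈ Icc (0 : ℝ) (1 / 4), ∃ w, emb c α w = u t ∧ ‖w‖ ≤ Real.exp t * ‖v₀‖ := by
  have hJ := isFormEmbedding_emb hc hα
  have hR := hJ.isUnitResolvent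
  have hE := hS.isEvolution hR
  have hn0 : ∀ k : ℕ, (0 : ℝ) ≤ k + 2 := fun k => by positivity
  have hn : ∀ k : ℕ, (2 : ℝ) ≤ k + 2 := fun k => by linarith [k.cast_nonneg (α := ℝ)]
  set x := emb c α v₀
  set y : ℕ → L2D := fun k => clampOp (hn0 k) x
  have hyx : Tendsto y atTop (𝓝 x) := tendsto_clampOp x
  have hy : ∀ k : ℕ, PolarLE supBall (k + 2) (y k) := by
    intro k
    refine polarLE_of_ae_abs_le (by linarith [hn k]) ?_
    filter_upwards [coeFn_clampOp (hn0 k) x] with z hz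
    rw [hz]
    exact abs_clamp_le (hn0 k) _
  have hyV : ∀ k, PolarLE (emb c α '' Metric.closedBall 0 1) ‖v₀‖ (y k) := by
    intro k
    obtain ⟨w, hw, hwv⟩ := exists_formSpace_comp hc hα (lipschitzWith_clamp (k + 2))
      (clamp_zero (hn0 k)) v₀
    have := polarLE_of_norm_le (J := emb c α) (r := ‖v₀‖) (hwv.trans_eq (by simp))
    rwa [hw] at this
  choose u huc huB hum using fun k : ℕ => exists_truncated_solution hc hα hS (hn k) (hn0 k)
    (norm_nonneg v₀) (hy k) (hyV k)
  have hnpos : ∀ k : ℕ, (0 : ℝ) < k + 2 := fun k => by linarith [hn k]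
  have hun : ∀ k, ∀ t ∈ Icc (0 : ℝ) (1 / 4),
      ∀ᵐ z ∂((volume : Measure ℝ).restrict dom), |u k t z| ≤ k + 2 := fun k t ht =>
    (ae_abs_le_of_polarLE (barrier_pos (hnpos k) ht.1) (huB k t ht).1).mono fun z hz =>
      hz.trans (barrier_le (hnpos k) ht.1)
  have hsup : ∀ t ∈ Ioc (0 : ℝ) (1 / 4), ∀ k, PolarLE supBall (1 / √t) (u k t) := fun t ht k =>
    (huB k t ⟨ht.1.le, ht.2⟩).1.mono zero_mem_supBall (barrier_le_inv_sqrt ht.1)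
  have hcau : ∀ t ∈ Icc (0 : ℝ) (1 / 4), ∃ z, Tendsto (fun k => u k t) atTop (𝓝 z) := by
    intro t ht
    have hdist : ∀ k l, k ≤ l → ‖u k t - u l t‖ ≤ Real.exp t * ‖y k - y l‖ := by
      intro k l hkl
      refine norm_sub_le_of_eq_mild hc hα hS (hn0 k) ?_ (hn0 l) (huc k) (huc l) (hun k) (hum k)
        (hum l) ht
      exact add_le_add_left (Nat.cast_le.2 hkl) 2
    refine cauchySeq_tendsto_of_complete (Metric.cauchySeq_iff.2 fun ε hε => ?_)
    obtain ⟨N, hN⟩ := Metric.cauchySeq_iff.1 hyx.cauchySeq (ε / Real.exp t) (by positivity)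
    refine ⟨N, fun k hk l hl => ?_⟩
    have h1 := hN k hk l hl
    rw [lt_div_iff₀ (Real.exp_pos t), mul_comm] at h1
    rcases le_total k l with h | h
    · rw [dist_eq_norm] at h1 ⊢
      exact (hdist k l h).trans_lt h1
    · rw [dist_comm] at h1 ⊢
      rw [dist_eq_norm] at h1 ⊢
      exact (hdist l k h).trans_lt h1
  have hex : ∀ t, ∃ z, t ∈ Icc (0 : ℝ) (1 / 4) → Tendsto (fun k => u k t) atTop (𝓝 z) := by
    intro t
    by_cases ht : t ∈ Icc (0 : ℝ) (1 / 4)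
    · obtain ⟨z, hz⟩ := hcau t ht
      exact ⟨z, fun _ => hz⟩
    · exact ⟨0, fun h => absurd h ht⟩
  choose U hU using hex
  have hpos : ∀ t : ℝ, 0 ≤ 1 / √t := fun t => by positivity
  -- The truncation height `1/√t` depends on time: it is just large enough to leave `U t` unchanged.
  -- At `t = 0` the value is junk, but only `Ioc 0 (1/4)` matters.
  set F : ℝ → L2D := fun t => cubicOp (hpos t) (U t)
  have hUV : ∀ t ∈ Icc (0 : ℝ) (1 / 4),
      PolarLE (emb c α '' Metric.closedBall 0 1) (Real.exp t * ‖v₀‖) (U t) := fun t ht =>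
    PolarLE.of_tendsto (hU t ht) tendsto_const_nhds (.of_forall fun k => (huB k t ht).2)
  have hUsup : ∀ t ∈ Ioc (0 : ℝ) (1 / 4), PolarLE supBall (1 / √t) (U t) := fun t ht =>
    PolarLE.of_tendsto (hU t ⟨ht.1.le, ht.2⟩) tendsto_const_nhds (.of_forall (hsup t ht))
  have hFk : ∀ t ∈ Ioc (0 : ℝ) (1 / 4), ∀ k, cubicOp (hn0 k) (u k t) = cubicOp (hpos t) (u k t) :=
    fun t ht k => cubicOp_congr _ _ (hun k t ⟨ht.1.le, ht.2⟩)
      (ae_abs_le_of_polarLE (one_div_pos.2 (Real.sqrt_pos.2 ht.1)) (hsup t ht k))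
  have hFlim : ∀ t ∈ Ioc (0 : ℝ) (1 / 4),
      Tendsto (fun k => cubicOp (hn0 k) (u k t)) atTop (𝓝 (F t)) := by
    intro t ht
    simp only [hFk t ht]
    exact ((continuous_cubicOp (hpos t)).tendsto _).comp (hU t ⟨ht.1.le, ht.2⟩)
  obtain ⟨C, hC, hbound⟩ := exists_norm_cubic_le hc hα (Real.exp 1 * ‖v₀‖)
  have hnorm : ∀ t ∈ Ioc (0 : ℝ) (1 / 4), ∀ z : L2D, PolarLE supBall (1 / √t) z →
      PolarLE (emb c α '' Metric.closedBall 0 1) (Real.exp t * ‖v₀‖) z →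
      ‖cubicOp (hpos t) z‖ ≤ C * t ^ (α / 2 - 1) := by
    intro t ht z h1 h2
    have hsq := Real.sqrt_pos.2 ht.1
    obtain ⟨w, rfl, hw⟩ := hJ.exists_of_polarLE (by positivity) h2
    have h3 := ae_abs_le_of_polarLE (one_div_pos.2 hsq) h1
    have h4 : 1 ≤ 1 / √t := by
      rw [le_div_iff₀ hsq, one_mul, Real.sqrt_le_one]
      linarith [ht.2]
    have h5 := hbound w (hw.trans (mul_le_mul_of_nonneg_right
      (Real.exp_le_exp.2 (by linarith [ht.2])) (norm_nonneg _))) _ h4 h3 _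
      (coeFn_cubicOp_of_le (hpos t) h3)
    refine h5.trans_eq ?_
    rw [one_div, Real.sqrt_eq_rpow, ← Real.rpow_neg ht.1.le, ← Real.rpow_mul ht.1.le]
    congr 2
    ring
  have hbint : IntegrableOn (fun t => C * t ^ (α / 2 - 1)) (Ioc (0 : ℝ) (1 / 4)) := by
    have := intervalIntegral.intervalIntegrable_rpow' (a := 0) (b := 1 / 4) (r := α / 2 - 1)
      (by linarith [hα.1])
    rw [intervalIntegrable_iff_integrableOn_Ioc_of_le (by norm_num)] at this
    exact this.const_mul C
  have hFbound : ∀ t ∈ Ioc (0 : ℝ) (1 / 4), ‖F t‖ ≤ C * t ^ (α / 2 - 1) := fun t ht =>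
    hnorm t ht _ (hUsup t ht) (hUV t ⟨ht.1.le, ht.2⟩)
  have hFmeas : ∀ k, AEStronglyMeasurable (fun s => cubicOp (hn0 k) (u k s))
      ((volume : Measure ℝ).restrict (Ioc 0 (1 / 4))) := fun k =>
    ((continuous_cubicOp (hn0 k)).comp (huc k)).aestronglyMeasurable
  have hFint : IntegrableOn F (Ioc 0 (1 / 4)) := by
    refine hbint.mono' (aestronglyMeasurable_of_tendsto_ae atTop hFmeas ?_) ?_
    · filter_upwards [ae_restrict_mem measurableSet_Ioc] with t ht using hFlim t ht
    · filter_upwards [ae_restrict_mem measurableSet_Ioc] with t ht using hFbound t ht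
  refine ⟨U, F, C, hC, hFint, fun t ht => coeFn_cubicOp_of_le (hpos t) (ae_abs_le_of_polarLE
    (one_div_pos.2 (Real.sqrt_pos.2 ht.1)) (hUsup t ht)), hFbound, fun t ht => ?_, fun t ht =>
    hJ.exists_of_polarLE (by positivity) (hUV t ht)⟩
  refine tendsto_nhds_unique (hU t ht) ?_
  have hsub : Ioc 0 t ⊆ Ioc 0 (1 / 4) := Ioc_subset_Ioc_right ht.2
  have h1 : Tendsto (fun k => ∫ s in (0 : ℝ)..t, S (t - s) (cubicOp (hn0 k) (u k s))) atTop
      (𝓝 (∫ s in (0 : ℝ)..t, S (t - s) (F s))) := by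
    simp only [intervalIntegral.integral_of_le ht.1]
    refine tendsto_integral_of_dominated_convergence (fun s => C * s ^ (α / 2 - 1))
      (fun k => hE.aestronglyMeasurable ((hFmeas k).mono_set hsub) t) (hbint.mono_set hsub)
      (fun k => ?_) ?_
    · filter_upwards [ae_restrict_mem measurableSet_Ioc] with s hs
      refine (hS.norm_apply_le hR _ _).trans ?_
      rw [hFk s (hsub hs) k]
      exact hnorm s (hsub hs) _ (hsup s (hsub hs) k) (huB k s ⟨hs.1.le, (hsub hs).2⟩).2
    · filter_upwards [ae_restrict_mem measurableSet_Ioc] with s hs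
      exact ((S (t - s)).continuous.tendsto _).comp (hFlim s (hsub hs))
  refine Tendsto.congr (fun k => (hum k t ht).symm) ?_
  exact (((S t).continuous.tendsto x).comp hyx).add h1

/-- At `t = 0` the bound `e^t ‖v₀‖` converges to the norm of the limit, so `tendsto_of_norm_le`
applies. At `t > 0` the forcing is bounded after time `t/2`, as `tendsto_mild` requires. -/
theorem exists_isSolution (hc : 0 < c) (hα : α ∈ Ioo (0 : ℝ) 2)
    (hS : IsYosidaLimit (formResolvent (emb c α)) S) {u₀ : L2D} (hu₀ : MemH0 α u₀) :
    ∃ u, IsSolution α (1 / 4) S u₀ u := by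
  have hJ := isFormEmbedding_emb hc hα
  obtain ⟨v₀, rfl⟩ := (memH0_iff hc hα u₀).1 hu₀
  obtain ⟨u, F, C, hC, hF, hFu, hFb, hum, huV⟩ := exists_mild_solution hc hα hS v₀
  have hex : ∀ t, ∃ w : formSpace c α, t ∈ Icc (0 : ℝ) (1 / 4) →
      emb c α w = u t ∧ ‖w‖ ≤ Real.exp t * ‖v₀‖ := by
    intro t
    by_cases ht : t ∈ Icc (0 : ℝ) (1 / 4)
    · obtain ⟨z, hz⟩ := huV t ht
      exact ⟨z, fun _ => hz⟩
    · exact ⟨0, fun h => absurd h ht⟩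
  choose w hw using hex
  have hE := hS.isEvolution hJ.isUnitResolvent
  refine ⟨u, continuousH0_of_continuousOn hc hα (fun t ht => (hw t ht).1) fun t ht => ?_,
    F, hF, ?_, hum⟩
  · rcases ht.1.eq_or_lt with rfl | h0
    · have huc : ContinuousOn u (Icc 0 (1 / 4)) := (hE.continuousOn_mild hF _).congr hum
      have e0 : w 0 = v₀ := hJ.inj (by
        rw [(hw 0 ht).1, hum 0 ht, mild, intervalIntegral.integral_same, hE.zero]
        simp)
      refine hJ.tendsto_of_norm_le (r := fun t => Real.exp t * ‖v₀‖) ?_ ?_ ?_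
      · rw [(hw 0 ht).1]
        refine (huc 0 ht).tendsto.congr' ?_
        filter_upwards [self_mem_nhdsWithin] with s hs using (hw s hs).1.symm
      · have : Continuous fun t => Real.exp t * ‖v₀‖ := by fun_prop
        have h1 := (this.tendsto 0).mono_left (nhdsWithin_le_nhds (s := Icc 0 (1 / 4)))
        rw [e0]
        simpa using h1
      · filter_upwards [self_mem_nhdsWithin] with s hs using (hw s hs).2
    · refine hJ.tendsto_mild hS hF (B := C * (t / 2) ^ (α / 2 - 1)) ⟨h0, ht.2⟩ (fun τ hτ => ?_)
        fun s hs => (hw s hs).1.trans (hum s hs)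
      have hτ0 : 0 < τ := (half_pos h0).trans hτ.1
      refine (hFb τ ⟨hτ0, hτ.2.le⟩).trans (mul_le_mul_of_nonneg_left ?_ hC)
      exact Real.rpow_le_rpow_of_nonpos (half_pos h0) hτ.1.le (by linarith [hα.2])
  · filter_upwards [ae_restrict_mem measurableSet_Ioc] with t ht using hFu t ht

end Existence

end

end NonlocalGL

theorem theorem2p1 (c α : ℝ) (hc : 0 < c) (hα : α ∈ Set.Ioo (0 : ℝ) 2) :
    ∃ S : ℝ → NonlocalGL.L2D →L[ℝ] NonlocalGL.L2D,
      NonlocalGL.IsGeneratedSemigroup c α S ∧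
      ∀ u₀ : NonlocalGL.L2D, NonlocalGL.MemH0 α u₀ →
        ∃ T : ℝ, 0 < T ∧
          ∃ u : ℝ → NonlocalGL.L2D, NonlocalGL.IsSolution α T S u₀ u ∧
            ∀ v : ℝ → NonlocalGL.L2D, NonlocalGL.IsSolution α T S u₀ v →
              ∀ t ∈ Set.Icc 0 T, v t = u t := by
  obtain ⟨S, hS⟩ := (NonlocalGL.isFormEmbedding_emb hc hα).isUnitResolvent.exists_limit
  refine ⟨S, NonlocalGL.isGeneratedSemigroup hc hα hS, fun u₀ hu₀ => ?_⟩
  obtain ⟨u, hu⟩ := NonlocalGL.exists_isSolution hc hα hS hu₀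
  -- The time `1/4` is the lifetime of the barrier and does not depend on the datum.
  exact ⟨1 / 4, by norm_num, u, hu, fun v hv t ht => hv.unique hc hα hS hu ht⟩
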